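/- **The Hesse arrangement of conics.** For a finite non-empty set $Z\subset\mathbb P^2_{\mathbb C}$ put $$\varepsilon(\mathcal O_{\mathbb P^2}(1);Z)=\inf_{C}\frac{\deg C}{\sum_{p\in Z}\operatorname{mult}_p C},$$ the infimum being over all irreducible reduced plane curves $C$ meeting $Z$. For a finite arrangement $\mathcal C$ of plane curves let $\operatorname{Sing}(\mathcal C)$ be the set of singular points of the members and of points lying on at least two members, and put $$\varepsilon_{\mathcal C}(\mathcal O_{\mathbb P^2}(1))=\frac{\deg \mathcal C}{\sum_{p\in \operatorname{Sing}(\mathcal C)}\operatorname{mult}_p(\mathcal C)}.$$ Let $E\subset\mathbb P^2_{\mathbb C}$ be a smooth cubic that is not projectively equivalent to the Fermat cubic $x^3+y^3+z^3=0$. In the dual plane (identified with $\mathbb P^2_{\mathbb C}$ through the coefficients of lines) let $P$ be the set of points given by the inflectional tangents of $E$ (the cusps of the dual curve of $E$), let $\mathcal L$ be the set of lines dual to the flexes of $E$ (the dual Hesse arrangement), and let $\mathcal{CL}$ be the set of irreducible conics passing through exactly six points of $P$ (the Hesse, or Chilean, arrangement of conics). Then: 1. $\mathcal{CL}$ consists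 of exactly $12$ conics; they are smooth, all singular points of $\mathcal{CL}$ are ordinary (the curves through such a point are smooth there with pairwise distinct tangents), and no point lies on all $12$ conics. The set $P$ has exactly $9$ points, each of multiplicity $8$ in $\mathcal{CL}$; $\mathcal{CL}$ has exactly $12$ nodes (ordinary double points); and $Z:=\operatorname{Sing}(\mathcal{CL})$ is the union of $P$ and the set of nodes, so that $Z$ has $21$ points. Each conic contains exactly $6$ points of $P$ and exactly $2$ nodes. 2. $\mathcal L$ consists of exactly $9$ lines. $\operatorname{Sing}(\mathcal L)$ is the set of the $12$ nodes of $\mathcal{CL}$, and each of these is a triple point of $\mathcal L$. Each line of $\mathcal L$ contains exactly $4$ of the nodes and exactly one point of $P$. 3. There are three distinct lines of $\mathcal L$ and a conic of $\mathcal{CL}$ whose sum is a (reducible) quintic passing through all $21$ points of $Z$. 4. $\varepsilon_{\mathcal{CL}}(\mathcal O_{\mathbb P^2}(1))=\frac14$, and every conic $C\in\mathcal{CL}$ has $\deg C/\sum_{p\in Z}\operatorname{mult}_pC=\frac14$. 5. $\varepsilon(\mathcal O_{\mathbb P^2}(1);Z)=\frac15$, and the infimum is attained by every line of $\mathcal L$.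 In particular $\varepsilon(\mathcal O_{\mathbb P^2}(1);Z)<\varepsilon_{\mathcal{CL}}(\mathcal O_{\mathbb P^2}(1))$. -/

import Mathlib

open MvPolynomial
open scoped LinearAlgebra.Projectivization

/-- The complex projective plane.  The dual plane is identified with it through the coefficients of
lines: the point `q` of the dual plane is the line `∑ i, q i * x i = 0`. -/
abbrev Plane : Type := ℙ ℂ (Fin 3 → ℂ)

/-- A plane curve (effective divisor) of arbitrary degree `d`: a nonzero homogeneous form of degree
`d` in three variables, up to a nonzero scalar. -/
abbrev PlaneCurve : Type := Σ d : ℕ, ℙ ℂ (homogeneousSubmodule (Fin 3) ℂ d)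

namespace PlaneCurve

/-- The degree of a plane curve, which is also its intersection number with `O(1)`. -/
def degree (C : PlaneCurve) : ℕ := C.1

/-- An equation of a plane curve (well defined up to a nonzero scalar). -/
noncomputable def form (C : PlaneCurve) : MvPolynomial (Fin 3) ℂ := (C.2.rep).1

/-- The set of points of a plane curve. -/
def points (C : PlaneCurve) : Set Plane := {p | eval p.rep C.form = 0}

/-- The multiplicity of a curve at `p`: the least degree of a nonzero homogeneous component of the
Taylor expansion of its equation at `p`. -/
noncomputable def mult (C : PlaneCurve) (p : Plane) : ℕ :=
  sInf {n : ℕ | homogeneousComponent n (bind₁ (fun i => X i + MvPolynomial.C (p.rep i)) C.form) ≠ 0}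

/-- The gradient of the equation at `p`; where it is nonzero, its entries are the coefficients of
the tangent line at `p`. -/
noncomputable def grad (C : PlaneCurve) (p : Plane) : Fin 3 → ℂ :=
  fun i => eval p.rep (pderiv i C.form)

/-- Smoothness: every point of the curve has multiplicity one. -/
def IsSmooth (C : PlaneCurve) : Prop := ∀ p ∈ C.points, C.mult p = 1

/-- An irreducible and reduced curve. -/
def IsIntegral (C : PlaneCurve) : Prop := Irreducible C.form

/-- The flexes of a curve: its smooth points at which the tangent line meets the curve with
multiplicity at least three. -/
def flexes (C : PlaneCurve) : Set Plane :=
  {p | p ∈ C.points ∧ C.grad p ≠ 0 ∧ ∀ v : Fin 3 → ℂ, C.grad p ⬝ᵥ v = 0 →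
    (Polynomial.X : Polynomial ℂ) ^ 3 ∣
      aeval (fun i => Polynomial.C (p.rep i) + Polynomial.C (v i) * Polynomial.X) C.form}

/-- `C` is projectively equivalent to the Fermat cubic `x ^ 3 + y ^ 3 + z ^ 3 = 0`. -/
def IsFermatCubic (C : PlaneCurve) : Prop :=
  ∃ A : GL (Fin 3) ℂ, Associated C.form
    (bind₁ (fun i => ∑ j, MvPolynomial.C ((A : Matrix (Fin 3) (Fin 3) ℂ) i j) * X j)
      (X 0 ^ 3 + X 1 ^ 3 + X 2 ^ 3 : MvPolynomial (Fin 3) ℂ))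

/-- The ratio `L·C / ∑_{p ∈ Z} mult_p C` for `L = O(1)` and a finite set `Z` of points. -/
noncomputable def seshadriRatio (Z : Set Plane) (C : PlaneCurve) : ℝ :=
  (C.degree : ℝ) / ((∑ᶠ p ∈ Z, C.mult p : ℕ) : ℝ)

end PlaneCurve

/-- The multipoint Seshadri constant of `O(1)` on the plane at a finite set `Z` of points. -/
noncomputable def seshadriConstant (Z : Set Plane) : ℝ :=
  sInf {r : ℝ | ∃ C : PlaneCurve, C.IsIntegral ∧ (Z ∩ C.points).Nonempty ∧ r = C.seshadriRatio Z}

namespace Arrangement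

/-- The singular locus of an arrangement: the singular points of its members and the points where
at least two members intersect. -/
def sing (A : Set PlaneCurve) : Set Plane :=
  {p | (∃ C ∈ A, 2 ≤ C.mult p) ∨ ∃ C ∈ A, ∃ D ∈ A, C ≠ D ∧ p ∈ C.points ∧ p ∈ D.points}

/-- The multiplicity at `p` of the sum of all members of a finite arrangement. -/
noncomputable def mult (A : Set PlaneCurve) (p : Plane) : ℕ := ∑ᶠ C ∈ A, C.mult p

/-- All members through `p` are smooth there, with pairwise distinct tangent lines. -/
def IsOrdinaryAt (A : Set PlaneCurve) (p : Plane) : Prop :=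
  (∀ C ∈ A, p ∈ C.points → C.mult p = 1) ∧
  ∀ C ∈ A, ∀ D ∈ A, C ≠ D → p ∈ C.points → p ∈ D.points →
    LinearIndependent ℂ ![C.grad p, D.grad p]

/-- The nodes of an arrangement of smooth curves: its ordinary double points. -/
def nodes (A : Set PlaneCurve) : Set Plane :=
  {p | p ∈ sing A ∧ mult A p = 2 ∧ IsOrdinaryAt A p}

/-- A `d`-arrangement: at least three smooth curves of degree `d`, with only ordinary singular
points and without a point common to all of them. -/
def IsDArrangement (d : ℕ) (A : Set PlaneCurve) : Prop :=
  A.Finite ∧ 3 ≤ A.ncard ∧ (∀ C ∈ A, C.degree = d ∧ C.IsSmooth) ∧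
    (∀ p ∈ sing A, IsOrdinaryAt A p) ∧ ¬ ∃ p : Plane, ∀ C ∈ A, p ∈ C.points

/-- The configurational Seshadri constant: the degree of the arrangement divided by the sum of its
multiplicities over its singular locus. -/
noncomputable def configurationalSeshadri (A : Set PlaneCurve) : ℝ :=
  ((∑ᶠ C ∈ A, C.degree : ℕ) : ℝ) / ((∑ᶠ p ∈ sing A, mult A p : ℕ) : ℝ)

end Arrangement

/-- The points of the dual plane given by the inflectional tangents of a curve `E`.  For a smooth
cubic these are the cusps of the dual sextic. -/
def dualCusps (E : PlaneCurve) : Set Plane :=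
  {q | ∃ p ∈ E.flexes, ∃ h : E.grad p ≠ 0, q = Projectivization.mk ℂ (E.grad p) h}

/-- The Hesse arrangement of conics of a smooth cubic `E`: all irreducible conics in the dual plane
passing through exactly six of the cusps of the dual curve of `E`. -/
def hesseConics (E : PlaneCurve) : Set PlaneCurve :=
  {C | C.degree = 2 ∧ C.IsIntegral ∧ (dualCusps E ∩ C.points).ncard = 6}

/-- The dual Hesse arrangement of a smooth cubic `E`: the lines of the dual plane that are dual to
the flexes of `E` (the line dual to `p` consists of all lines through `p`). -/
def dualHesseLines (E : PlaneCurve) : Set PlaneCurve :=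
  {L | L.degree = 1 ∧ ∃ p ∈ E.flexes, L.points = {q : Plane | p.rep ⬝ᵥ q.rep = 0}}

/-! The flexes of a smooth cubic form an affine plane over the field with three elements, and the
configuration is governed by that plane. Cusps are indexed by its 9 points. Nodes and conics are
both indexed by its 12 lines: the node of `m` is the line through the three flexes of `m`, seen as a
point of the dual plane. The conic of `l` contains exactly the cusps of the points off `l` and the
nodes of the two lines parallel to `l`. The line dual to the flex `a` contains only the cusp of `a`
and the nodes of the four lines through `a`. The structure `HesseConfiguration` records these
incidences; once they are known, all counts are finite checks over the affine plane.

Geometry enters through Bézout's theorem for lines and smooth conics. These have polynomial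
parametrizations, so the theorem reduces to counting roots of a polynomial in one variable
(`IsParametrization.sum_le`). Two conics of the arrangement already share four known points, so they
have no other intersection and cross transversally at each of the four. A conic through six cusps
shares five of them with some member of the arrangement and is therefore equal to it.

For the Seshadri constant, take the three lines dual to the flexes on one affine line together with
the conic of that affine line: this quintic contains all 21 points. An integral curve `C` that is
none of the lines or conics therefore satisfies `∑ mult ≤ (1 + 1 + 1 + 2) deg C`. The lines and
conics themselves have the ratios 1/5 and 1/4.

The incidences are found in coordinates. A flex exists because the cubic meets its Hessian. From a
flex one reaches a Weierstrass form, then the form `(x + y + z)³ + k x y z`, and a discrete Fourier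
transform gives the Hesse form `x³ + y³ + z³ - 3 l x y z`. There flexes, tangents and conics are
written with cube roots of unity. The conditions `l ≠ 0`, `l³ ≠ 1` and `l³ ≠ -8` ensure that the
twelve conics are smooth and have no further incidences; `l³ = -8` gives a Fermat cubic. -/

/-! ### Common zeros and the Nullstellensatz -/

/-- Two polynomials in three variables without constant term have a common zero different from the
origin. -/
theorem exists_common_zero (F G : MvPolynomial (Fin 3) ℂ) (hF : eval 0 F = 0) (hG : eval 0 G = 0) :
    ∃ v : Fin 3 → ℂ, v ≠ 0 ∧ eval v F = 0 ∧ eval v G = 0 := by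
  by_contra! hcon
  set I : Ideal (MvPolynomial (Fin 3) ℂ) := Ideal.span {F, G} with hI
  -- `φ k` kills the first `k` variables. The kernels form a strict chain of primes from zero to the
  -- ideal of the origin, which therefore has height at least 3.
  let φ : ℕ → MvPolynomial (Fin 3) ℂ →ₐ[ℂ] MvPolynomial (Fin 3) ℂ :=
    fun k => aeval (fun i => if i.val < k then 0 else X i)
  have hφX : ∀ k i, φ k (X i) = if i.val < k then 0 else X i := fun k i => by simp [φ]
  have hcomp : ∀ j k, j ≤ k → ∀ P, φ k (φ j P) = φ k P := by
    intro j k hjk P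
    rw [← AlgHom.comp_apply]
    congr 1
    apply MvPolynomial.algHom_ext
    intro i
    rw [AlgHom.comp_apply, hφX, hφX]
    split_ifs with h1 h2 h2
    · simp
    · omega
    · simp [hφX, h2]
    · simp [hφX, h2]
  let P : ℕ → Ideal (MvPolynomial (Fin 3) ℂ) := fun k => RingHom.ker (φ k)
  have hprime : ∀ k, (P k).IsPrime := fun k => RingHom.ker_isPrime _
  have hlt : ∀ k : ℕ, k < 3 → P k < P (k + 1) := by
    intro k hk
    refine lt_of_le_of_ne ?_ ?_
    · intro Q hQ
      have : φ k Q = 0 := hQ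
      show φ (k + 1) Q = 0
      rw [← hcomp k (k + 1) (by omega), this, map_zero]
    · intro h
      have h1 : (X ⟨k, hk⟩ : MvPolynomial (Fin 3) ℂ) ∈ P (k + 1) := by
        show φ (k + 1) _ = 0
        simp [hφX]
      rw [← h] at h1
      have : φ k (X ⟨k, hk⟩) = 0 := h1
      simp [hφX] at this
  have hheight : ∀ k : ℕ, k ≤ 3 → (k : ℕ∞) ≤ (P k).height := by
    intro k
    induction k with
    | zero => simp
    | succ k ih =>
      intro hk
      have := hprime k
      have := hprime (k + 1)
      have h2 := Ideal.height_add_one_le_of_lt_of_isPrime (hlt k (by omega))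
      push_cast
      exact le_trans (by gcongr; exact ih (by omega)) h2
  have hP3 : ∀ Q, Q ∈ P 3 ↔ eval 0 Q = 0 := by
    intro Q
    have : φ 3 Q = C (eval 0 Q) := by
      have h3 : φ 3 = (Algebra.ofId ℂ (MvPolynomial (Fin 3) ℂ)).comp (aeval 0) := by
        apply MvPolynomial.algHom_ext
        intro i
        simp [hφX, i.2]
      rw [h3]
      simp [Algebra.ofId_apply, algebraMap_eq]
    show φ 3 Q = 0 ↔ _
    rw [this]
    simp
  have hIP : I ≤ P 3 := by
    rw [hI, Ideal.span_le]
    rintro Q (rfl | rfl)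
    · exact (hP3 _).2 hF
    · exact (hP3 _).2 hG
  -- If the origin were the only common zero, the Nullstellensatz would put every variable into the
  -- radical of `I`, and the ideal of the origin would be a minimal prime over `I`.
  have hrad : ∀ i, (X i : MvPolynomial (Fin 3) ℂ) ∈ I.radical := by
    intro i
    rw [← MvPolynomial.vanishingIdeal_zeroLocus_eq_radical (K := ℂ), mem_vanishingIdeal_iff]
    intro v hv
    rw [mem_zeroLocus_iff] at hv
    by_cases h0 : v = 0
    · simp [h0]
    · exact absurd (by simpa using hv G (Ideal.subset_span (by simp)))
        (hcon v h0 (by simpa using hv F (Ideal.subset_span (by simp))))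
  have hmin : P 3 ∈ I.minimalPrimes := by
    refine ⟨⟨hprime 3, hIP⟩, ?_⟩
    rintro J ⟨hJ, hIJ⟩ - Q hQ
    have hX : ∀ i, (X i : MvPolynomial (Fin 3) ℂ) ∈ J := fun i =>
      (hJ.radical_le_iff.2 hIJ) (hrad i)
    have h1 : Q - φ 3 Q ∈ J := by
      have : (Ideal.Quotient.mkₐ ℂ J).comp (φ 3) = Ideal.Quotient.mkₐ ℂ J := by
        apply MvPolynomial.algHom_ext
        intro i
        have := Ideal.Quotient.eq_zero_iff_mem.2 (hX i)
        simp [hφX, i.2, this]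
      rw [← Ideal.Quotient.eq]
      exact (DFunLike.congr_fun this Q).symm
    have h2 : φ 3 Q = 0 := hQ
    simpa [h2] using h1
  -- Krull's height theorem bounds the height by the number of generators, at most 2.
  have h1 := Ideal.height_le_card_of_mem_minimalPrimes_span (s := {F, G})
    (Set.toFinite _) hmin
  have h2 := hheight 3 le_rfl
  have h3 : (3 : ℕ∞) ≤ (({F, G} : Set (MvPolynomial (Fin 3) ℂ)).encard) := by
    rw [← Set.Finite.cast_ncard_eq (Set.toFinite _)]
    exact h2.trans h1
  have h4 := h3.trans (Set.encard_insert_le {G} F)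
  rw [Set.encard_singleton] at h4
  norm_num at h4

/-- A polynomial vanishing on the zeros of an irreducible one is a multiple of it. -/
theorem Irreducible.dvd_of_forall_eval {K F : MvPolynomial (Fin 3) ℂ} (hK : Irreducible K)
    (h : ∀ v, eval v K = 0 → eval v F = 0) : K ∣ F := by
  have hp : (Ideal.span {K}).IsPrime := (Ideal.span_singleton_prime hK.ne_zero).2 hK.prime
  rw [← Ideal.mem_span_singleton, ← MvPolynomial.IsPrime.vanishingIdeal_zeroLocus (K := ℂ)
    (Ideal.span {K}), mem_vanishingIdeal_iff]
  intro v hv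
  rw [mem_zeroLocus_iff] at hv
  simpa using h v (by simpa using hv K (Ideal.mem_span_singleton_self K))

/-! ### Linear substitutions -/

/-- Linear substitution: the composite of a polynomial with the linear map given by a matrix. -/
noncomputable def linSubst (N : Matrix (Fin 3) (Fin 3) ℂ) :
    MvPolynomial (Fin 3) ℂ →ₐ[ℂ] MvPolynomial (Fin 3) ℂ :=
  bind₁ (fun i => ∑ j, C (N i j) * X j)

theorem linSubst_X (N : Matrix (Fin 3) (Fin 3) ℂ) (i : Fin 3) :
    linSubst N (X i) = ∑ j, C (N i j) * X j := bind₁_X_right _ _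

theorem linSubst_C (N : Matrix (Fin 3) (Fin 3) ℂ) (c : ℂ) : linSubst N (C c) = C c :=
  bind₁_C_right _ _

theorem linSubst_one (F : MvPolynomial (Fin 3) ℂ) : linSubst 1 F = F := by
  have : linSubst 1 = AlgHom.id ℂ (MvPolynomial (Fin 3) ℂ) := by
    apply MvPolynomial.algHom_ext
    intro i
    simp [linSubst_X, Matrix.one_apply, apply_ite C, ite_mul]
  rw [this, AlgHom.id_apply]

theorem linSubst_linSubst (N M : Matrix (Fin 3) (Fin 3) ℂ) (F : MvPolynomial (Fin 3) ℂ) :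
    linSubst N (linSubst M F) = linSubst (M * N) F := by
  have : (linSubst N).comp (linSubst M) = linSubst (M * N) := by
    apply MvPolynomial.algHom_ext
    intro i
    simp only [AlgHom.comp_apply, linSubst_X, map_sum, map_mul, linSubst_C, Matrix.mul_apply,
      Finset.mul_sum, Finset.sum_mul, ← mul_assoc]
    rw [Finset.sum_comm]
  exact DFunLike.congr_fun this F

theorem eval_linSubst (N : Matrix (Fin 3) (Fin 3) ℂ) (F : MvPolynomial (Fin 3) ℂ)
    (v : Fin 3 → ℂ) : eval v (linSubst N F) = eval (N.mulVec v) F := by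
  have : (eval v).comp (linSubst N).toRingHom = eval (N.mulVec v) := by
    apply MvPolynomial.ringHom_ext
    · simp
    · intro i
      simp [linSubst_X, Matrix.mulVec, dotProduct]
  exact DFunLike.congr_fun this F

theorem linSubst_isHomogeneous (N : Matrix (Fin 3) (Fin 3) ℂ) {F : MvPolynomial (Fin 3) ℂ} {d : ℕ}
    (hF : F.IsHomogeneous d) : (linSubst N F).IsHomogeneous d := by
  have hN : ∀ i, (∑ j, C (N i j) * X j : MvPolynomial (Fin 3) ℂ).IsHomogeneous 1 :=
    fun i => IsHomogeneous.sum _ _ 1 fun j _ => isHomogeneous_C_mul_X (N i j) j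
  have h1 := hF.aeval _ hN
  rw [one_mul] at h1
  unfold linSubst bind₁
  exact h1

/-- An invertible linear substitution is an automorphism. -/
noncomputable def linSubstEquiv (N M : Matrix (Fin 3) (Fin 3) ℂ) (h : M * N = 1) :
    MvPolynomial (Fin 3) ℂ ≃ₐ[ℂ] MvPolynomial (Fin 3) ℂ :=
  AlgEquiv.ofAlgHom (linSubst N) (linSubst M)
    (AlgHom.ext fun F => by simp [linSubst_linSubst, h, linSubst_one])
    (AlgHom.ext fun F => by simp [linSubst_linSubst, mul_eq_one_comm.1 h, linSubst_one])

/-- Partial derivatives of a linear substitution. -/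
theorem pderiv_linSubst (N : Matrix (Fin 3) (Fin 3) ℂ) (F : MvPolynomial (Fin 3) ℂ)
    (j : Fin 3) :
    pderiv j (linSubst N F) = ∑ i, C (N i j) * linSubst N (pderiv i F) := by
  induction F using MvPolynomial.induction_on with
  | C a => simp
  | add p q hp hq => simp [hp, hq, mul_add, Finset.sum_add_distrib]
  | mul_X p i hp =>
    simp only [map_mul, linSubst_X, pderiv_mul, hp, pderiv_X, map_add, mul_add,
      Finset.sum_add_distrib, Finset.sum_mul, mul_assoc]
    congr 1
    simp only [map_sum, pderiv_mul, pderiv_C, pderiv_X, Pi.single_apply]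
    simp [Finset.sum_ite_eq, mul_comm, apply_ite]

/-! ### Homogeneity, the chain rule and translations -/

/-- Scaling the arguments of a homogeneous polynomial. -/
theorem aeval_mul_of_isHomogeneous {σ A : Type*} [Fintype σ] [CommRing A] [Algebra ℂ A]
    {F : MvPolynomial σ ℂ} {d : ℕ} (hF : F.IsHomogeneous d) (c : A) (g : σ → A) :
    aeval (fun i => c * g i) F = c ^ d * aeval g F := by
  rw [aeval_def, aeval_def, eval₂_eq', eval₂_eq', Finset.mul_sum]
  refine Finset.sum_congr rfl fun m hm => ?_
  have hd : ∑ i, m i = d := by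
    have := hF (mem_support_iff.1 hm)
    rw [← this, Finsupp.weight_apply, Finsupp.sum_fintype _ _ (by simp)]
    simp
  simp only [mul_pow, Finset.prod_mul_distrib, Finset.prod_pow_eq_pow_sum, hd]
  ring

theorem eval_smul_of_isHomogeneous {σ : Type*} [Fintype σ] {F : MvPolynomial σ ℂ} {d : ℕ}
    (hF : F.IsHomogeneous d) (c : ℂ) (v : σ → ℂ) : eval (c • v) F = c ^ d * eval v F := by
  show eval (fun i => c * v i) F = _
  simpa [coe_aeval_eq_eval] using aeval_mul_of_isHomogeneous hF c v

/-- The chain rule along a polynomial path. -/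
theorem derivative_aeval_eq (g : Fin 3 → Polynomial ℂ) (F : MvPolynomial (Fin 3) ℂ) :
    Polynomial.derivative (aeval g F) =
      ∑ i, aeval g (pderiv i F) * Polynomial.derivative (g i) := by
  induction F using MvPolynomial.induction_on with
  | C a => simp
  | add p q hp hq => simp [hp, hq, add_mul, Finset.sum_add_distrib]
  | mul_X p i hp =>
    simp only [map_mul, aeval_X, Polynomial.derivative_mul, hp, pderiv_mul, map_add, add_mul,
      Finset.sum_add_distrib, pderiv_X, Finset.sum_mul]
    rw [add_comm]
    simp only [Pi.single_apply, apply_ite (aeval g), mul_ite, ite_mul, map_one, map_zero]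
    simp [add_comm, mul_right_comm]

/-- Partial derivatives commute with translations. -/
theorem pderiv_bind₁_translate (v : Fin 3 → ℂ) (F : MvPolynomial (Fin 3) ℂ) (j : Fin 3) :
    pderiv j (bind₁ (fun i => X i + C (v i)) F) =
      bind₁ (fun i => X i + C (v i)) (pderiv j F) := by
  induction F using MvPolynomial.induction_on with
  | C a => simp
  | add p q hp hq => simp [hp, hq]
  | mul_X p i hp =>
    simp only [map_mul, bind₁_X_right, pderiv_mul, hp, pderiv_X, map_add, pderiv_C, add_zero]
    by_cases h : i = j <;> simp [h]

/-- A homogeneous component of degree `k` contributes a factor `x ^ k`, and the components of degree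
below `m` vanish. -/
theorem pow_dvd_aeval_of_homogeneousComponent {A : Type*} [CommRing A] [Algebra ℂ A]
    (G : MvPolynomial (Fin 3) ℂ) (m : ℕ) (hG : ∀ k < m, homogeneousComponent k G = 0)
    (x : A) (h : Fin 3 → A) : x ^ m ∣ aeval (fun i => x * h i) G := by
  rw [← sum_homogeneousComponent G, map_sum]
  refine Finset.dvd_sum fun k _ => ?_
  rcases lt_or_ge k m with hk | hk
  · simp [hG k hk]
  · rw [aeval_mul_of_isHomogeneous (homogeneousComponent_isHomogeneous k G)]
    exact (pow_dvd_pow x hk).mul_right _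

/-! ### Equations, points and multiplicities of plane curves -/

namespace PlaneCurve

theorem form_isHomogeneous (C : PlaneCurve) : C.form.IsHomogeneous C.degree :=
  (C.2.rep).2

theorem form_ne_zero (C : PlaneCurve) : C.form ≠ 0 := fun h =>
  C.2.rep_nonzero (Subtype.ext h)

/-- The curve with a given equation. -/
noncomputable def ofForm (F : MvPolynomial (Fin 3) ℂ) (d : ℕ) (hF : F.IsHomogeneous d)
    (h0 : F ≠ 0) : PlaneCurve :=
  ⟨d, Projectivization.mk ℂ (⟨F, hF⟩ : homogeneousSubmodule (Fin 3) ℂ d)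
    (fun h => h0 (congrArg Subtype.val h))⟩

theorem exists_form_ofForm (F : MvPolynomial (Fin 3) ℂ) (d : ℕ) (hF : F.IsHomogeneous d)
    (h0 : F ≠ 0) : ∃ c : ℂ, c ≠ 0 ∧ (ofForm F d hF h0).form = MvPolynomial.C c * F := by
  obtain ⟨a, ha⟩ := Projectivization.exists_smul_eq_mk_rep ℂ
    (⟨F, hF⟩ : homogeneousSubmodule (Fin 3) ℂ d) (fun h => h0 (congrArg Subtype.val h))
  refine ⟨a, a.ne_zero, ?_⟩
  have := congrArg Subtype.val ha
  rw [form, ofForm, ← this, C_mul']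
  rfl

theorem associated_form_ofForm (F : MvPolynomial (Fin 3) ℂ) (d : ℕ) (hF : F.IsHomogeneous d)
    (h0 : F ≠ 0) : Associated (ofForm F d hF h0).form F := by
  obtain ⟨c, hc, h⟩ := exists_form_ofForm F d hF h0
  rw [h]
  exact associated_unit_mul_left _ _ ((isUnit_iff_ne_zero.2 hc).map MvPolynomial.C)

/-- Curves of the same degree, one contained in the other, are equal. -/
theorem eq_of_form_dvd {C D : PlaneCurve} (hdeg : C.degree = D.degree) (h : C.form ∣ D.form) :
    C = D := by
  obtain ⟨d, c⟩ := C
  obtain ⟨d', c'⟩ := D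
  obtain rfl : d = d' := hdeg
  obtain ⟨Q, hQ⟩ := h
  have h1 := form_isHomogeneous ⟨d, c'⟩
  have h2 := form_isHomogeneous ⟨d, c⟩
  have hQ0 : Q ≠ 0 := by rintro rfl; exact form_ne_zero ⟨d, c'⟩ (by simpa using hQ)
  have h3 := congrArg totalDegree hQ
  rw [totalDegree_mul_of_isDomain (form_ne_zero ⟨d, c⟩) hQ0, h1.totalDegree (form_ne_zero _),
    h2.totalDegree (form_ne_zero _)] at h3
  simp only [degree] at h3
  rw [(totalDegree_eq_zero_iff_eq_C).1 (by omega : Q.totalDegree = 0)] at hQ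
  congr 1
  rw [← c.mk_rep, ← c'.mk_rep, Projectivization.mk_eq_mk_iff']
  refine ⟨(coeff 0 Q)⁻¹, Subtype.ext ?_⟩
  have hc : coeff 0 Q ≠ 0 := by
    intro h; rw [h] at hQ; exact form_ne_zero ⟨d, c'⟩ (by simpa using hQ)
  have hQ' : (c'.rep).1 = (c.rep).1 * MvPolynomial.C (coeff 0 Q) := hQ
  show (coeff 0 Q)⁻¹ • (c'.rep).1 = _
  rw [hQ', mul_comm, C_mul', smul_smul, inv_mul_cancel₀ hc, one_smul]

theorem mem_points {C : PlaneCurve} {p : Plane} : p ∈ C.points ↔ eval p.rep C.form = 0 := Iff.rfl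

theorem mk_mem_points {C : PlaneCurve} {v : Fin 3 → ℂ} (hv : v ≠ 0) :
    Projectivization.mk ℂ v hv ∈ C.points ↔ eval v C.form = 0 := by
  obtain ⟨a, ha⟩ := Projectivization.exists_smul_eq_mk_rep ℂ v hv
  rw [mem_points, ← ha]
  have := eval_smul_of_isHomogeneous C.form_isHomogeneous (a : ℂ) v
  rw [Units.smul_def, this]
  simp

/-- Translation is invertible, so the translated equation is nonzero. Hence the infimum defining
`mult` is attained and is never the default value for the empty set. -/
theorem mult_nonempty (C : PlaneCurve) (v : Fin 3 → ℂ) :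
    {n : ℕ | homogeneousComponent n (bind₁ (fun i => X i + MvPolynomial.C (v i)) C.form)
      ≠ 0}.Nonempty := by
  by_contra hne
  rw [Set.not_nonempty_iff_eq_empty, Set.eq_empty_iff_forall_notMem] at hne
  have h0 : bind₁ (fun i => X i + MvPolynomial.C (v i)) C.form = 0 := by
    rw [← sum_homogeneousComponent (bind₁ _ C.form)]
    exact Finset.sum_eq_zero fun k _ => by simpa using hne k
  apply C.form_ne_zero
  have h1 : (bind₁ (fun i => X i - MvPolynomial.C (v i))).comp
      (bind₁ (fun i => X i + MvPolynomial.C (v i))) = AlgHom.id ℂ (MvPolynomial (Fin 3) ℂ) := by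
    apply MvPolynomial.algHom_ext
    intro i
    simp
  have h2 := DFunLike.congr_fun h1 C.form
  simpa [h0] using h2.symm

theorem homogeneousComponent_eq_zero_of_lt_mult {C : PlaneCurve} {p : Plane} {k : ℕ}
    (hk : k < C.mult p) :
    homogeneousComponent k (bind₁ (fun i => X i + MvPolynomial.C (p.rep i)) C.form) = 0 := by
  by_contra h
  have : C.mult p ≤ k := Nat.sInf_le h
  exact absurd hk this.not_gt

theorem homogeneousComponent_zero_translate (F : MvPolynomial (Fin 3) ℂ) (v : Fin 3 → ℂ) :
    homogeneousComponent 0 (bind₁ (fun i => X i + MvPolynomial.C (v i)) F) =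
      MvPolynomial.C (eval v F) := by
  rw [homogeneousComponent_zero, ← constantCoeff_eq]
  congr 1
  have : (constantCoeff.comp (bind₁ (fun i => X i + MvPolynomial.C (v i))).toRingHom :
      MvPolynomial (Fin 3) ℂ →+* ℂ) = eval v := by
    apply MvPolynomial.ringHom_ext <;> simp
  exact DFunLike.congr_fun this F

theorem mult_eq_zero_iff {C : PlaneCurve} {p : Plane} : C.mult p = 0 ↔ p ∉ C.points := by
  constructor
  · intro h hp
    have := Nat.sInf_mem (mult_nonempty C p.rep)
    rw [← PlaneCurve.mult, h] at this
    refine this ?_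
    rw [homogeneousComponent_zero_translate, mem_points.1 hp, map_zero]
  · intro h
    rw [PlaneCurve.mult, Nat.sInf_eq_zero]
    left
    show _ ≠ _
    rw [homogeneousComponent_zero_translate]
    simpa [mem_points] using h

/-- The coefficients of the linear Taylor term are the partial derivatives at the point; this links
multiplicity one with a nonzero gradient. -/
theorem homogeneousComponent_one_translate_eq_zero (F : MvPolynomial (Fin 3) ℂ)
    (v : Fin 3 → ℂ) :
    homogeneousComponent 1 (bind₁ (fun i => X i + MvPolynomial.C (v i)) F) = 0 ↔
      ∀ i, eval v (pderiv i F) = 0 := by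
  have key : ∀ i, coeff (Finsupp.single i 1)
      (bind₁ (fun i => X i + MvPolynomial.C (v i)) F) = eval v (pderiv i F) := by
    intro i
    have h1 := coeff_pderiv (i := i) (bind₁ (fun i => X i + MvPolynomial.C (v i)) F) 0
    rw [pderiv_bind₁_translate] at h1
    have h2 := homogeneousComponent_zero_translate (pderiv i F) v
    rw [homogeneousComponent_zero] at h2
    rw [C_injective _ _ h2] at h1
    simpa using h1.symm
  constructor
  · intro h i
    have := congrArg (coeff (Finsupp.single i 1)) h
    rw [coeff_homogeneousComponent] at this
    simpa [key] using this
  · intro h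
    ext m
    rw [coeff_homogeneousComponent]
    split_ifs with hm
    · obtain ⟨i, rfl⟩ : ∃ i, m = Finsupp.single i 1 := by
        rw [Finsupp.degree_eq_sum, Fin.sum_univ_three] at hm
        have : m 0 = 1 ∨ m 1 = 1 ∨ m 2 = 1 := by omega
        rcases this with h | h | h
        · exact ⟨0, by ext j; fin_cases j <;> simp <;> omega⟩
        · exact ⟨1, by ext j; fin_cases j <;> simp <;> omega⟩
        · exact ⟨2, by ext j; fin_cases j <;> simp <;> omega⟩
      simp [key, h]
    · simp

theorem mult_eq_one_iff {C : PlaneCurve} {p : Plane} :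
    C.mult p = 1 ↔ p ∈ C.points ∧ C.grad p ≠ 0 := by
  have hg : C.grad p ≠ 0 ↔ homogeneousComponent 1
      (bind₁ (fun i => X i + MvPolynomial.C (p.rep i)) C.form) ≠ 0 := by
    rw [Ne, Ne, homogeneousComponent_one_translate_eq_zero, funext_iff]
    rfl
  rw [hg]
  constructor
  · intro h
    refine ⟨by_contra fun h0 => ?_, ?_⟩
    · rw [← mult_eq_zero_iff] at h0; omega
    · have := Nat.sInf_mem (mult_nonempty C p.rep)
      rw [← PlaneCurve.mult, h] at this
      exact this
  · rintro ⟨h, h1⟩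
    refine le_antisymm (Nat.sInf_le h1) ?_
    rw [Nat.one_le_iff_ne_zero, Ne, mult_eq_zero_iff]
    simpa using h

/-- A path through a point of multiplicity `m` meets the curve there with multiplicity at least
`m`. -/
theorem pow_mult_dvd_aeval (C : PlaneCurve) (p : Plane) (g : Fin 3 → Polynomial ℂ) (t c : ℂ)
    (hc : c ≠ 0) (hg : ∀ i, (g i).eval t = c * p.rep i) :
    (Polynomial.X - Polynomial.C t) ^ C.mult p ∣ aeval g C.form := by
  -- The path is written as `c` times (point plus `X - t` times a correction). Homogeneity removes
  -- `c`, and what remains is the Taylor expansion at the point with arguments divisible by `X - t`.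
  have hh : ∀ i, ∃ h, g i = Polynomial.C c * (Polynomial.C (p.rep i) +
      (Polynomial.X - Polynomial.C t) * h) := by
    intro i
    obtain ⟨h, hh⟩ := Polynomial.X_sub_C_dvd_sub_C_eval (p := g i) (a := t)
    refine ⟨Polynomial.C c⁻¹ * h, ?_⟩
    rw [hg, sub_eq_iff_eq_add] at hh
    have h1 : Polynomial.C c * Polynomial.C c⁻¹ = 1 := by
      rw [← Polynomial.C_mul, mul_inv_cancel₀ hc, Polynomial.C_1]
    rw [hh, Polynomial.C_mul]
    linear_combination (-(Polynomial.X - Polynomial.C t) * h) * h1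
  choose h hh using hh
  have h1 : g = fun i => Polynomial.C c * (Polynomial.C (p.rep i) +
      (Polynomial.X - Polynomial.C t) * h i) := funext hh
  rw [h1, aeval_mul_of_isHomogeneous C.form_isHomogeneous]
  apply Dvd.dvd.mul_left
  have h2 : aeval (fun i => Polynomial.C (p.rep i) + (Polynomial.X - Polynomial.C t) * h i) C.form
      = aeval (fun i => (Polynomial.X - Polynomial.C t) * h i)
        (bind₁ (fun i => X i + MvPolynomial.C (p.rep i)) C.form) := by
    rw [aeval_bind₁]
    congr 2
    ext1 i
    simp [add_comm]
  rw [h2]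
  exact pow_dvd_aeval_of_homogeneousComponent _ _
    (fun k hk => homogeneousComponent_eq_zero_of_lt_mult hk) _ _

end PlaneCurve

/-! ### Parametrized curves and Bézout's theorem -/

theorem eval_zero_of_isHomogeneous {σ : Type*} [Fintype σ] {F : MvPolynomial σ ℂ} {d : ℕ}
    (hF : F.IsHomogeneous d) (hd : 0 < d) : eval 0 F = 0 := by
  have := eval_smul_of_isHomogeneous hF 0 0
  rwa [zero_smul, zero_pow hd.ne', zero_mul] at this

/-- The zeros of the irreducible form `K` are parametrized by binary forms of degree `e`. -/
structure IsParametrization (K : MvPolynomial (Fin 3) ℂ) (e : ℕ)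
    (φ : Fin 3 → MvPolynomial (Fin 2) ℂ) : Prop where
  irreducible : Irreducible K
  pos : 0 < e
  isHomogeneous : ∀ i, (φ i).IsHomogeneous e
  bind_eq_zero : bind₁ φ K = 0
  surj : ∀ v, eval v K = 0 → ∃ (c : ℂ) (w : Fin 2 → ℂ), ∀ i, v i = c * eval w (φ i)

theorem eq_of_rep_smul {p q : Plane} {a b : ℂ} (ha : a ≠ 0)
    (h : ∀ i, a * p.rep i = b * q.rep i) : p = q := by
  rw [← p.mk_rep, ← q.mk_rep, Projectivization.mk_eq_mk_iff']
  refine ⟨a⁻¹ * b, funext fun i => ?_⟩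
  rw [Pi.smul_apply, smul_eq_mul, mul_assoc, ← h, inv_mul_cancel_left₀ ha]

namespace IsParametrization

variable {K : MvPolynomial (Fin 3) ℂ} {e : ℕ} {φ : Fin 3 → MvPolynomial (Fin 2) ℂ}

/-- A parametrization by polynomials in one variable whose image contains a given finite set of
points of the curve. -/
theorem exists_path (hK : IsParametrization K e φ) (S : Finset Plane)
    (hS : ∀ p ∈ S, eval p.rep K = 0) :
    ∃ g : Fin 3 → Polynomial ℂ, aeval g K = 0 ∧
      (∀ p ∈ S, ∃ t c : ℂ, c ≠ 0 ∧ ∀ i, (g i).eval t = c * p.rep i) ∧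
      ∀ (F : MvPolynomial (Fin 3) ℂ) (d : ℕ), F.IsHomogeneous d → ¬ K ∣ F →
        aeval g F ≠ 0 ∧ (aeval g F).natDegree ≤ e * d := by
  have h1 : ∀ p : Plane, ∃ (c : ℂ) (w : Fin 2 → ℂ), p ∈ S → ∀ i, p.rep i = c * eval w (φ i) := by
    intro p
    by_cases hp : p ∈ S
    · obtain ⟨c, w, h⟩ := hK.surj _ (hS p hp)
      exact ⟨c, w, fun _ => h⟩
    · exact ⟨0, 0, fun h => absurd h hp⟩
  choose c w hw using h1
  -- The affine chart `t ↦ (1 + x t : t)` of the projective line misses only `(x : 1)`. Since `S` is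
  -- finite, `x` can be chosen so that no parameter of a point of `S` is lost.
  obtain ⟨x, hx⟩ := Infinite.exists_notMem_finset (S.image fun p => w p 0 / w p 1)
  have hc0 : ∀ p ∈ S, c p ≠ 0 := fun p hp h0 => p.rep_nonzero (funext fun i => by
    rw [hw p hp, h0, zero_mul]; rfl)
  have hα : ∀ p ∈ S, w p 0 - x * w p 1 ≠ 0 := by
    intro p hp h0
    by_cases h1 : w p 1 = 0
    · have hw0 : w p = 0 := by
        ext i; fin_cases i
        · simpa [h1] using h0
        · exact h1
      exact p.rep_nonzero (funext fun i => by
        rw [hw p hp, hw0, eval_zero_of_isHomogeneous (hK.isHomogeneous i) hK.pos, mul_zero]; rfl)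
    · exact hx (Finset.mem_image.2 ⟨p, hp, by rw [div_eq_iff h1]; linear_combination h0⟩)
  let ψ : Fin 2 → Polynomial ℂ :=
    ![1 + Polynomial.C x * Polynomial.X, Polynomial.X]
  have hψ : ∀ (G : MvPolynomial (Fin 2) ℂ) (t : ℂ),
      (aeval ψ G).eval t = eval ![1 + x * t, t] G := by
    intro G t
    have : (Polynomial.evalRingHom t).comp (aeval ψ).toRingHom = eval ![1 + x * t, t] := by
      apply MvPolynomial.ringHom_ext
      · simp
      · intro i; fin_cases i <;> simp [ψ]
    exact DFunLike.congr_fun this G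
  have hscale : ∀ (G : MvPolynomial (Fin 2) ℂ) (n : ℕ) (v : Fin 2 → ℂ), G.IsHomogeneous n →
      v 0 - x * v 1 ≠ 0 →
      eval v G = (v 0 - x * v 1) ^ n * (aeval ψ G).eval (v 1 / (v 0 - x * v 1)) := by
    intro G n v hG hv
    rw [hψ, ← eval_smul_of_isHomogeneous hG]
    congr 2
    ext i; fin_cases i
    · show v 0 = (v 0 - x * v 1) * (1 + x * (v 1 / (v 0 - x * v 1)))
      rw [mul_add, mul_left_comm, mul_div_cancel₀ _ hv]
      ring
    · show v 1 = (v 0 - x * v 1) * (v 1 / (v 0 - x * v 1))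
      rw [mul_div_cancel₀ _ hv]
  have hg : ∀ F, aeval (fun i => aeval ψ (φ i)) F = aeval ψ (bind₁ φ F) := fun F => by
    rw [aeval_bind₁]
  refine ⟨fun i => aeval ψ (φ i), ?_, ?_, ?_⟩
  · rw [hg, hK.bind_eq_zero, map_zero]
  · intro p hp
    refine ⟨w p 1 / (w p 0 - x * w p 1), ((w p 0 - x * w p 1) ^ e * c p)⁻¹,
      inv_ne_zero (mul_ne_zero (pow_ne_zero _ (hα p hp)) (hc0 p hp)), fun i => ?_⟩
    rw [hw p hp, hscale _ e _ (hK.isHomogeneous i) (hα p hp)]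
    show _ = ((w p 0 - x * w p 1) ^ e * c p)⁻¹ * _
    rw [← mul_assoc (c p), mul_comm (c p) ((w p 0 - x * w p 1) ^ e),
      inv_mul_cancel_left₀ (mul_ne_zero (pow_ne_zero _ (hα p hp)) (hc0 p hp))]
  · intro F d hF hKF
    have hB : (bind₁ φ F).IsHomogeneous (e * d) := hF.aeval φ hK.isHomogeneous
    rw [hg]
    constructor
    · intro h0
      have hB0 : bind₁ φ F = 0 := by
        -- Vanishing on the chart gives vanishing away from the zeros of `X 0 - x X 1`; multiplying
        -- by this linear form extends it to all arguments.
        have : bind₁ φ F * (X 0 - C x * X 1) = 0 := by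
          apply MvPolynomial.funext
          intro v
          by_cases hv : v 0 - x * v 1 = 0
          · simp [hv]
          · simp [hscale _ _ v hB hv, h0]
        refine (mul_eq_zero.1 this).resolve_right fun h => ?_
        simpa using congrArg (eval ![1, 0]) h
      refine hKF (hK.irreducible.dvd_of_forall_eval fun v hv => ?_)
      obtain ⟨a, u, hu⟩ := hK.surj v hv
      have hv' : v = a • fun i => eval u (φ i) := funext hu
      rw [hv', eval_smul_of_isHomogeneous hF]
      have : eval (fun i => eval u (φ i)) F = eval u (bind₁ φ F) := by
        have h1 : (eval u).comp (bind₁ φ).toRingHom = eval (fun i => eval u (φ i)) := by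
          apply MvPolynomial.ringHom_ext <;> simp
        exact (DFunLike.congr_fun h1 F).symm
      rw [this, hB0, map_zero, mul_zero]
    · refine (aeval_natDegree_le _ hB.totalDegree_le ψ (n := 1) ?_).trans (by simp)
      intro i; fin_cases i
      · show (1 + Polynomial.C x * Polynomial.X).natDegree ≤ 1
        compute_degree
      · simp [ψ]

/-- Bézout's theorem for a parametrized curve and an arbitrary one. -/
theorem sum_le (hK : IsParametrization K e φ) {F : MvPolynomial (Fin 3) ℂ} {d : ℕ}
    (hF : F.IsHomogeneous d) (hKF : ¬ K ∣ F) (S : Finset Plane) (hS : ∀ p ∈ S, eval p.rep K = 0)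
    (m : Plane → ℕ)
    (hm : ∀ p ∈ S, ∀ (g : Fin 3 → Polynomial ℂ) (t c : ℂ), c ≠ 0 →
      (∀ i, (g i).eval t = c * p.rep i) → aeval g K = 0 →
      (Polynomial.X - Polynomial.C t) ^ m p ∣ aeval g F) :
    ∑ p ∈ S, m p ≤ e * d := by
  obtain ⟨g, hgK, hgS, hgF⟩ := hK.exists_path S hS
  obtain ⟨hne, hdeg⟩ := hgF F d hF hKF
  have h1 : ∀ p : Plane, ∃ t c : ℂ, p ∈ S → c ≠ 0 ∧ ∀ i, (g i).eval t = c * p.rep i := by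
    intro p
    by_cases hp : p ∈ S
    · obtain ⟨t, c, h⟩ := hgS p hp
      exact ⟨t, c, fun _ => h⟩
    · exact ⟨0, 0, fun h => absurd h hp⟩
  choose t c ht using h1
  -- A parameter determines its image point, so distinct points of `S` give distinct roots, and the
  -- powers of their linear factors are coprime.
  have hinj : Set.InjOn t S := by
    intro p hp q hq hpq
    refine eq_of_rep_smul (ht p hp).1 (b := c q) fun i => ?_
    rw [← (ht p hp).2, ← (ht q hq).2, hpq]
  have hdvd : ∏ p ∈ S, (Polynomial.X - Polynomial.C (t p)) ^ m p ∣ aeval g F := by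
    refine Finset.prod_dvd_of_coprime ?_ fun p hp => hm p hp g _ _ (ht p hp).1 (ht p hp).2 hgK
    intro p hp q hq hpq
    exact (Polynomial.isCoprime_X_sub_C_of_isUnit_sub
      (sub_ne_zero.2 (hinj.ne hp hq hpq)).isUnit).pow
  have h2 := Polynomial.natDegree_le_of_dvd hdvd hne
  rw [Polynomial.natDegree_prod _ _ fun p _ => pow_ne_zero _ (Polynomial.X_sub_C_ne_zero _)] at h2
  simpa using h2.trans hdeg

/-- Transport along a linear change of coordinates. -/
theorem linSubst (hK : IsParametrization K e φ) (N M : Matrix (Fin 3) (Fin 3) ℂ) (h : M * N = 1) :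
    IsParametrization (linSubst N K) e (fun i => ∑ j, C (M i j) * φ j) where
  irreducible := (MulEquiv.irreducible_iff (linSubstEquiv N M h)).2 hK.irreducible
  pos := hK.pos
  isHomogeneous i := IsHomogeneous.sum _ _ e fun j _ => by
    simpa using (hK.isHomogeneous j).C_mul (M i j)
  bind_eq_zero := by
    rw [_root_.linSubst, bind₁_bind₁, ← hK.bind_eq_zero]
    congr 2
    ext1 i
    have h' := mul_eq_one_comm.1 h
    simp only [map_sum, map_mul, bind₁_C_right, bind₁_X_right, Finset.mul_sum, ← mul_assoc]
    rw [Finset.sum_comm]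
    simp only [← Finset.sum_mul, ← map_mul, ← map_sum, ← Matrix.mul_apply, h', Matrix.one_apply,
      apply_ite C, ite_mul, C_1, C_0, one_mul, zero_mul, Finset.sum_ite_eq, Finset.mem_univ, if_true]
  surj v hv := by
    rw [eval_linSubst] at hv
    obtain ⟨c, w, hw⟩ := hK.surj _ hv
    refine ⟨c, w, fun i => ?_⟩
    have : v = M.mulVec (N.mulVec v) := by rw [Matrix.mulVec_mulVec, h, Matrix.one_mulVec]
    rw [this, funext hw]
    simp [Matrix.mulVec, dotProduct, Finset.mul_sum, mul_left_comm]

end IsParametrization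

/-! ### The standard line and the standard conic -/

theorem irreducible_X_zero : Irreducible (X 0 : MvPolynomial (Fin 3) ℂ) := by
  refine irreducible_of_totalDegree_eq_one (totalDegree_X 0) fun x hx => ?_
  have := hx (Finsupp.single 0 1)
  rw [coeff_X, if_pos rfl] at this
  exact isUnit_of_dvd_one this

theorem isParametrization_line : IsParametrization (X 0) 1 ![0, X 0, X 1] where
  irreducible := irreducible_X_zero
  pos := one_pos
  isHomogeneous i := by
    fin_cases i
    · exact isHomogeneous_zero _ _ _
    · exact isHomogeneous_X _ _
    · exact isHomogeneous_X _ _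
  bind_eq_zero := by simp
  surj v hv := by
    refine ⟨1, ![v 1, v 2], fun i => ?_⟩
    rw [eval_X] at hv
    fin_cases i <;> simp [hv]

/-- The form is linear in `X 2` with the coprime coefficients `X 1` and `-X 0 ^ 2`. -/
theorem irreducible_conic : Irreducible (X 1 * X 2 - X 0 ^ 2 : MvPolynomial (Fin 3) ℂ) := by
  have := irreducible_mul_X_add (X 1 : MvPolynomial (Fin 3) ℂ) (-X 0 ^ 2) 2 (X_ne_zero _)
    (by simp) ?_ ?_
  · rwa [← sub_eq_add_neg] at this
  · rw [vars_neg]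
    exact fun h => by simpa using vars_pow _ _ h
  · rw [IsRelPrime.neg_right_iff]
    intro d hd1 hd0
    obtain ⟨k, -, hk⟩ := (dvd_prime_pow irreducible_X_zero.prime 2).1 hd0
    rcases k with _ | k
    · exact (associated_one_iff_isUnit.1 (by simpa using hk))
    · obtain ⟨Q, hQ⟩ := ((dvd_pow_self _ k.succ_ne_zero).trans hk.symm.dvd).trans hd1
      simpa using congrArg (eval ![0, 1, 0]) hQ

theorem isParametrization_conic :
    IsParametrization (X 1 * X 2 - X 0 ^ 2) 2 ![X 0 * X 1, X 0 ^ 2, X 1 ^ 2] where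
  irreducible := irreducible_conic
  pos := two_pos
  isHomogeneous i := by
    fin_cases i
    · exact (isHomogeneous_X _ _).mul (isHomogeneous_X _ _)
    · exact isHomogeneous_X_pow _ _
    · exact isHomogeneous_X_pow _ _
  bind_eq_zero := by simp; ring
  surj v hv := by
    simp only [map_sub, map_mul, map_pow, eval_X] at hv
    -- The point with `v 2 = 0` has the parameter `(1 : 0)`; every other point has the parameter `(v
    -- 0 : v 2)`.
    by_cases h2 : v 2 = 0
    · have h0 : v 0 = 0 := by simpa [h2] using hv
      refine ⟨v 1, ![1, 0], fun i => ?_⟩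
      fin_cases i <;> simp [h0, h2]
    · refine ⟨(v 2)⁻¹, ![v 0, v 2], fun i => ?_⟩
      fin_cases i
      · simp; field_simp
      · simp; field_simp; linear_combination hv
      · simp; field_simp

/-! ### Nonsingular forms and smooth curves -/

/-- A form without singular points in the projective plane. -/
def IsNonsingularForm (F : MvPolynomial (Fin 3) ℂ) : Prop :=
  ∀ v : Fin 3 → ℂ, v ≠ 0 → eval v F = 0 → ∃ i, eval v (pderiv i F) ≠ 0

theorem eval_pderiv_linSubst (N : Matrix (Fin 3) (Fin 3) ℂ) (F : MvPolynomial (Fin 3) ℂ)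
    (v : Fin 3 → ℂ) :
    (fun j => eval v (pderiv j (linSubst N F))) =
      N.transpose.mulVec (fun i => eval (N.mulVec v) (pderiv i F)) := by
  ext j
  simp [pderiv_linSubst, eval_linSubst, Matrix.mulVec, dotProduct]

theorem mulVec_ne_zero {M N : Matrix (Fin 3) (Fin 3) ℂ} (h : M * N = 1) {v : Fin 3 → ℂ}
    (hv : v ≠ 0) : N.mulVec v ≠ 0 := by
  intro h0
  apply hv
  rw [← Matrix.one_mulVec v, ← h, ← Matrix.mulVec_mulVec, h0, Matrix.mulVec_zero]

theorem IsNonsingularForm.linSubst {F : MvPolynomial (Fin 3) ℂ} (hF : IsNonsingularForm F)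
    {M N : Matrix (Fin 3) (Fin 3) ℂ} (h : M * N = 1) : IsNonsingularForm (linSubst N F) := by
  intro v hv h0
  rw [eval_linSubst] at h0
  obtain ⟨i, hi⟩ := hF _ (mulVec_ne_zero h hv) h0
  by_contra! hcon
  have h1 := eval_pderiv_linSubst N F v
  have h2 : (fun j => eval v (pderiv j (_root_.linSubst N F))) = 0 := funext hcon
  rw [h2] at h1
  refine mulVec_ne_zero (M := M.transpose) (N := N.transpose) ?_ ?_ h1.symm
  · rw [← Matrix.transpose_mul, mul_eq_one_comm.1 h, Matrix.transpose_one]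
  · exact fun h3 => hi (congrFun h3 i)

theorem IsNonsingularForm.C_mul {F : MvPolynomial (Fin 3) ℂ} (hF : IsNonsingularForm F)
    {c : ℂ} (hc : c ≠ 0) : IsNonsingularForm (C c * F) := by
  intro v hv h0
  obtain ⟨i, hi⟩ := hF v hv (by simpa [hc] using h0)
  exact ⟨i, by simp [hc, hi]⟩

theorem IsParametrization.C_mul {K : MvPolynomial (Fin 3) ℂ} {e : ℕ}
    {φ : Fin 3 → MvPolynomial (Fin 2) ℂ} (hK : IsParametrization K e φ) {c : ℂ} (hc : c ≠ 0) :
    IsParametrization (C c * K) e φ where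
  irreducible := (irreducible_isUnit_mul ((isUnit_iff_ne_zero.2 hc).map C)).2 hK.irreducible
  pos := hK.pos
  isHomogeneous := hK.isHomogeneous
  bind_eq_zero := by rw [map_mul, hK.bind_eq_zero, mul_zero]
  surj v hv := hK.surj v (by simpa [hc] using hv)

theorem isNonsingularForm_X_zero : IsNonsingularForm (X 0) :=
  fun _ _ _ => ⟨0, by simp⟩

theorem isNonsingularForm_conic : IsNonsingularForm (X 1 * X 2 - X 0 ^ 2) := by
  intro v hv _
  by_contra! h
  apply hv
  have h0 := h 0
  have h1 := h 1
  have h2 := h 2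
  simp [pderiv_X] at h0 h1 h2
  ext i
  fin_cases i
  · simpa using h0
  · exact h2
  · exact h1

theorem eval_smul_pderiv {F : MvPolynomial (Fin 3) ℂ} {d : ℕ} (hF : F.IsHomogeneous d) (c : ℂ)
    (v : Fin 3 → ℂ) (i : Fin 3) :
    eval (c • v) (pderiv i F) = c ^ (d - 1) * eval v (pderiv i F) :=
  eval_smul_of_isHomogeneous hF.pderiv c v

namespace PlaneCurve

theorem mult_pos_iff {C : PlaneCurve} {p : Plane} : 0 < C.mult p ↔ p ∈ C.points := by
  rw [Nat.pos_iff_ne_zero, Ne, mult_eq_zero_iff, not_not]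

theorem isSmooth_iff {C : PlaneCurve} : C.IsSmooth ↔ IsNonsingularForm C.form := by
  constructor
  · intro h v hv h0
    have h1 := (mult_eq_one_iff.1 (h _ ((mk_mem_points hv).2 h0))).2
    obtain ⟨a, ha⟩ := Projectivization.exists_smul_eq_mk_rep ℂ v hv
    obtain ⟨i, hi⟩ := Function.ne_iff.1 h1
    refine ⟨i, fun h2 => hi ?_⟩
    rw [grad, ← ha, Units.smul_def, eval_smul_pderiv C.form_isHomogeneous, h2, mul_zero]
    rfl
  · intro h p hp
    obtain ⟨i, hi⟩ := h _ p.rep_nonzero hp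
    exact mult_eq_one_iff.2 ⟨hp, fun h0 => hi (congrFun h0 i)⟩

theorem IsSmooth.mult_eq {C : PlaneCurve} (h : C.IsSmooth) (p : Plane) [Decidable (p ∈ C.points)] :
    C.mult p = if p ∈ C.points then 1 else 0 := by
  split_ifs with hp
  · exact h p hp
  · exact mult_eq_zero_iff.2 hp

theorem IsSmooth.grad_ne_zero {C : PlaneCurve} (h : C.IsSmooth) {p : Plane} (hp : p ∈ C.points) :
    C.grad p ≠ 0 := (mult_eq_one_iff.1 (h p hp)).2

/-! ### Consequences of Bézout's theorem for curves with many common points -/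

section Bezout

variable {C D : PlaneCurve} {e : ℕ} {φ : Fin 3 → MvPolynomial (Fin 2) ℂ}

theorem sum_mult_le (hC : IsParametrization C.form e φ) (h : ¬ C.form ∣ D.form)
    (S : Finset Plane) (hS : ∀ p ∈ S, p ∈ C.points) :
    ∑ p ∈ S, D.mult p ≤ e * D.degree :=
  hC.sum_le D.form_isHomogeneous h S hS _
    fun p _ g t c hc hg _ => D.pow_mult_dvd_aeval p g t c hc hg

/-- More common points than Bézout allows force the first equation to divide the second; equal
degrees then give equality. -/
theorem eq_of_card_lt (hC : IsParametrization C.form e φ) (hdeg : C.degree = D.degree)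
    (S : Finset Plane) (hSC : ∀ p ∈ S, p ∈ C.points) (hSD : ∀ p ∈ S, p ∈ D.points)
    (hcard : e * D.degree < S.card) : C = D := by
  refine eq_of_form_dvd hdeg (by_contra fun h => ?_)
  have h1 := sum_mult_le hC h S hSC
  have h2 : S.card ≤ ∑ p ∈ S, D.mult p := by
    rw [Finset.card_eq_sum_ones]
    exact Finset.sum_le_sum fun p hp => mult_pos_iff.2 (hSD p hp)
  omega

theorem inter_subset_of_card_eq (hC : IsParametrization C.form e φ) (hdeg : C.degree = D.degree)
    (hne : C ≠ D) (S : Finset Plane) (hSC : ∀ p ∈ S, p ∈ C.points) (hSD : ∀ p ∈ S, p ∈ D.points)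
    (hcard : e * D.degree = S.card) {q : Plane} (hqC : q ∈ C.points) (hqD : q ∈ D.points) :
    q ∈ S := by
  classical
  by_contra hq
  refine hne (eq_of_card_lt hC hdeg (insert q S) ?_ ?_ ?_)
  · simpa [hqC] using hSC
  · simpa [hqD] using hSD
  · rw [Finset.card_insert_of_notMem hq]; omega

/-- When the common points of `S` already exhaust Bézout's bound, a tangency at one of them would
count twice and exceed it. -/
theorem linearIndependent_grad_of_card_eq (hC : IsParametrization C.form e φ)
    (hdeg : C.degree = D.degree) (hne : C ≠ D) (hsm : C.IsSmooth)
    (S : Finset Plane) (hSC : ∀ p ∈ S, p ∈ C.points) (hSD : ∀ p ∈ S, p ∈ D.points)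
    (hcard : e * D.degree = S.card) {q : Plane} (hq : q ∈ S) :
    LinearIndependent ℂ ![C.grad q, D.grad q] := by
  classical
  rw [LinearIndependent.pair_iff' (hsm.grad_ne_zero (hSC q hq))]
  intro a ha
  have key := hC.sum_le D.form_isHomogeneous
    (fun h => hne (eq_of_form_dvd hdeg h)) S hSC (fun p => if p = q then 2 else 1) ?_
  · rw [← Finset.add_sum_erase S _ hq, if_pos rfl,
      Finset.sum_congr rfl (fun p hp => if_neg (Finset.ne_of_mem_erase hp))] at key
    simp only [Finset.sum_const, smul_eq_mul, mul_one, Finset.card_erase_of_mem hq] at key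
    have := Finset.card_pos.2 ⟨q, hq⟩
    omega
  · intro p hp g t c hc hg hg0
    have hdvd : Polynomial.X - Polynomial.C t ∣ aeval g D.form := by
      have h1 := D.pow_mult_dvd_aeval p g t c hc hg
      exact (dvd_pow_self _ (mult_pos_iff.2 (hSD p hp)).ne').trans h1
    split_ifs with hpq
    · subst hpq
      -- By the chain rule the derivative along the path is the gradient paired with the velocity.
      -- It vanishes for `C`, which contains the path, hence also for `D` if its gradient is a
      -- multiple of that of `C`. So the root at `t` is double.
      have hder : ∀ B : PlaneCurve, (Polynomial.derivative (aeval g B.form)).eval t =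
          c ^ (B.degree - 1) * (B.grad p ⬝ᵥ fun i => (Polynomial.derivative (g i)).eval t) := by
        intro B
        have hev : ∀ G : MvPolynomial (Fin 3) ℂ, (aeval g G).eval t = eval (c • p.rep) G := by
          intro G
          have : (Polynomial.evalRingHom t).comp (aeval g).toRingHom = eval (c • p.rep) := by
            apply MvPolynomial.ringHom_ext
            · simp
            · intro i; simp [hg]
          exact DFunLike.congr_fun this G
        rw [derivative_aeval_eq, Polynomial.eval_finsetSum, dotProduct, Finset.mul_sum]
        refine Finset.sum_congr rfl fun i _ => ?_
        rw [Polynomial.eval_mul, hev, eval_smul_pderiv B.form_isHomogeneous, mul_assoc]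
        rfl
      have h1 := hder C
      rw [hg0] at h1
      have h2 := hder D
      rw [← ha, smul_dotProduct] at h2
      have h3 : (C.grad p ⬝ᵥ fun i => (Polynomial.derivative (g i)).eval t) = 0 := by
        simpa [hc] using h1.symm
      rw [h3, smul_zero, mul_zero] at h2
      obtain ⟨Q, hQ⟩ := hdvd
      rw [hQ, pow_two]
      refine mul_dvd_mul_left _ (Polynomial.dvd_iff_isRoot.2 ?_)
      rw [hQ] at h2
      simpa [Polynomial.derivative_mul] using h2
    · simpa using hdvd

end Bezout

/-- The curve with the equation `F` composed with an invertible linear map. -/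
theorem exists_parametrization_ofForm {F : MvPolynomial (Fin 3) ℂ} {d e : ℕ}
    {φ : Fin 3 → MvPolynomial (Fin 2) ℂ} (hF : F.IsHomogeneous d) (h0 : F ≠ 0)
    (hP : IsParametrization F e φ) : IsParametrization (ofForm F d hF h0).form e φ := by
  obtain ⟨c, hc, h⟩ := exists_form_ofForm F d hF h0
  rw [h]
  exact hP.C_mul hc

theorem isSmooth_ofForm {F : MvPolynomial (Fin 3) ℂ} {d : ℕ} (hF : F.IsHomogeneous d) (h0 : F ≠ 0)
    (hs : IsNonsingularForm F) : (ofForm F d hF h0).IsSmooth := by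
  obtain ⟨c, hc, h⟩ := exists_form_ofForm F d hF h0
  rw [isSmooth_iff, h]
  exact hs.C_mul hc

theorem mk_mem_points_ofForm {F : MvPolynomial (Fin 3) ℂ} {d : ℕ} (hF : F.IsHomogeneous d)
    (h0 : F ≠ 0) {v : Fin 3 → ℂ} (hv : v ≠ 0) :
    Projectivization.mk ℂ v hv ∈ (ofForm F d hF h0).points ↔ eval v F = 0 := by
  obtain ⟨c, hc, h⟩ := exists_form_ofForm F d hF h0
  rw [mk_mem_points, h]
  simp [hc]

end PlaneCurve

/-- A nonzero vector is the first row of an invertible matrix. -/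
theorem exists_matrix_row_zero {f : Fin 3 → ℂ} (hf : f ≠ 0) :
    ∃ N M : Matrix (Fin 3) (Fin 3) ℂ, M * N = 1 ∧ N 0 = f := by
  have key : ∀ N : Matrix (Fin 3) (Fin 3) ℂ, N.det ≠ 0 → N 0 = f →
      ∃ N M : Matrix (Fin 3) (Fin 3) ℂ, M * N = 1 ∧ N 0 = f := fun N h h1 =>
    ⟨N, N⁻¹, Matrix.nonsing_inv_mul N h.isUnit, h1⟩
  by_cases h0 : f 0 = 0
  · by_cases h1 : f 1 = 0
    · have h2 : f 2 ≠ 0 := fun h2 => hf (by ext i; fin_cases i <;> assumption)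
      exact key (Matrix.of ![f, ![1, 0, 0], ![0, 1, 0]]) (by simp [Matrix.det_fin_three, h2]) rfl
    · exact key (Matrix.of ![f, ![1, 0, 0], ![0, 0, 1]]) (by simp [Matrix.det_fin_three, h1]) rfl
  · exact key (Matrix.of ![f, ![0, 1, 0], ![0, 0, 1]]) (by simp [Matrix.det_fin_three, h0]) rfl

/-- The linear form with given coefficients. -/
noncomputable def linearForm (f : Fin 3 → ℂ) : MvPolynomial (Fin 3) ℂ := ∑ i, C (f i) * X i

theorem eval_linearForm (f v : Fin 3 → ℂ) : eval v (linearForm f) = f ⬝ᵥ v := by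
  simp [linearForm, dotProduct]

theorem linearForm_isHomogeneous (f : Fin 3 → ℂ) : (linearForm f).IsHomogeneous 1 :=
  IsHomogeneous.sum _ _ 1 fun _ _ => isHomogeneous_C_mul_X _ _

theorem exists_linearForm_eq_linSubst {f : Fin 3 → ℂ} (hf : f ≠ 0) :
    ∃ N M : Matrix (Fin 3) (Fin 3) ℂ, M * N = 1 ∧ linearForm f = linSubst N (X 0) := by
  obtain ⟨N, M, h, rfl⟩ := exists_matrix_row_zero hf
  exact ⟨N, M, h, by rw [linSubst_X]; rfl⟩

/-! ### The affine plane over three elements and the abstract Hesse configuration -/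

/-- The points of the affine plane over the field with three elements. -/
abbrev AffPoint : Type := ZMod 3 × ZMod 3

/-- The lines of the affine plane over the field with three elements: `(none, i)` is the vertical
line `x = i` and `(some s, t)` is the line `y = s * x + t`. -/
abbrev AffLine : Type := Option (ZMod 3) × ZMod 3

/-- Incidence of points and lines. -/
def Inc (a : AffPoint) (l : AffLine) : Prop :=
  l.1.elim (a.1 = l.2) (fun s => a.2 = s * a.1 + l.2)

instance (a : AffPoint) (l : AffLine) : Decidable (Inc a l) := by
  obtain ⟨_ | s, t⟩ := l <;> (simp only [Inc, Option.elim]; infer_instance)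

/-- The standard smooth conic. -/
noncomputable def stdConic : MvPolynomial (Fin 3) ℂ := X 1 * X 2 - X 0 ^ 2

theorem stdConic_ne_zero : stdConic ≠ 0 := irreducible_conic.ne_zero

/-- The incidence structure of flexes `f`, inflectional tangents `p`, lines `n` through three
flexes, and conics (the pull-backs of the standard one by `N`) attached to a smooth cubic. -/
structure HesseConfiguration (E : PlaneCurve) where
  f : AffPoint → Fin 3 → ℂ
  p : AffPoint → Fin 3 → ℂ
  n : AffLine → Fin 3 → ℂ
  N : AffLine → Matrix (Fin 3) (Fin 3) ℂ
  M : AffLine → Matrix (Fin 3) (Fin 3) ℂ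
  mul_eq_one : ∀ l, M l * N l = 1
  f_dot_p : ∀ a b, f a ⬝ᵥ p b = 0 ↔ a = b
  f_dot_n : ∀ a l, f a ⬝ᵥ n l = 0 ↔ Inc a l
  conic_p : ∀ a l, eval (p a) (linSubst (N l) stdConic) = 0 ↔ ¬ Inc a l
  conic_n : ∀ m l, eval (n m) (linSubst (N l) stdConic) = 0 ↔ m.1 = l.1 ∧ m ≠ l
  mem_flexes : ∀ x : Plane, x ∈ E.flexes ↔ ∃ a, ∃ c : ℂ, c ≠ 0 ∧ x.rep = c • f a
  grad_eq : ∀ (x : Plane) a (c : ℂ), c ≠ 0 → x.rep = c • f a →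
    ∃ c' : ℂ, c' ≠ 0 ∧ E.grad x = c' • p a

theorem stdConic_isHomogeneous : stdConic.IsHomogeneous 2 :=
  ((isHomogeneous_X _ _).mul (isHomogeneous_X _ _)).sub (isHomogeneous_X_pow _ _)

theorem Set.ncard_image_setOf {α β : Type*} [Fintype α] {g : α → β} (hg : Function.Injective g)
    (P : α → Prop) [DecidablePred P] :
    (g '' {a | P a}).ncard = (Finset.univ.filter P).card := by
  rw [Set.ncard_image_of_injective _ hg, Set.ncard_eq_toFinset_card', Set.toFinset_ofPred]

theorem Set.ncard_range_of_injective' {α β : Type*} [Fintype α] {g : α → β}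
    (hg : Function.Injective g) : (Set.range g).ncard = Fintype.card α := by
  rw [← Set.image_univ, Set.ncard_image_of_injective _ hg, Set.ncard_univ, Nat.card_eq_fintype_card]

section Combinatorics

theorem exists_inc_of_ne : ∀ a b : AffPoint, ∃ l, Inc a l ∧ Inc b l := by decide

theorem card_filter_inc_erase : ∀ (a b : AffPoint) (l : AffLine), a ≠ b → Inc a l → Inc b l →
    (Finset.univ.filter fun x => Inc x l ∧ x ≠ a ∧ x ≠ b).card = 1 := by decide

/-- Three points lie outside `s`. The line through two of them has only one further point, so at
most one point of `s` lies on it. -/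
theorem exists_five_le (s : Finset AffPoint) (hs : s.card = 6) :
    ∃ l, 5 ≤ (s.filter fun a => ¬ Inc a l).card := by
  have h1 : 1 < (sᶜ).card := by rw [Finset.card_compl, hs]; decide
  obtain ⟨a, ha, b, hb, hab⟩ := Finset.one_lt_card.1 h1
  rw [Finset.mem_compl] at ha hb
  obtain ⟨l, hal, hbl⟩ := exists_inc_of_ne a b
  refine ⟨l, ?_⟩
  have h2 : (s.filter fun x => Inc x l).card ≤ 1 := by
    rw [← card_filter_inc_erase a b l hab hal hbl]
    refine Finset.card_le_card fun x hx => ?_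
    rw [Finset.mem_filter] at hx ⊢
    exact ⟨Finset.mem_univ _, hx.2, fun h => ha (h ▸ hx.1), fun h => hb (h ▸ hx.1)⟩
  have h3 := Finset.card_filter_add_card_filter_not (s := s) (fun x => Inc x l)
  omega

end Combinatorics

/-! ### The arrangements of conics and lines of a configuration -/

namespace HesseConfiguration

variable {E : PlaneCurve} (H : HesseConfiguration E)
include H

theorem f_ne_zero (a : AffPoint) : H.f a ≠ 0 := by
  intro h
  have := H.f_dot_p a (a.1 + 1, a.2)
  rw [h, zero_dotProduct] at this
  have h1 := congrArg Prod.fst (this.1 rfl)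
  simp at h1

theorem p_ne_zero (a : AffPoint) : H.p a ≠ 0 := by
  intro h
  have := H.f_dot_p (a.1 + 1, a.2) a
  rw [h, dotProduct_zero] at this
  have h1 := congrArg Prod.fst (this.1 rfl)
  simp at h1

theorem n_ne_zero (l : AffLine) : H.n l ≠ 0 := by
  intro h
  have h1 : ∀ a, Inc a l := fun a => by
    rw [← H.f_dot_n, h, dotProduct_zero]
  have h2 : ∀ l, ∃ a, ¬ Inc a l := by decide
  exact (h2 l).elim fun a ha => ha (h1 a)

/-- The inflectional tangents as points of the dual plane. -/
noncomputable def cusp (a : AffPoint) : Plane := Projectivization.mk ℂ (H.p a) (H.p_ne_zero a)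

/-- The lines through three flexes as points of the dual plane. -/
noncomputable def node (l : AffLine) : Plane := Projectivization.mk ℂ (H.n l) (H.n_ne_zero l)

omit H in
theorem linSubst_ne_zero {F : MvPolynomial (Fin 3) ℂ} (hF : F ≠ 0)
    {N M : Matrix (Fin 3) (Fin 3) ℂ} (h : M * N = 1) : linSubst N F ≠ 0 :=
  (map_ne_zero_iff _ (linSubstEquiv N M h).injective).2 hF

/-- The conics of the configuration. -/
noncomputable def conic (l : AffLine) : PlaneCurve :=
  PlaneCurve.ofForm (linSubst (H.N l) stdConic) 2
    (linSubst_isHomogeneous _ stdConic_isHomogeneous)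
    (linSubst_ne_zero stdConic_ne_zero (H.mul_eq_one l))

theorem linearForm_f_ne_zero (a : AffPoint) : linearForm (H.f a) ≠ 0 := by
  obtain ⟨N, M, h, h1⟩ := exists_linearForm_eq_linSubst (H.f_ne_zero a)
  rw [h1]
  exact linSubst_ne_zero (X_ne_zero _) h

/-- The lines dual to the flexes. -/
noncomputable def line (a : AffPoint) : PlaneCurve :=
  PlaneCurve.ofForm (linearForm (H.f a)) 1 (linearForm_isHomogeneous _) (H.linearForm_f_ne_zero a)

theorem conic_degree (l : AffLine) : (H.conic l).degree = 2 := rfl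

theorem line_degree (a : AffPoint) : (H.line a).degree = 1 := rfl

theorem exists_conic_parametrization (l : AffLine) :
    ∃ φ, IsParametrization (H.conic l).form 2 φ :=
  ⟨_, PlaneCurve.exists_parametrization_ofForm _ _
    (isParametrization_conic.linSubst (H.N l) (H.M l) (H.mul_eq_one l))⟩

theorem exists_line_parametrization (a : AffPoint) :
    ∃ φ, IsParametrization (H.line a).form 1 φ := by
  obtain ⟨N, M, h, h1⟩ := exists_linearForm_eq_linSubst (H.f_ne_zero a)
  refine ⟨_, PlaneCurve.exists_parametrization_ofForm _ _ (φ := ?_) ?_⟩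
  rotate_left
  · rw [h1]
    exact isParametrization_line.linSubst N M h

theorem conic_isSmooth (l : AffLine) : (H.conic l).IsSmooth :=
  PlaneCurve.isSmooth_ofForm _ _ (isNonsingularForm_conic.linSubst (H.mul_eq_one l))

theorem line_isSmooth (a : AffPoint) : (H.line a).IsSmooth := by
  obtain ⟨N, M, h, h1⟩ := exists_linearForm_eq_linSubst (H.f_ne_zero a)
  refine PlaneCurve.isSmooth_ofForm _ _ ?_
  rw [h1]
  exact isNonsingularForm_X_zero.linSubst h

theorem cusp_mem_conic {a : AffPoint} {l : AffLine} :
    H.cusp a ∈ (H.conic l).points ↔ ¬ Inc a l := by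
  rw [cusp, conic, PlaneCurve.mk_mem_points_ofForm, H.conic_p]

theorem node_mem_conic {m l : AffLine} :
    H.node m ∈ (H.conic l).points ↔ m.1 = l.1 ∧ m ≠ l := by
  rw [node, conic, PlaneCurve.mk_mem_points_ofForm, H.conic_n]

theorem cusp_mem_line {a b : AffPoint} : H.cusp b ∈ (H.line a).points ↔ a = b := by
  rw [cusp, line, PlaneCurve.mk_mem_points_ofForm, eval_linearForm, H.f_dot_p]

theorem node_mem_line {a : AffPoint} {l : AffLine} :
    H.node l ∈ (H.line a).points ↔ Inc a l := by
  rw [node, line, PlaneCurve.mk_mem_points_ofForm, eval_linearForm, H.f_dot_n]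

theorem cusp_injective : Function.Injective H.cusp := fun a b h => by
  rw [← H.cusp_mem_line, ← h, H.cusp_mem_line]

theorem node_injective : Function.Injective H.node := fun l m h => by
  have h1 : ∀ a, Inc a l ↔ Inc a m := fun a => by
    rw [← H.node_mem_line, h, H.node_mem_line]
  have h2 : ∀ l m, (∀ a, Inc a l ↔ Inc a m) → l = m := by decide
  exact h2 l m h1

/-- A cusp lies on one dual line only, whereas a node lies on the three dual to the flexes of its
affine line. -/
theorem cusp_ne_node (a : AffPoint) (l : AffLine) : H.cusp a ≠ H.node l := fun h => by
  have h1 : ∀ b, b = a ↔ Inc b l := fun b => by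
    rw [← H.node_mem_line, ← h, H.cusp_mem_line]
  have h2 : ∀ a l, ¬ ∀ b, b = a ↔ Inc b l := by decide
  exact h2 a l h1

theorem disjoint_cusp_node : Disjoint (Set.range H.cusp) (Set.range H.node) := by
  rw [Set.disjoint_left]
  rintro _ ⟨a, rfl⟩ ⟨l, hl⟩
  exact H.cusp_ne_node a l hl.symm

theorem line_injective : Function.Injective H.line := fun a b h => by
  rw [← H.cusp_mem_line, h, H.cusp_mem_line]

theorem conic_injective : Function.Injective H.conic := fun l m h => by
  have h1 : ∀ a, ¬ Inc a l ↔ ¬ Inc a m := fun a => by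
    rw [← H.cusp_mem_conic, h, H.cusp_mem_conic]
  have h2 : ∀ l m, (∀ a, ¬ Inc a l ↔ ¬ Inc a m) → l = m := by decide
  exact h2 l m h1

open Classical in
/-- The points common to two conics. -/
noncomputable def conicInter (l m : AffLine) : Finset Plane :=
  (Finset.univ.filter fun a => ¬ Inc a l ∧ ¬ Inc a m).image H.cusp ∪
    (Finset.univ.filter fun k : AffLine => (k.1 = l.1 ∧ k ≠ l) ∧ k.1 = m.1 ∧ k ≠ m).image H.node

/-- Parallel affine lines leave three points uncovered and have one common third parallel: three
cusps and one node. Lines that meet leave four points uncovered and share no such node: four cusps.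
Either way Bézout's number 4 is reached. -/
theorem card_conicInter {l m : AffLine} (h : l ≠ m) : (H.conicInter l m).card = 4 := by
  classical
  rw [conicInter, Finset.card_union_of_disjoint, Finset.card_image_of_injective _ H.cusp_injective,
    Finset.card_image_of_injective _ H.node_injective]
  · revert l m; decide
  · rw [Finset.disjoint_left]
    simp only [Finset.mem_image]
    rintro _ ⟨a, -, rfl⟩ ⟨k, -, hk⟩
    exact H.cusp_ne_node a k hk.symm

theorem conicInter_subset {l m : AffLine} {q : Plane} (hq : q ∈ H.conicInter l m) :
    (q ∈ (H.conic l).points ∧ q ∈ (H.conic m).points) ∧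
      q ∈ Set.range H.cusp ∪ Set.range H.node := by
  classical
  rw [conicInter, Finset.mem_union, Finset.mem_image, Finset.mem_image] at hq
  rcases hq with ⟨a, ha, rfl⟩ | ⟨k, hk, rfl⟩
  · rw [Finset.mem_filter] at ha
    exact ⟨⟨H.cusp_mem_conic.2 ha.2.1, H.cusp_mem_conic.2 ha.2.2⟩, Or.inl ⟨a, rfl⟩⟩
  · rw [Finset.mem_filter] at hk
    exact ⟨⟨H.node_mem_conic.2 hk.2.1, H.node_mem_conic.2 hk.2.2⟩, Or.inr ⟨k, rfl⟩⟩

theorem mem_conicInter {l m : AffLine} (h : l ≠ m) {q : Plane} (hl : q ∈ (H.conic l).points)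
    (hm : q ∈ (H.conic m).points) : q ∈ H.conicInter l m := by
  obtain ⟨φ, hφ⟩ := H.exists_conic_parametrization l
  refine PlaneCurve.inter_subset_of_card_eq (D := H.conic m) hφ
    ((H.conic_degree l).trans (H.conic_degree m).symm) (H.conic_injective.ne h) _
    (fun p hp => (H.conicInter_subset hp).1.1) (fun p hp => (H.conicInter_subset hp).1.2) ?_ hl hm
  rw [H.card_conicInter h, H.conic_degree]

theorem isOrdinaryAt (q : Plane) : Arrangement.IsOrdinaryAt (Set.range H.conic) q := by
  refine ⟨?_, ?_⟩
  · rintro _ ⟨l, rfl⟩ hq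
    exact H.conic_isSmooth l q hq
  · rintro _ ⟨l, rfl⟩ _ ⟨m, rfl⟩ hne hl hm
    have h : l ≠ m := fun h => hne (by rw [h])
    obtain ⟨φ, hφ⟩ := H.exists_conic_parametrization l
    refine PlaneCurve.linearIndependent_grad_of_card_eq hφ
      ((H.conic_degree l).trans (H.conic_degree m).symm) hne (H.conic_isSmooth l) _
      (fun p hp => (H.conicInter_subset hp).1.1) (fun p hp => (H.conicInter_subset hp).1.2) ?_
      (H.mem_conicInter h hl hm)
    rw [H.card_conicInter h, H.conic_degree]

theorem exists_conics_cusp (a : AffPoint) : ∃ l m, l ≠ m ∧ H.cusp a ∈ (H.conic l).points ∧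
    H.cusp a ∈ (H.conic m).points := by
  simp only [H.cusp_mem_conic]
  revert a; decide

theorem exists_conics_node (k : AffLine) : ∃ l m, l ≠ m ∧ H.node k ∈ (H.conic l).points ∧
    H.node k ∈ (H.conic m).points := by
  simp only [H.node_mem_conic]
  revert k; decide

theorem sing_conics :
    Arrangement.sing (Set.range H.conic) = Set.range H.cusp ∪ Set.range H.node := by
  ext q
  constructor
  · rintro (⟨_, ⟨l, rfl⟩, h⟩ | ⟨_, ⟨l, rfl⟩, _, ⟨m, rfl⟩, hne, hl, hm⟩)
    · have h1 : q ∈ (H.conic l).points := PlaneCurve.mult_pos_iff.1 (by omega)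
      have := H.conic_isSmooth l q h1
      omega
    · exact (H.conicInter_subset
        (H.mem_conicInter (fun h => hne (by rw [h])) hl hm)).2
  · rintro (⟨a, rfl⟩ | ⟨k, rfl⟩)
    · obtain ⟨l, m, hne, hl, hm⟩ := H.exists_conics_cusp a
      exact Or.inr ⟨_, ⟨l, rfl⟩, _, ⟨m, rfl⟩, H.conic_injective.ne hne, hl, hm⟩
    · obtain ⟨l, m, hne, hl, hm⟩ := H.exists_conics_node k
      exact Or.inr ⟨_, ⟨l, rfl⟩, _, ⟨m, rfl⟩, H.conic_injective.ne hne, hl, hm⟩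

omit H in
theorem arrangementMult_range {ι : Type*} [Fintype ι] {K : ι → PlaneCurve}
    (hK : Function.Injective K) (hs : ∀ i, (K i).IsSmooth) (q : Plane)
    [DecidablePred fun i => q ∈ (K i).points] :
    Arrangement.mult (Set.range K) q = (Finset.univ.filter fun i => q ∈ (K i).points).card := by
  classical
  rw [Arrangement.mult, finsum_mem_range hK, finsum_eq_sum_of_fintype, Finset.card_filter]
  exact Finset.sum_congr rfl fun i _ => by convert (hs i).mult_eq q

theorem mult_cusp (a : AffPoint) : Arrangement.mult (Set.range H.conic) (H.cusp a) = 8 := by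
  classical
  rw [arrangementMult_range H.conic_injective H.conic_isSmooth]
  simp only [H.cusp_mem_conic]
  revert a; decide

theorem mult_node (k : AffLine) : Arrangement.mult (Set.range H.conic) (H.node k) = 2 := by
  classical
  rw [arrangementMult_range H.conic_injective H.conic_isSmooth]
  simp only [H.node_mem_conic]
  revert k; decide

theorem nodes_conics : Arrangement.nodes (Set.range H.conic) = Set.range H.node := by
  ext q
  constructor
  · rintro ⟨h1, h2, -⟩
    rw [H.sing_conics] at h1
    rcases h1 with ⟨a, rfl⟩ | h1
    · rw [H.mult_cusp] at h2; omega
    · exact h1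
  · rintro ⟨k, rfl⟩
    exact ⟨by rw [H.sing_conics]; exact Or.inr ⟨k, rfl⟩, H.mult_node k, H.isOrdinaryAt _⟩

theorem isDArrangement : Arrangement.IsDArrangement 2 (Set.range H.conic) := by
  refine ⟨Set.finite_range _, ?_, ?_, fun q _ => H.isOrdinaryAt q, ?_⟩
  · rw [Set.ncard_range_of_injective' H.conic_injective]; decide
  · rintro _ ⟨l, rfl⟩
    exact ⟨rfl, H.conic_isSmooth l⟩
  · rintro ⟨q, hq⟩
    have hq' : ∀ l, q ∈ (H.conic l).points := fun l => hq _ ⟨l, rfl⟩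
    -- A point common to all conics is already a cusp or a node. But a cusp avoids the conic of any
    -- affine line through its point, and the node of `k` avoids the conic of `k`.
    have hm := H.mem_conicInter (l := (none, 0)) (m := (none, 1)) (by decide) (hq' _) (hq' _)
    rcases (H.conicInter_subset hm).2 with ⟨a, rfl⟩ | ⟨k, rfl⟩
    · simp only [H.cusp_mem_conic] at hq'
      have : ∀ a, ∃ l, Inc a l := by decide
      exact (this a).elim fun l hl => hq' l hl
    · simp only [H.node_mem_conic] at hq'
      exact (hq' k).2 rfl

/-- Two dual lines meet once, and the node of the affine line joining `a` and `b` is on both. -/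
theorem line_inter {a b : AffPoint} (h : a ≠ b) {q : Plane} (ha : q ∈ (H.line a).points)
    (hb : q ∈ (H.line b).points) : q ∈ Set.range H.node := by
  classical
  obtain ⟨φ, hφ⟩ := H.exists_line_parametrization a
  have := PlaneCurve.inter_subset_of_card_eq (D := H.line b) hφ
    ((H.line_degree a).trans (H.line_degree b).symm) (H.line_injective.ne h)
    ((Finset.univ.filter fun l => Inc a l ∧ Inc b l).image H.node) ?_ ?_ ?_ ha hb
  · obtain ⟨k, -, hk⟩ := Finset.mem_image.1 this
    exact ⟨k, hk⟩
  · simp only [Finset.mem_image, Finset.mem_filter]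
    rintro _ ⟨k, hk, rfl⟩
    exact H.node_mem_line.2 hk.2.1
  · simp only [Finset.mem_image, Finset.mem_filter]
    rintro _ ⟨k, hk, rfl⟩
    exact H.node_mem_line.2 hk.2.2
  · rw [Finset.card_image_of_injective _ H.node_injective, H.line_degree]
    have : ∀ a b : AffPoint, a ≠ b →
        1 * 1 = (Finset.univ.filter fun l => Inc a l ∧ Inc b l).card := by decide
    exact this a b h

theorem sing_lines : Arrangement.sing (Set.range H.line) = Set.range H.node := by
  ext q
  constructor
  · rintro (⟨_, ⟨l, rfl⟩, h⟩ | ⟨_, ⟨l, rfl⟩, _, ⟨m, rfl⟩, hne, hl, hm⟩)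
    · have h1 : q ∈ (H.line l).points := PlaneCurve.mult_pos_iff.1 (by omega)
      have := H.line_isSmooth l q h1
      omega
    · exact H.line_inter (fun h => hne (by rw [h])) hl hm
  · rintro ⟨k, rfl⟩
    have : ∀ k, ∃ a b, a ≠ b ∧ Inc a k ∧ Inc b k := by decide
    obtain ⟨a, b, hne, ha, hb⟩ := this k
    exact Or.inr ⟨_, ⟨a, rfl⟩, _, ⟨b, rfl⟩, H.line_injective.ne hne, H.node_mem_line.2 ha,
      H.node_mem_line.2 hb⟩

theorem mult_lines_node (k : AffLine) :
    Arrangement.mult (Set.range H.line) (H.node k) = 3 := by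
  classical
  rw [arrangementMult_range H.line_injective H.line_isSmooth]
  simp only [H.node_mem_line]
  revert k; decide

theorem dualCusps_eq : dualCusps E = Set.range H.cusp := by
  have key : ∀ (x : Plane) a (c : ℂ), c ≠ 0 → x.rep = c • H.f a → ∀ h : E.grad x ≠ 0,
      H.cusp a = Projectivization.mk ℂ (E.grad x) h := by
    intro x a c hc hx h
    obtain ⟨c', hc', h1⟩ := H.grad_eq x a c hc hx
    rw [cusp, Projectivization.mk_eq_mk_iff']
    exact ⟨c'⁻¹, by rw [h1, smul_smul, inv_mul_cancel₀ hc', one_smul]⟩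
  ext q
  constructor
  · rintro ⟨x, hx, h, rfl⟩
    obtain ⟨a, c, hc, hx⟩ := (H.mem_flexes x).1 hx
    exact ⟨a, key x a c hc hx h⟩
  · rintro ⟨a, rfl⟩
    obtain ⟨c, hc⟩ := Projectivization.exists_smul_eq_mk_rep ℂ (H.f a) (H.f_ne_zero a)
    have hx := (H.mem_flexes _).2 ⟨a, c, c.ne_zero, hc.symm⟩
    exact ⟨_, hx, hx.2.1, key _ a c c.ne_zero hc.symm _⟩

/-- The Nullstellensatz recovers the equation of a line from its set of points, and rescaling the
coordinates of a flex does not change its dual line. -/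
theorem dualHesseLines_eq : dualHesseLines E = Set.range H.line := by
  have hline : ∀ a (q : Plane), q ∈ (H.line a).points ↔ H.f a ⬝ᵥ q.rep = 0 := by
    intro a q
    conv_lhs => rw [← q.mk_rep]
    rw [line, PlaneCurve.mk_mem_points_ofForm, eval_linearForm]
  ext L
  constructor
  · rintro ⟨hL, x, hx, hpts⟩
    obtain ⟨a, c, hc, hx⟩ := (H.mem_flexes x).1 hx
    refine ⟨a, PlaneCurve.eq_of_form_dvd hL.symm ?_⟩
    obtain ⟨φ, hφ⟩ := H.exists_line_parametrization a
    refine hφ.irreducible.dvd_of_forall_eval fun v hv => ?_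
    by_cases h0 : v = 0
    · rw [h0]
      exact eval_zero_of_isHomogeneous L.form_isHomogeneous (by rw [hL]; exact one_pos)
    · have h1 := (hline a _).1 ((PlaneCurve.mk_mem_points h0).2 hv)
      rw [← PlaneCurve.mk_mem_points h0, hpts]
      show x.rep ⬝ᵥ _ = 0
      rw [hx, smul_dotProduct, h1, smul_zero]
  · rintro ⟨a, rfl⟩
    obtain ⟨c, hc⟩ := Projectivization.exists_smul_eq_mk_rep ℂ (H.f a) (H.f_ne_zero a)
    refine ⟨rfl, _, (H.mem_flexes _).2 ⟨a, c, c.ne_zero, hc.symm⟩, ?_⟩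
    ext q
    rw [hline, Set.mem_ofPred_eq, ← hc, smul_dotProduct, smul_eq_zero_iff_eq]

theorem cusps_inter (C : PlaneCurve) :
    Set.range H.cusp ∩ C.points = H.cusp '' {a | H.cusp a ∈ C.points} := by
  ext q
  constructor
  · rintro ⟨⟨a, rfl⟩, h⟩
    exact ⟨a, h, rfl⟩
  · rintro ⟨a, h, rfl⟩
    exact ⟨⟨a, rfl⟩, h⟩

theorem nodes_inter (C : PlaneCurve) :
    Set.range H.node ∩ C.points = H.node '' {a | H.node a ∈ C.points} := by
  ext q
  constructor
  · rintro ⟨⟨a, rfl⟩, h⟩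
    exact ⟨a, h, rfl⟩
  · rintro ⟨a, h, rfl⟩
    exact ⟨⟨a, rfl⟩, h⟩

theorem ncard_cusps_inter_conic (l : AffLine) :
    (Set.range H.cusp ∩ (H.conic l).points).ncard = 6 := by
  classical
  rw [H.cusps_inter, Set.ncard_image_setOf H.cusp_injective]
  simp only [H.cusp_mem_conic]
  revert l; decide

theorem ncard_nodes_inter_conic (l : AffLine) :
    (Set.range H.node ∩ (H.conic l).points).ncard = 2 := by
  classical
  rw [H.nodes_inter, Set.ncard_image_setOf H.node_injective]
  simp only [H.node_mem_conic]
  revert l; decide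

theorem ncard_cusps_inter_line (a : AffPoint) :
    (Set.range H.cusp ∩ (H.line a).points).ncard = 1 := by
  classical
  rw [H.cusps_inter, Set.ncard_image_setOf H.cusp_injective]
  simp only [H.cusp_mem_line]
  revert a; decide

theorem ncard_nodes_inter_line (a : AffPoint) :
    (Set.range H.node ∩ (H.line a).points).ncard = 4 := by
  classical
  rw [H.nodes_inter, Set.ncard_image_setOf H.node_injective]
  simp only [H.node_mem_line]
  revert a; decide

/-- By `exists_five_le`, six cusps always include five lying on one of the twelve conics, and five
common points force two conics to agree when one of them is parametrized. -/
theorem hesseConics_eq : hesseConics E = Set.range H.conic := by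
  classical
  ext C
  constructor
  · rintro ⟨hC, -, h6⟩
    rw [H.dualCusps_eq, H.cusps_inter, Set.ncard_image_setOf H.cusp_injective] at h6
    obtain ⟨l, hl⟩ := exists_five_le _ h6
    refine ⟨l, ?_⟩
    obtain ⟨φ, hφ⟩ := H.exists_conic_parametrization l
    refine PlaneCurve.eq_of_card_lt hφ hC.symm
      ((((Finset.univ.filter fun a => H.cusp a ∈ C.points)).filter
        fun a => ¬ Inc a l).image H.cusp) ?_ ?_ ?_
    · simp only [Finset.mem_image, Finset.mem_filter]
      rintro _ ⟨a, ha, rfl⟩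
      exact H.cusp_mem_conic.2 ha.2
    · simp only [Finset.mem_image, Finset.mem_filter]
      rintro _ ⟨a, ha, rfl⟩
      exact ha.1.2
    · rw [Finset.card_image_of_injective _ H.cusp_injective, hC]
      omega
  · rintro ⟨l, rfl⟩
    obtain ⟨φ, hφ⟩ := H.exists_conic_parametrization l
    refine ⟨rfl, hφ.irreducible, ?_⟩
    rw [H.dualCusps_eq, H.ncard_cusps_inter_conic]

/-! ### Seshadri constants and the quintic -/

/-- Sums over the singular points of the arrangement of conics. -/
theorem finsum_sing (m : Plane → ℕ) :
    ∑ᶠ q ∈ Set.range H.cusp ∪ Set.range H.node, m q =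
      ∑ a, m (H.cusp a) + ∑ l, m (H.node l) := by
  rw [finsum_mem_union H.disjoint_cusp_node (Set.finite_range _) (Set.finite_range _),
    finsum_mem_range H.cusp_injective, finsum_mem_range H.node_injective,
    finsum_eq_sum_of_fintype, finsum_eq_sum_of_fintype]

theorem configurationalSeshadri_conics :
    Arrangement.configurationalSeshadri (Set.range H.conic) = 1 / 4 := by
  have h1 : ∑ᶠ C ∈ Set.range H.conic, C.degree = 24 := by
    rw [finsum_mem_range H.conic_injective, finsum_eq_sum_of_fintype]
    simp only [H.conic_degree]
    decide
  have h2 : ∑ᶠ p ∈ Arrangement.sing (Set.range H.conic),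
      Arrangement.mult (Set.range H.conic) p = 96 := by
    rw [H.sing_conics, H.finsum_sing]
    simp only [H.mult_cusp, H.mult_node]
    decide
  rw [Arrangement.configurationalSeshadri, h1, h2]
  norm_num

theorem seshadriRatio_conic (l : AffLine) :
    (H.conic l).seshadriRatio (Set.range H.cusp ∪ Set.range H.node) = 1 / 4 := by
  classical
  have h : ∑ᶠ p ∈ Set.range H.cusp ∪ Set.range H.node, (H.conic l).mult p = 8 := by
    rw [H.finsum_sing]
    simp only [(H.conic_isSmooth l).mult_eq, H.cusp_mem_conic, H.node_mem_conic]
    revert l; decide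
  rw [PlaneCurve.seshadriRatio, h, H.conic_degree]
  norm_num

theorem seshadriRatio_line (a : AffPoint) :
    (H.line a).seshadriRatio (Set.range H.cusp ∪ Set.range H.node) = 1 / 5 := by
  classical
  have h : ∑ᶠ p ∈ Set.range H.cusp ∪ Set.range H.node, (H.line a).mult p = 5 := by
    rw [H.finsum_sing]
    simp only [(H.line_isSmooth a).mult_eq, H.cusp_mem_line, H.node_mem_line]
    revert a; decide
  rw [PlaneCurve.seshadriRatio, h, H.line_degree]
  norm_num

/-- Three lines and a conic pass through all singular points. -/
theorem mem_line_or_mem_conic {q : Plane} (hq : q ∈ Set.range H.cusp ∪ Set.range H.node) :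
    (∃ k, q ∈ (H.line (0, k)).points) ∨ q ∈ (H.conic (none, 0)).points := by
  -- The points `(0, k)` are those of the affine line `(none, 0)`. A cusp is on one of the three
  -- lines or on the conic according as its point is on this affine line or off it. A node is on one
  -- of the lines if its affine line meets or equals `(none, 0)`, and on the conic if it is a
  -- different parallel.
  rcases hq with ⟨a, rfl⟩ | ⟨l, rfl⟩
  · simp only [H.cusp_mem_line, H.cusp_mem_conic]
    revert a; decide
  · simp only [H.node_mem_line, H.node_mem_conic]
    revert l; decide

omit H in
theorem _root_.PlaneCurve.IsIntegral.eq_of_dvd {C D : PlaneCurve} (hC : C.IsIntegral)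
    (hD : Irreducible D.form) (h : D.form ∣ C.form) : D = C := by
  refine PlaneCurve.eq_of_form_dvd ?_ h
  have h1 : C.form ∣ D.form := (hD.associated_of_dvd hC h).symm.dvd
  have h2 := totalDegree_le_of_dvd_of_isDomain h C.form_ne_zero
  have h3 := totalDegree_le_of_dvd_of_isDomain h1 D.form_ne_zero
  rw [C.form_isHomogeneous.totalDegree C.form_ne_zero,
    D.form_isHomogeneous.totalDegree D.form_ne_zero] at h2 h3
  exact le_antisymm h2 h3

/-- Bézout is applied to `C` and each component of the quintic through all 21 points: the three
lines contribute at most `deg C` each and the conic at most `2 deg C`. -/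
theorem sum_mult_le_of_not_dvd {C : PlaneCurve} (hline : ∀ a, ¬ (H.line a).form ∣ C.form)
    (hconic : ∀ l, ¬ (H.conic l).form ∣ C.form) :
    ∑ᶠ q ∈ Set.range H.cusp ∪ Set.range H.node, C.mult q ≤ 5 * C.degree := by
  classical
  have hfin : (Set.range H.cusp ∪ Set.range H.node).Finite :=
    (Set.finite_range _).union (Set.finite_range _)
  rw [finsum_mem_eq_finite_toFinset_sum _ hfin]
  have h1 : ∀ k, ∑ q ∈ hfin.toFinset.filter (· ∈ (H.line (0, k)).points), C.mult q ≤
      1 * C.degree := by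
    intro k
    obtain ⟨φ, hφ⟩ := H.exists_line_parametrization (0, k)
    exact PlaneCurve.sum_mult_le hφ (hline _) _ fun p hp => (Finset.mem_filter.1 hp).2
  have h2 : ∑ q ∈ hfin.toFinset.filter (· ∈ (H.conic (none, 0)).points), C.mult q ≤
      2 * C.degree := by
    obtain ⟨φ, hφ⟩ := H.exists_conic_parametrization (none, 0)
    exact PlaneCurve.sum_mult_le hφ (hconic _) _ fun p hp => (Finset.mem_filter.1 hp).2
  have h3 : ∑ q ∈ hfin.toFinset, C.mult q ≤
      ∑ k, ∑ q ∈ hfin.toFinset.filter (· ∈ (H.line (0, k)).points), C.mult q +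
        ∑ q ∈ hfin.toFinset.filter (· ∈ (H.conic (none, 0)).points), C.mult q := by
    simp only [Finset.sum_filter]
    rw [Finset.sum_comm, ← Finset.sum_add_distrib]
    -- Each singular point is counted on the right at least once, on a component of the quintic
    -- containing it.
    refine Finset.sum_le_sum fun q hq => ?_
    rcases H.mem_line_or_mem_conic (hfin.mem_toFinset.1 hq) with ⟨k, hk⟩ | hk
    · refine le_trans ?_ (Nat.le_add_right _ _)
      refine le_trans ?_ (Finset.single_le_sum (fun _ _ => Nat.zero_le _) (Finset.mem_univ k))
      rw [if_pos hk]
    · rw [if_pos hk]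
      exact Nat.le_add_left _ _
  have h4 := Finset.sum_le_sum fun k (_ : k ∈ (Finset.univ : Finset (ZMod 3))) => h1 k
  rw [Finset.sum_const, Finset.card_univ, ZMod.card, smul_eq_mul] at h4
  omega

/-- The lines attain 1/5 and the conics have the larger ratio 1/4. For every other integral curve no
line or conic of the configuration divides its equation, and the quintic bound applies. -/
theorem seshadriConstant_eq :
    seshadriConstant (Set.range H.cusp ∪ Set.range H.node) = 1 / 5 := by
  refine IsLeast.csInf_eq ⟨?_, ?_⟩
  · obtain ⟨φ, hφ⟩ := H.exists_line_parametrization 0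
    exact ⟨H.line 0, hφ.irreducible, ⟨H.cusp 0, Or.inl ⟨0, rfl⟩, H.cusp_mem_line.2 rfl⟩,
      (H.seshadriRatio_line 0).symm⟩
  · rintro _ ⟨C, hC, ⟨q, hqZ, hqC⟩, rfl⟩
    by_cases hline : ∃ a, (H.line a).form ∣ C.form
    · obtain ⟨a, ha⟩ := hline
      obtain ⟨φ, hφ⟩ := H.exists_line_parametrization a
      rw [← hC.eq_of_dvd hφ.irreducible ha, H.seshadriRatio_line]
    by_cases hconic : ∃ l, (H.conic l).form ∣ C.form
    · obtain ⟨l, hl⟩ := hconic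
      obtain ⟨φ, hφ⟩ := H.exists_conic_parametrization l
      rw [← hC.eq_of_dvd hφ.irreducible hl, H.seshadriRatio_conic]
      norm_num
    have h1 := H.sum_mult_le_of_not_dvd (not_exists.1 hline) (not_exists.1 hconic)
    have h2 : 0 < ∑ᶠ q ∈ Set.range H.cusp ∪ Set.range H.node, C.mult q := by
      have hfin : (Set.range H.cusp ∪ Set.range H.node).Finite :=
        (Set.finite_range _).union (Set.finite_range _)
      rw [finsum_mem_eq_finite_toFinset_sum _ hfin]
      exact Finset.sum_pos' (fun _ _ => Nat.zero_le _)
        ⟨q, hfin.mem_toFinset.2 hqZ, PlaneCurve.mult_pos_iff.2 hqC⟩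
    rw [PlaneCurve.seshadriRatio, div_le_div_iff₀ (by norm_num) (by exact_mod_cast h2), one_mul,
      mul_comm]
    exact_mod_cast h1

theorem exists_quintic : ∃ Q : PlaneCurve, Q.degree = 5 ∧
    Associated Q.form ((H.line (0, 0)).form * (H.line (0, 1)).form * (H.line (0, 2)).form *
      (H.conic (none, 0)).form) ∧
    Set.range H.cusp ∪ Set.range H.node ⊆ Q.points := by
  have h1 := ((((H.line (0, 0)).form_isHomogeneous.mul (H.line (0, 1)).form_isHomogeneous).mul
    (H.line (0, 2)).form_isHomogeneous).mul (H.conic (none, 0)).form_isHomogeneous)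
  have h2 : (H.line (0, 0)).form * (H.line (0, 1)).form * (H.line (0, 2)).form *
      (H.conic (none, 0)).form ≠ 0 :=
    mul_ne_zero (mul_ne_zero (mul_ne_zero (PlaneCurve.form_ne_zero _) (PlaneCurve.form_ne_zero _))
      (PlaneCurve.form_ne_zero _)) (PlaneCurve.form_ne_zero _)
  refine ⟨PlaneCurve.ofForm _ _ h1 h2, rfl, PlaneCurve.associated_form_ofForm _ _ h1 h2, ?_⟩
  intro q hq
  rw [← q.mk_rep, PlaneCurve.mk_mem_points_ofForm, map_mul, map_mul, map_mul]
  rcases H.mem_line_or_mem_conic hq with ⟨k, hk⟩ | hk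
  · have hk' : k = 0 ∨ k = 1 ∨ k = 2 := by
      clear hk
      revert k
      decide
    rw [PlaneCurve.mem_points] at hk
    rcases hk' with rfl | rfl | rfl <;> simp [hk]
  · rw [PlaneCurve.mem_points] at hk
    simp [hk]

end HesseConfiguration

/-! ### Flexes and the Hessian -/

/-- The Hessian matrix of a form at a point. -/
noncomputable def hessian (F : MvPolynomial (Fin 3) ℂ) (v : Fin 3 → ℂ) :
    Matrix (Fin 3) (Fin 3) ℂ := Matrix.of fun i j => eval v (pderiv i (pderiv j F))

theorem pderiv_comm (i j : Fin 3) (F : MvPolynomial (Fin 3) ℂ) :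
    pderiv i (pderiv j F) = pderiv j (pderiv i F) := by
  let D : Fin 3 → Derivation ℂ (MvPolynomial (Fin 3) ℂ) (MvPolynomial (Fin 3) ℂ) := pderiv
  have : ⁅D i, D j⁆ = 0 := by
    refine MvPolynomial.derivation_ext (R := ℂ) fun k => ?_
    simp [D, Derivation.commutator_apply, pderiv_X, Pi.single_apply, apply_ite]
  have h := DFunLike.congr_fun this F
  rw [Derivation.commutator_apply, Derivation.zero_apply, sub_eq_zero] at h
  exact h

theorem hessian_linSubst (N : Matrix (Fin 3) (Fin 3) ℂ) (F : MvPolynomial (Fin 3) ℂ)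
    (v : Fin 3 → ℂ) :
    hessian (linSubst N F) v = N.transpose * hessian F (N.mulVec v) * N := by
  ext i j
  simp only [hessian, Matrix.of_apply, pderiv_linSubst, map_sum, pderiv_C_mul, map_mul, eval_C,
    eval_linSubst, Matrix.mul_apply, Matrix.transpose_apply, Finset.mul_sum, Finset.sum_mul]
  refine Finset.sum_congr rfl fun k _ => Finset.sum_congr rfl fun l _ => ?_
  ring

/-- The intersection of a curve with a line, up to the second order. -/
theorem X_pow_three_dvd_iff (F : MvPolynomial (Fin 3) ℂ) (p v : Fin 3 → ℂ) :
    (Polynomial.X : Polynomial ℂ) ^ 3 ∣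
      aeval (fun i => Polynomial.C (p i) + Polynomial.C (v i) * Polynomial.X) F ↔
    eval p F = 0 ∧ (fun i => eval p (pderiv i F)) ⬝ᵥ v = 0 ∧
      v ⬝ᵥ (hessian F p).mulVec v = 0 := by
  set g : Fin 3 → Polynomial ℂ := fun i => Polynomial.C (p i) + Polynomial.C (v i) * Polynomial.X
    with hg
  have hev : ∀ G : MvPolynomial (Fin 3) ℂ, (aeval g G).coeff 0 = eval p G := by
    intro G
    have : (Polynomial.constantCoeff).comp (aeval g).toRingHom = eval p := by
      apply MvPolynomial.ringHom_ext
      · simp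
      · intro i; simp [hg]
    exact DFunLike.congr_fun this G
  have hder : ∀ G : MvPolynomial (Fin 3) ℂ, Polynomial.derivative (aeval g G) =
      ∑ i, aeval g (pderiv i G) * Polynomial.C (v i) := by
    intro G
    rw [derivative_aeval_eq]
    simp [hg]
  have h1 : (aeval g F).coeff 1 = (fun i => eval p (pderiv i F)) ⬝ᵥ v := by
    have := Polynomial.coeff_derivative (aeval g F) 0
    rw [hder, Polynomial.finsetSum_coeff] at this
    simp only [Polynomial.coeff_mul_C, hev] at this
    simpa [dotProduct] using this.symm
  have h2 : (aeval g F).coeff 2 * 2 = v ⬝ᵥ (hessian F p).mulVec v := by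
    have h3 := Polynomial.coeff_derivative (aeval g F) 1
    have h4 := Polynomial.coeff_derivative (Polynomial.derivative (aeval g F)) 0
    rw [h3, hder F, map_sum, Polynomial.finsetSum_coeff] at h4
    simp only [Polynomial.derivative_mul, Polynomial.derivative_C, mul_zero, add_zero, hder,
      Polynomial.coeff_mul_C, Polynomial.finsetSum_coeff, hev] at h4
    have h5 : (aeval g F).coeff 2 * 2 =
        ∑ x, (∑ i, eval p (pderiv i (pderiv x F)) * v i) * v x := by
      rw [h4]; norm_num
    rw [h5, dotProduct]
    simp only [Matrix.mulVec, dotProduct, hessian, Matrix.of_apply]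
    refine Finset.sum_congr rfl fun x _ => ?_
    rw [Finset.mul_sum, Finset.sum_mul]
    refine Finset.sum_congr rfl fun i _ => ?_
    rw [pderiv_comm i x]
    ring
  rw [Polynomial.X_pow_dvd_iff]
  constructor
  · intro h
    refine ⟨?_, ?_, ?_⟩
    · rw [← hev]; exact h 0 (by norm_num)
    · rw [← h1]; exact h 1 (by norm_num)
    · rw [← h2, h 2 (by norm_num), zero_mul]
  · rintro ⟨h0, h1', h2'⟩ d hd
    interval_cases d
    · rw [hev, h0]
    · rw [h1, h1']
    · rw [h2'] at h2
      simpa using h2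

theorem euler_grad {F : MvPolynomial (Fin 3) ℂ} {d : ℕ} (hF : F.IsHomogeneous d)
    (p : Fin 3 → ℂ) : ∑ i, p i * eval p (pderiv i F) = d * eval p F := by
  have := congrArg (eval p) hF.sum_X_mul_pderiv
  simpa using this

theorem euler_hessian {F : MvPolynomial (Fin 3) ℂ} (hF : F.IsHomogeneous 3) (p : Fin 3 → ℂ)
    (j : Fin 3) : ∑ i, p i * hessian F p i j = 2 * eval p (pderiv j F) := by
  have h := euler_grad (hF.pderiv (i := j)) p
  simpa [hessian] using h

/-- The second fundamental form of a cubic cone and its Hessian determinant. -/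
theorem four_mul_hessian_cross {F : MvPolynomial (Fin 3) ℂ} (hF : F.IsHomogeneous 3)
    {p : Fin 3 → ℂ} (hp : eval p F = 0) (e : Fin 3 → ℂ) (g v : Fin 3 → ℂ)
    (hg : g = fun i => eval p (pderiv i F))
    (hv : v = ![g 1 * e 2 - g 2 * e 1, g 2 * e 0 - g 0 * e 2, g 0 * e 1 - g 1 * e 0]) :
    4 * (v ⬝ᵥ (hessian F p).mulVec v) = -(hessian F p).det * (p ⬝ᵥ e) ^ 2 := by
  have hg' : ∀ j, g j = (∑ i, p i * hessian F p i j) / 2 := fun j => by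
    rw [euler_hessian hF, hg]; ring
  have h3 : ∑ j, p j * g j = 0 := by
    rw [hg, euler_grad hF, hp, mul_zero]
  have hsymm : ∀ i j, hessian F p i j = hessian F p j i := fun i j => by
    simp [hessian, pderiv_comm i j]
  have h10 := hsymm 1 0
  have h20 := hsymm 2 0
  have h21 := hsymm 2 1
  simp only [hg', Fin.sum_univ_three, h10, h20, h21] at h3
  subst hv
  rw [Matrix.det_fin_three]
  simp only [dotProduct, Matrix.mulVec, Fin.sum_univ_three, hg', h10, h20, h21,
    Matrix.cons_val_zero, Matrix.cons_val_one, Matrix.cons_val]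
  generalize hessian F p 0 0 = a at *
  generalize hessian F p 0 1 = b at *
  generalize hessian F p 0 2 = c at *
  generalize hessian F p 1 1 = d at *
  generalize hessian F p 1 2 = k at *
  generalize hessian F p 2 2 = m at *
  -- The coefficient is twice the adjugate quadratic form of the Hessian at `e`. For `e = H f` the
  -- identity follows from `(H p) × (H f) = adj(H) (p × f)` and Lagrange's identity, in which the
  -- term with `p ⬝ᵥ H p` drops out.
  linear_combination 2 * ((d * m - k ^ 2) * e 0 ^ 2 + (a * m - c ^ 2) * e 1 ^ 2 +
    (a * d - b ^ 2) * e 2 ^ 2 + 2 * (c * k - b * m) * e 0 * e 1 +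
    2 * (b * k - c * d) * e 0 * e 2 + 2 * (b * c - a * k) * e 1 * e 2) * h3

/-- A vector orthogonal to `g` is a cross product with `g`. -/
theorem exists_cross_eq {g v : Fin 3 → ℂ} (hg : g ≠ 0) (h : g ⬝ᵥ v = 0) :
    ∃ e : Fin 3 → ℂ,
      v = ![g 1 * e 2 - g 2 * e 1, g 2 * e 0 - g 0 * e 2, g 0 * e 1 - g 1 * e 0] := by
  simp only [dotProduct, Fin.sum_univ_three] at h
  by_cases h0 : g 0 = 0
  · by_cases h1 : g 1 = 0
    · have h2 : g 2 ≠ 0 := fun h2 => hg (by ext i; fin_cases i <;> assumption)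
      refine ⟨![v 1 / g 2, -v 0 / g 2, 0], ?_⟩
      have h3 : v 2 = 0 := by simpa [h0, h1, h2] using h
      ext i; fin_cases i <;> simp [h0, h1, h3] <;> field_simp
    · refine ⟨![-v 2 / g 1, 0, v 0 / g 1], ?_⟩
      have h3 : g 1 * v 1 = - (g 2 * v 2) := by rw [h0] at h; linear_combination h
      ext i; fin_cases i <;> simp [h0] <;> field_simp
      linear_combination h3
  · refine ⟨![0, v 2 / g 0, -v 1 / g 0], ?_⟩
    ext i; fin_cases i <;> simp <;> field_simp
    linear_combination h

/-- The flexes of a smooth cubic are its intersections with the Hessian curve. -/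
theorem mem_flexes_iff {E : PlaneCurve} (hdeg : E.degree = 3) (hE : E.IsSmooth) (x : Plane) :
    x ∈ E.flexes ↔ eval x.rep E.form = 0 ∧ (hessian E.form x.rep).det = 0 := by
  have hF : E.form.IsHomogeneous 3 := by
    have := E.form_isHomogeneous
    rwa [hdeg] at this
  constructor
  · rintro ⟨hx, hg, h⟩
    refine ⟨hx, ?_⟩
    obtain ⟨i, hi⟩ := Function.ne_iff.1 x.rep_nonzero
    -- A coordinate vector `e` with `p ⬝ᵥ e ≠ 0`, so that the second-order vanishing along the
    -- tangent direction `g × e` forces the Hessian determinant to vanish.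
    let e : Fin 3 → ℂ := Pi.single i 1
    have key := four_mul_hessian_cross hF hx e _ _ rfl rfl
    rw [((X_pow_three_dvd_iff _ _ _).1 (h _ ?_)).2.2] at key
    · have h1 : x.rep ⬝ᵥ e = x.rep i := by simp [e]
      rw [h1, mul_zero] at key
      simpa using (mul_eq_zero.1 key.symm).resolve_right (pow_ne_zero 2 hi)
    · simp only [dotProduct, Fin.sum_univ_three, PlaneCurve.grad, Matrix.cons_val_zero,
        Matrix.cons_val_one, Matrix.cons_val]
      ring
  · rintro ⟨hx, hdet⟩
    refine ⟨hx, hE.grad_ne_zero hx, fun v hv => ?_⟩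
    obtain ⟨e, he⟩ := exists_cross_eq (hE.grad_ne_zero hx) hv
    rw [X_pow_three_dvd_iff]
    refine ⟨hx, hv, ?_⟩
    have key := four_mul_hessian_cross hF hx e _ v rfl he
    rw [hdet] at key
    simpa using key

theorem hessian_det_isHomogeneous_aux {F : MvPolynomial (Fin 3) ℂ} (hF : F.IsHomogeneous 3) :
    hessian F 0 = 0 := by
  ext i j
  exact eval_zero_of_isHomogeneous (hF.pderiv.pderiv) (by norm_num)

/-- A smooth cubic has a flex. -/
theorem exists_mem_flexes {E : PlaneCurve} (hdeg : E.degree = 3) (hE : E.IsSmooth) :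
    ∃ x, x ∈ E.flexes := by
  have hF : E.form.IsHomogeneous 3 := by
    have := E.form_isHomogeneous
    rwa [hdeg] at this
  let G : MvPolynomial (Fin 3) ℂ :=
    (Matrix.of fun i j => pderiv i (pderiv j E.form) : Matrix (Fin 3) (Fin 3) _).det
  have hG : ∀ v, eval v G = (hessian E.form v).det := by
    intro v
    rw [RingHom.map_det]
    rfl
  -- The cubic and its Hessian, which both vanish at the origin, have a common zero elsewhere.
  obtain ⟨v, hv, h1, h2⟩ := exists_common_zero E.form G
    (eval_zero_of_isHomogeneous hF (by norm_num))
    (by rw [hG, hessian_det_isHomogeneous_aux hF, Matrix.det_zero])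
  obtain ⟨a, ha⟩ := Projectivization.exists_smul_eq_mk_rep ℂ v hv
  refine ⟨Projectivization.mk ℂ v hv, (mem_flexes_iff hdeg hE _).2 ⟨?_, ?_⟩⟩
  · exact (PlaneCurve.mk_mem_points hv).2 h1
  · rw [hG] at h2
    have : hessian E.form ((a : ℂ) • v) = (a : ℂ) • hessian E.form v := by
      ext i j
      simp only [hessian, Matrix.of_apply, Matrix.smul_apply]
      rw [eval_smul_of_isHomogeneous hF.pderiv.pderiv]
      simp
    rw [← ha, Units.smul_def, this, Matrix.det_smul, h2, mul_zero]

/-! ### Normal forms of smooth cubics -/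

/-- Forms that differ by an invertible linear change of coordinates. -/
def LinEquivalent (F G : MvPolynomial (Fin 3) ℂ) : Prop :=
  ∃ N M : Matrix (Fin 3) (Fin 3) ℂ, M * N = 1 ∧ F = linSubst N G

namespace LinEquivalent

theorem symm {F G : MvPolynomial (Fin 3) ℂ} (h : LinEquivalent F G) : LinEquivalent G F := by
  obtain ⟨N, M, h, rfl⟩ := h
  exact ⟨M, N, mul_eq_one_comm.1 h, by rw [linSubst_linSubst, mul_eq_one_comm.1 h, linSubst_one]⟩

theorem trans {F G K : MvPolynomial (Fin 3) ℂ} (h : LinEquivalent F G) (h' : LinEquivalent G K) :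
    LinEquivalent F K := by
  obtain ⟨N, M, h, rfl⟩ := h
  obtain ⟨N', M', h', rfl⟩ := h'
  refine ⟨N' * N, M * M', ?_, by rw [linSubst_linSubst]⟩
  rw [Matrix.mul_assoc, ← Matrix.mul_assoc M', h', Matrix.one_mul, h]

theorem isNonsingularForm {F G : MvPolynomial (Fin 3) ℂ} (h : LinEquivalent F G)
    (hF : IsNonsingularForm F) : IsNonsingularForm G := by
  obtain ⟨N, M, hMN, rfl⟩ := h.symm
  exact hF.linSubst hMN

theorem of_det {F G : MvPolynomial (Fin 3) ℂ} (N : Matrix (Fin 3) (Fin 3) ℂ) (hN : N.det ≠ 0)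
    (h : ∀ v, eval v F = eval (N.mulVec v) G) : LinEquivalent F G :=
  ⟨N, N⁻¹, Matrix.nonsing_inv_mul N hN.isUnit, MvPolynomial.funext fun v => by
    rw [h, eval_linSubst]⟩

end LinEquivalent

theorem exists_sq_add_self_add_one : ∃ w : ℂ, w ^ 2 + w + 1 = 0 := by
  obtain ⟨s, hs⟩ := IsAlgClosed.exists_pow_nat_eq (-3 : ℂ) two_pos
  exact ⟨(-1 + s) / 2, by linear_combination hs / 4⟩

/-- The three linear forms are the discrete Fourier transform of `(x, y, z)`. Together with
`prod_fourier` this expresses `27 x y z` as the sum of their cubes minus three times their product.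
-/
theorem sum_fourier_pow_three {w : ℂ} (hw : w ^ 2 + w + 1 = 0) (x y z : ℂ) :
    (x + y + z) ^ 3 + (x + w ^ 2 * y + w * z) ^ 3 + (x + w * y + w ^ 2 * z) ^ 3 =
      3 * (x ^ 3 + y ^ 3 + z ^ 3) + 18 * x * y * z := by
  linear_combination ((w - 1) * (w ^ 3 + 2) * (y ^ 3 + z ^ 3) + 3 * x ^ 2 * (y + z) +
    3 * (w ^ 2 - w + 1) * x * (y ^ 2 + z ^ 2) + 12 * (w - 1) * x * y * z +
    3 * (w ^ 3 - w + 1) * (y ^ 2 * z + y * z ^ 2)) * hw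

theorem prod_fourier {w : ℂ} (hw : w ^ 2 + w + 1 = 0) (x y z : ℂ) :
    (x + y + z) * (x + w ^ 2 * y + w * z) * (x + w * y + w ^ 2 * z) =
      x ^ 3 + y ^ 3 + z ^ 3 - 3 * x * y * z := by
  linear_combination ((x + y + z) * ((w - 1) * (y ^ 2 + z ^ 2) + x * y + x * z +
    (w ^ 2 - w + 1) * y * z)) * hw

theorem self_sub_sq_ne_zero {w : ℂ} (hw : w ^ 2 + w + 1 = 0) : w - w ^ 2 ≠ 0 := by
  intro h
  have h1 : w = -1 / 2 := by linear_combination (hw + h) / 2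
  rw [h1] at hw
  norm_num at hw

theorem pow_three_eq_one {w : ℂ} (hw : w ^ 2 + w + 1 = 0) : w ^ 3 = 1 := by
  linear_combination (w - 1) * hw

/-- The Fermat cubic. -/
noncomputable def fermatForm : MvPolynomial (Fin 3) ℂ := X 0 ^ 3 + X 1 ^ 3 + X 2 ^ 3

/-- The Hesse pencil of cubics. -/
noncomputable def hesseForm (l : ℂ) : MvPolynomial (Fin 3) ℂ :=
  X 0 ^ 3 + X 1 ^ 3 + X 2 ^ 3 - C (3 * l) * X 0 * X 1 * X 2

/-- Weierstrass cubics. -/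
noncomputable def weierstrassForm (a b : ℂ) : MvPolynomial (Fin 3) ℂ :=
  X 0 ^ 3 + C a * X 0 * X 2 ^ 2 + C b * X 2 ^ 3 - X 1 ^ 2 * X 2

/-- Cubics with three collinear flexes and the coordinate lines as inflectional tangents. -/
noncomputable def trilateralForm (k : ℂ) : MvPolynomial (Fin 3) ℂ :=
  (X 0 + X 1 + X 2) ^ 3 + C k * X 0 * X 1 * X 2

/-- With `z' = -l z / 2` one has `z' ^ 3 = z ^ 3`, and the Fourier identity at `(x, y, z')` gives
three times the Hesse form; `c ^ 3 = 1 / 3` absorbs the factor. -/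
theorem hesseForm_linEquivalent_fermatForm {l : ℂ} (hl : l ^ 3 = -8) :
    LinEquivalent (hesseForm l) fermatForm := by
  obtain ⟨w, hw⟩ := exists_sq_add_self_add_one
  obtain ⟨c, hc⟩ := IsAlgClosed.exists_pow_nat_eq (1 / 3 : ℂ) three_pos
  have hc0 : c ≠ 0 := by rintro rfl; norm_num at hc
  have hl0 : l ≠ 0 := by rintro rfl; norm_num at hl
  have hw1 := self_sub_sq_ne_zero hw
  refine LinEquivalent.of_det (Matrix.of ![![c, c, -c * l / 2], ![c, c * w ^ 2, -c * w * l / 2],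
    ![c, c * w, -c * w ^ 2 * l / 2]]) ?_ ?_
  · have : (Matrix.of ![![c, c, -c * l / 2], ![c, c * w ^ 2, -c * w * l / 2],
        ![c, c * w, -c * w ^ 2 * l / 2]]).det = -(3 * c ^ 3 * l / 2 * (w - w ^ 2)) := by
      have h3 := pow_three_eq_one hw
      simp [Matrix.det_fin_three]
      linear_combination (-c ^ 3 * l / 2 * w) * h3
    rw [this]
    simp [hc0, hl0, hw1]
  · intro v
    have h1 := sum_fourier_pow_three hw (v 0) (v 1) (-l * v 2 / 2)
    simp [hesseForm, fermatForm, dotProduct, Fin.sum_univ_three]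
    linear_combination (-1 / 3 : ℂ) * h1 + v 2 ^ 3 / 8 * hl -
      ((v 0 + v 1 + -l * v 2 / 2) ^ 3 + (v 0 + w ^ 2 * v 1 + w * (-l * v 2 / 2)) ^ 3 +
        (v 0 + w * v 1 + w ^ 2 * (-l * v 2 / 2)) ^ 3) * hc

/-- In Fourier coordinates `S₀ = x + y + z`, `S₁`, `S₂` the form is `((27 + k) S₀³ + k S₁³ + k S₂³ -
3 k S₀ S₁ S₂) / 27`. Scaling by cube roots `r` of `27 + k` and `t` of `k` gives the Hesse form with
`l = t / r`. -/
theorem trilateralForm_linEquivalent {k : ℂ} (hk : k ≠ 0)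
    (hns : IsNonsingularForm (trilateralForm k)) :
    ∃ l : ℂ, l ≠ 0 ∧ l ^ 3 ≠ 1 ∧ LinEquivalent (trilateralForm k) (hesseForm l) := by
  -- For `k = -27` the point `(1 : 1 : 1)` is singular.
  have hk27 : 27 + k ≠ 0 := by
    intro h
    obtain ⟨i, hi⟩ := hns ![1, 1, 1] (fun h => by simpa using congrFun h 0)
      (by simp [trilateralForm]; linear_combination h)
    apply hi
    fin_cases i <;> simp [trilateralForm, pderiv_X] <;> linear_combination h
  obtain ⟨w, hw⟩ := exists_sq_add_self_add_one
  obtain ⟨r, hr⟩ := IsAlgClosed.exists_pow_nat_eq (27 + k) three_pos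
  obtain ⟨t, ht⟩ := IsAlgClosed.exists_pow_nat_eq k three_pos
  have hr0 : r ≠ 0 := by rintro rfl; apply hk27; rw [← hr]; norm_num
  have ht0 : t ≠ 0 := by rintro rfl; apply hk; rw [← ht]; norm_num
  have h3 := pow_three_eq_one hw
  have hw1 := self_sub_sq_ne_zero hw
  refine ⟨t / r, div_ne_zero ht0 hr0, ?_, LinEquivalent.of_det
    (Matrix.of ![![r / 3, r / 3, r / 3], ![t / 3, t * w ^ 2 / 3, t * w / 3],
      ![t / 3, t * w / 3, t * w ^ 2 / 3]]) ?_ ?_⟩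
  · rw [div_pow, hr, ht, Ne, div_eq_one_iff_eq hk27]
    intro h
    have : (27 : ℂ) = 0 := by linear_combination -h
    norm_num at this
  · have : (Matrix.of ![![r / 3, r / 3, r / 3], ![t / 3, t * w ^ 2 / 3, t * w / 3],
      ![t / 3, t * w / 3, t * w ^ 2 / 3]]).det = r * t ^ 2 / 9 * (w - w ^ 2) := by
      simp [Matrix.det_fin_three]
      linear_combination (r * t ^ 2 / 27 * w) * h3
    rw [this]
    simp [hr0, ht0, hw1]
  · intro v
    have h1 := sum_fourier_pow_three hw (v 0) (v 1) (v 2)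
    have h2 := prod_fourier hw (v 0) (v 1) (v 2)
    have h4 : t / r * r = t := div_mul_cancel₀ t hr0
    simp [hesseForm, trilateralForm, dotProduct, Fin.sum_univ_three]
    generalize t / r = m at h4
    linear_combination (-(v 0 + v 1 + v 2) ^ 3 / 27) * hr -
      ((v 0 + w ^ 2 * v 1 + w * v 2) ^ 3 + (v 0 + w * v 1 + w ^ 2 * v 2) ^ 3) / 27 * ht -
      k / 27 * h1 + k / 9 * h2 +
      (v 0 + v 1 + v 2) * (v 0 + w ^ 2 * v 1 + w * v 2) * (v 0 + w * v 1 + w ^ 2 * v 2) / 9 *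
        (t ^ 2 * h4 + ht)

/-- The part `b z ^ 3 - y ^ 2 z` is the sum of the cubes of `p z + q y` and `p z - q y` when `2 p ^
3 = b` and `6 p q ^ 2 = -1`. -/
theorem weierstrassForm_zero_linEquivalent {b : ℂ}
    (hns : IsNonsingularForm (weierstrassForm 0 b)) :
    LinEquivalent (weierstrassForm 0 b) fermatForm := by
  have hb : b ≠ 0 := by
    rintro rfl
    obtain ⟨i, hi⟩ := hns ![0, 0, 1] (fun h => by simpa using congrFun h 2)
      (by simp [weierstrassForm])
    apply hi
    fin_cases i <;> simp [weierstrassForm, pderiv_X]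
  obtain ⟨p, hp⟩ := IsAlgClosed.exists_pow_nat_eq (b / 2) three_pos
  have hp0 : p ≠ 0 := by rintro rfl; apply hb; linear_combination -2 * hp
  obtain ⟨q, hq⟩ := IsAlgClosed.exists_pow_nat_eq (-1 / (6 * p)) two_pos
  have hq1 : 6 * p * q ^ 2 = -1 := by rw [hq]; field_simp
  have hq0 : q ≠ 0 := by rintro rfl; norm_num at hq1
  refine LinEquivalent.of_det (Matrix.of ![![1, 0, 0], ![0, q, p], ![0, -q, p]]) ?_ ?_
  · have : (Matrix.of ![![1, 0, 0], ![0, q, p], ![0, -q, p]]).det = 2 * q * p := by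
      simp [Matrix.det_fin_three]; ring
    rw [this]
    simp [hq0, hp0]
  · intro v
    simp [weierstrassForm, fermatForm, dotProduct, Fin.sum_univ_three]
    linear_combination (-2 * v 2 ^ 3) * hp - v 1 ^ 2 * v 2 * hq1

/-- If `y = r x + s` is the tangent at a finite flex with abscissa `c`, the cubic equals `(x - c z)³
+ z ((r x + s z)² - y²)`: the cube of a line through three flexes plus the product of their
tangents. Scaling the three tangents so that they add up to `x - c z` gives the trilateral form. -/
theorem weierstrassForm_linEquivalent {a b : ℂ} (ha : a ≠ 0)
    (hns : IsNonsingularForm (weierstrassForm a b)) :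
    ∃ k : ℂ, k ≠ 0 ∧ LinEquivalent (weierstrassForm a b) (trilateralForm k) := by
  -- This is 27 times the 3-division polynomial `3 c⁴ + 6 a c² + 12 b c - a²` at the abscissa `c =
  -- r² / 3` of a flex, rewritten for the slope `r`. The nonzero constant term, from `a ≠ 0`, makes
  -- `r` nonzero.
  obtain ⟨r, hr⟩ : ∃ r : ℂ, r ^ 8 + 18 * a * r ^ 4 + 108 * b * r ^ 2 - 27 * a ^ 2 = 0 := by
    let P : Polynomial ℂ := Polynomial.X ^ 8 + Polynomial.C (18 * a) * Polynomial.X ^ 4 +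
      Polynomial.C (108 * b) * Polynomial.X ^ 2 - Polynomial.C (27 * a ^ 2)
    have hdeg : P.degree = 8 := by simp only [P]; compute_degree!
    obtain ⟨r, hr⟩ := IsAlgClosed.exists_root P (by rw [hdeg]; norm_num)
    exact ⟨r, by simpa [P, Polynomial.IsRoot] using hr⟩
  have hr0 : r ≠ 0 := by rintro rfl; simp at hr; exact ha hr
  obtain ⟨c, hc⟩ : ∃ c, c = r ^ 2 / 3 := ⟨_, rfl⟩
  obtain ⟨s, hs⟩ : ∃ s, s = (a - 3 * c ^ 2) / (2 * r) := ⟨_, rfl⟩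
  have h1 : 2 * r * s + 3 * c ^ 2 = a := by rw [hs]; field_simp; ring
  have h2 : s ^ 2 - c ^ 3 = b := by
    rw [hs, hc]; field_simp; linear_combination -hr
  -- Otherwise the flex has ordinate `r c + s = 0`, and `(c : 0 : 1)` is a singular point.
  have hk : s / r + c ≠ 0 := by
    intro h
    have hs' : s = -r * c := by field_simp at h; linear_combination h
    have h3 : a = -3 * c ^ 2 := by rw [← h1, hs', hc]; ring
    have h4 : b = 2 * c ^ 3 := by rw [← h2, hs', hc]; ring
    obtain ⟨i, hi⟩ := hns ![c, 0, 1] (fun h => by simpa using congrFun h 2)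
      (by simp [weierstrassForm, h3, h4]; ring)
    apply hi
    fin_cases i <;> simp [weierstrassForm, pderiv_X, h3, h4]
    ring
  refine ⟨-(4 * r ^ 2) / (s / r + c), div_ne_zero (by simp [hr0]) hk, LinEquivalent.of_det
    (Matrix.of ![![1 / 2, -1 / (2 * r), s / (2 * r)], ![1 / 2, 1 / (2 * r), s / (2 * r)],
      ![0, 0, -(s / r + c)]]) ?_ ?_⟩
  · have : (Matrix.of ![![1 / 2, -1 / (2 * r), s / (2 * r)], ![1 / 2, 1 / (2 * r), s / (2 * r)],
      ![0, 0, -(s / r + c)]]).det = -(s / r + c) / (2 * r) := by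
      simp [Matrix.det_fin_three]; field_simp; ring
    rw [this]
    exact div_ne_zero (neg_ne_zero.2 hk) (by simp [hr0])
  · intro v
    have hP : -(4 * r ^ 2) / (s / r + c) * ((v 0 / 2 + -1 / (2 * r) * v 1 + s / (2 * r) * v 2) *
        (v 0 / 2 + 1 / (2 * r) * v 1 + s / (2 * r) * v 2) * (-(s / r + c) * v 2)) =
        v 2 * ((r * v 0 + s * v 2) ^ 2 - v 1 ^ 2) := by
      rw [show -(4 * r ^ 2) / (s / r + c) * ((v 0 / 2 + -1 / (2 * r) * v 1 + s / (2 * r) * v 2) *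
        (v 0 / 2 + 1 / (2 * r) * v 1 + s / (2 * r) * v 2) * (-(s / r + c) * v 2)) =
        ((s / r + c) / (s / r + c)) * (4 * r ^ 2 * ((v 0 / 2 + -1 / (2 * r) * v 1 +
          s / (2 * r) * v 2) * (v 0 / 2 + 1 / (2 * r) * v 1 + s / (2 * r) * v 2)) * v 2) by ring,
        div_self hk]
      field_simp
      ring
    have hN : (Matrix.of ![![1 / 2, -1 / (2 * r), s / (2 * r)],
        ![1 / 2, 1 / (2 * r), s / (2 * r)], ![0, 0, -(s / r + c)]]).mulVec v =
        ![v 0 / 2 + -1 / (2 * r) * v 1 + s / (2 * r) * v 2,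
          v 0 / 2 + 1 / (2 * r) * v 1 + s / (2 * r) * v 2, -(s / r + c) * v 2] := by
      ext i
      fin_cases i <;> simp [Matrix.mulVec, dotProduct, Fin.sum_univ_three] <;> ring
    rw [hN]
    simp only [weierstrassForm, trilateralForm, map_add, map_sub, map_mul, map_pow, eval_X, eval_C,
      Matrix.cons_val_zero, Matrix.cons_val_one, Matrix.cons_val]
    have hS' : v 0 / 2 + -1 / (2 * r) * v 1 + s / (2 * r) * v 2 +
        (v 0 / 2 + 1 / (2 * r) * v 1 + s / (2 * r) * v 2) + -(s / r + c) * v 2 =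
        v 0 - c * v 2 := by ring
    rw [hS']
    linear_combination (-v 0 * v 2 ^ 2) * h1 - v 2 ^ 3 * h2 + 3 * v 0 ^ 2 * v 2 * hc - hP

/-- A cubic with a flex at `(0 : 1 : 0)` whose tangent there is the line `z = 0`. -/
noncomputable def flexForm (c e₁ e₂ e₃ e₄ e₅ e₆ : ℂ) : MvPolynomial (Fin 3) ℂ :=
  C c * X 0 ^ 3 + X 2 * (C e₁ * X 1 ^ 2 + C e₂ * X 0 * X 1 + C e₃ * X 0 ^ 2 + C e₄ * X 1 * X 2 +
    C e₅ * X 0 * X 2 + C e₆ * X 2 ^ 2)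

theorem exists_eq_flexForm {F : MvPolynomial (Fin 3) ℂ} (hF : F.IsHomogeneous 3)
    (h0 : eval ![0, 1, 0] F = 0) (h1 : eval ![0, 1, 0] (pderiv 0 F) = 0)
    (h2 : eval ![0, 1, 0] (pderiv 0 (pderiv 0 F)) = 0) :
    ∃ c e₁ e₂ e₃ e₄ e₅ e₆, F = flexForm c e₁ e₂ e₃ e₄ e₅ e₆ := by
  -- The third derivatives `T` of a cubic are constant, and Euler's formula applied repeatedly
  -- expresses the form through them. The three hypotheses kill the monomials `y³`, `x y²` and `x²
  -- y`.
  obtain ⟨T, hT⟩ : ∃ T : Fin 3 → Fin 3 → Fin 3 → ℂ,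
      T = fun i j k => eval 0 (pderiv i (pderiv j (pderiv k F))) := ⟨_, rfl⟩
  have hTv : ∀ v i j k, eval v (pderiv i (pderiv j (pderiv k F))) = T i j k := by
    intro v i j k
    have := eval_smul_of_isHomogeneous ((hF.pderiv (i := k)).pderiv (i := j) |>.pderiv (i := i)) 0 v
    rw [zero_smul] at this
    simp only [hT]
    rw [this]
    simp
  have e2 : ∀ v j k, eval v (pderiv j (pderiv k F)) = ∑ i, v i * T i j k := by
    intro v j k
    have := euler_grad ((hF.pderiv (i := k)).pderiv (i := j)) v
    simpa [hTv] using this.symm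
  have e1 : ∀ v k, 2 * eval v (pderiv k F) = ∑ j, v j * ∑ i, v i * T i j k := by
    intro v k
    have := euler_grad (hF.pderiv (i := k)) v
    simpa [e2] using this.symm
  have e0 : ∀ v, 6 * eval v F = ∑ k, v k * ∑ j, v j * ∑ i, v i * T i j k := by
    intro v
    have := euler_grad hF v
    simp only [← e1]
    rw [Finset.sum_congr rfl fun i _ => mul_left_comm (v i) 2 _, ← Finset.mul_sum, this]
    push_cast
    ring
  have s1 : ∀ i j k, T i j k = T j i k := fun i j k => by
    rw [← hTv 0, ← hTv 0, pderiv_comm]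
  have s2 : ∀ i j k, T i j k = T i k j := fun i j k => by
    rw [← hTv 0, ← hTv 0, pderiv_comm j k]
  have t0 : T 1 1 1 = 0 := by
    have := e0 ![0, 1, 0]
    simpa [h0, Fin.sum_univ_three] using this.symm
  have t1 : T 0 1 1 = 0 := by
    have := e1 ![0, 1, 0] 0
    rw [s1, s2]
    simpa [h1, Fin.sum_univ_three] using this.symm
  have t2 : T 0 0 1 = 0 := by
    have := e2 ![0, 1, 0] 0 0
    rw [s2, s1]
    simpa [h2, Fin.sum_univ_three] using this.symm
  refine ⟨T 0 0 0 / 6, T 1 1 2 / 2, T 0 1 2, T 0 0 2 / 2, T 1 2 2 / 2, T 0 2 2 / 2, T 2 2 2 / 6,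
    MvPolynomial.funext fun v => ?_⟩
  have := e0 v
  simp only [Fin.sum_univ_three] at this
  rw [s1 2 1 0, s2 2 2 1, s1 2 1 1, s1 2 0 0, s1 2 0 1, s1 2 0 2, s1 1 0 0, s1 1 0 1, s1 1 0 2,
    s2 1 2 0, s2 2 2 0, s2 1 2 1, s2 1 1 0, s2 0 2 0, s2 0 2 1, s2 0 1 0, s1 1 0 2, s1 2 0 2,
    s1 1 0 1, s1 2 1 2, t0, t1, t2] at this
  simp only [flexForm, map_add, map_mul, map_pow, eval_X, eval_C]
  linear_combination this / 6

/-- Completing the square in `y` and then the cube in `x` gives the Weierstrass form, once the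
coefficients of `y² z` and `x³` are nonzero. -/
theorem flexForm_linEquivalent {c e₁ e₂ e₃ e₄ e₅ e₆ : ℂ}
    (hns : IsNonsingularForm (flexForm c e₁ e₂ e₃ e₄ e₅ e₆)) :
    ∃ a b, LinEquivalent (flexForm c e₁ e₂ e₃ e₄ e₅ e₆) (weierstrassForm a b) := by
  have he : e₁ ≠ 0 := by
    intro h
    obtain ⟨i, hi⟩ := hns ![0, 1, 0] (fun h => by simpa using congrFun h 1)
      (by simp [flexForm])
    apply hi
    fin_cases i <;> simp [flexForm, pderiv_X, h]
  -- If `c = 0` the line `z = 0` splits off, and its intersection with the residual conic is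
  -- singular.
  have hc : c ≠ 0 := by
    intro h
    obtain ⟨d, hd⟩ := IsAlgClosed.exists_pow_nat_eq (e₂ ^ 2 - 4 * e₁ * e₃) two_pos
    have hy : e₁ * ((-e₂ + d) / (2 * e₁)) ^ 2 + e₂ * ((-e₂ + d) / (2 * e₁)) + e₃ = 0 := by
      field_simp
      linear_combination hd
    obtain ⟨i, hi⟩ := hns ![1, (-e₂ + d) / (2 * e₁), 0] (fun h => by simpa using congrFun h 0)
      (by simp [flexForm, h])
    apply hi
    fin_cases i
    · simp [flexForm, pderiv_X, h]
    · simp [flexForm, pderiv_X]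
    · simpa [flexForm, pderiv_X] using hy
  obtain ⟨g, hg⟩ := IsAlgClosed.exists_pow_nat_eq c three_pos
  obtain ⟨d, hd⟩ := IsAlgClosed.exists_pow_nat_eq (-e₁) two_pos
  have hg0 : g ≠ 0 := by rintro rfl; apply hc; rw [← hg]; norm_num
  have hd0 : d ≠ 0 := by rintro rfl; apply he; linear_combination hd
  obtain ⟨p, hp⟩ : ∃ p, 2 * e₁ * p = e₂ := ⟨e₂ / (2 * e₁), by field_simp⟩
  obtain ⟨q, hq⟩ : ∃ q, 2 * e₁ * q = e₄ := ⟨e₄ / (2 * e₁), by field_simp⟩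
  obtain ⟨s, hs⟩ : ∃ s, 3 * c * s = e₃ - e₁ * p ^ 2 := ⟨(e₃ - e₁ * p ^ 2) / (3 * c), by field_simp⟩
  obtain ⟨a, ha⟩ : ∃ a, a * g = e₅ - 2 * e₁ * p * q - 3 * c * s ^ 2 :=
    ⟨_, div_mul_cancel₀ _ hg0⟩
  refine ⟨a, e₆ - e₁ * q ^ 2 - c * s ^ 3 - a * g * s, LinEquivalent.of_det
    (Matrix.of ![![g, 0, g * s], ![d * p, d, d * q], ![0, 0, 1]]) ?_ ?_⟩
  · have : (Matrix.of ![![g, 0, g * s], ![d * p, d, d * q], ![0, 0, 1]]).det = g * d := by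
      simp [Matrix.det_fin_three]
    rw [this]
    exact mul_ne_zero hg0 hd0
  · intro v
    simp [flexForm, weierstrassForm, dotProduct, Fin.sum_univ_three]
    linear_combination (-(v 0 + s * v 2) ^ 3) * hg + (v 1 + p * v 0 + q * v 2) ^ 2 * v 2 * hd -
      (v 0 * v 2 ^ 2) * ha - (v 0 ^ 2 * v 2) * hs - v 0 * v 1 * v 2 * hp - v 1 * v 2 ^ 2 * hq

/-- Coordinates in which a given flex is `(0 : 1 : 0)` with the tangent `z = 0`. -/
theorem exists_flex_frame {g p : Fin 3 → ℂ} (hg : g ≠ 0) (hp : p ≠ 0) (hgp : g ⬝ᵥ p = 0) :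
    ∃ A : Matrix (Fin 3) (Fin 3) ℂ, A.det ≠ 0 ∧ A.mulVec ![0, 1, 0] = p ∧
      g ⬝ᵥ (fun i => A i 0) = 0 := by
  obtain ⟨N, M, hMN, rfl⟩ := exists_matrix_row_zero hg
  have hNM := mul_eq_one_comm.1 hMN
  have hdet : M.det ≠ 0 := by
    intro h
    have := congrArg Matrix.det hMN
    rw [Matrix.det_mul, h, zero_mul, Matrix.det_one] at this
    exact zero_ne_one this
  set q := N.mulVec p with hq
  have hMq : M.mulVec q = p := by rw [hq, Matrix.mulVec_mulVec, hMN, Matrix.one_mulVec]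
  have hq0 : q 0 = 0 := hgp
  -- In the coordinates given by `N` the tangent line is the vanishing of coordinate 0. It remains
  -- to find an invertible `T` with middle column `q` and first column on that line.
  have key : ∀ T : Matrix (Fin 3) (Fin 3) ℂ, T.det ≠ 0 → T.mulVec ![0, 1, 0] = q → T 0 0 = 0 →
      ∃ A : Matrix (Fin 3) (Fin 3) ℂ, A.det ≠ 0 ∧ A.mulVec ![0, 1, 0] = p ∧
      N 0 ⬝ᵥ (fun i => A i 0) = 0 := by
    intro T hT h1 h2
    refine ⟨M * T, by rw [Matrix.det_mul]; exact mul_ne_zero hdet hT, ?_, ?_⟩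
    · rw [← Matrix.mulVec_mulVec, h1, hMq]
    · have : (N * (M * T)) 0 0 = 0 := by rw [← Matrix.mul_assoc, hNM, Matrix.one_mul, h2]
      rwa [Matrix.mul_apply] at this
  by_cases h1 : q 1 = 0
  · have h2 : q 2 ≠ 0 := by
      intro h2
      apply mulVec_ne_zero hMN hp
      ext i; fin_cases i <;> assumption
    refine key (Matrix.of ![![0, 0, 1], ![1, 0, 0], ![0, q 2, 0]])
      (by simp [Matrix.det_fin_three, h2]) ?_ rfl
    ext i; fin_cases i <;> simp [hq0, h1]
  · refine key (Matrix.of ![![0, 0, 1], ![0, q 1, 0], ![1, q 2, 0]])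
      (by simp [Matrix.det_fin_three, h1]) ?_ rfl
    ext i; fin_cases i <;> simp [hq0]

/-- The Hesse normal form of a smooth cubic. -/
theorem exists_linEquivalent_hesseForm {E : PlaneCurve} (hdeg : E.degree = 3) (hE : E.IsSmooth)
    (hferm : ¬ E.IsFermatCubic) :
    ∃ l : ℂ, l ≠ 0 ∧ l ^ 3 ≠ 1 ∧ l ^ 3 ≠ -8 ∧ LinEquivalent E.form (hesseForm l) := by
  have hF : E.form.IsHomogeneous 3 := by
    have := E.form_isHomogeneous
    rwa [hdeg] at this
  have hns := PlaneCurve.isSmooth_iff.1 hE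
  have hferm' : ¬ LinEquivalent E.form fermatForm := by
    rintro ⟨N, M, h, h1⟩
    exact hferm ⟨⟨N, M, mul_eq_one_comm.1 h, h⟩, by rw [h1]; exact Associated.refl _⟩
  obtain ⟨x, hx⟩ := exists_mem_flexes hdeg hE
  have hgx : E.grad x ⬝ᵥ x.rep = 0 := by
    have := euler_grad hF x.rep
    rw [PlaneCurve.mem_points.1 hx.1, mul_zero] at this
    rw [← this, dotProduct]
    exact Finset.sum_congr rfl fun i _ => mul_comm _ _
  obtain ⟨A, hA, hAx, hAg⟩ := exists_flex_frame hx.2.1 x.rep_nonzero hgx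
  have h1 := ((X_pow_three_dvd_iff _ _ _).1 (hx.2.2 _ hAg)).2.2
  have heq : LinEquivalent E.form (linSubst A E.form) :=
    LinEquivalent.symm ⟨A, A⁻¹, Matrix.nonsing_inv_mul A hA.isUnit, rfl⟩
  obtain ⟨c, e₁, e₂, e₃, e₄, e₅, e₆, hflex⟩ := exists_eq_flexForm (F := linSubst A E.form)
    (linSubst_isHomogeneous A hF)
    (by rw [eval_linSubst, hAx]; exact hx.1)
    (by
      have := congrFun (eval_pderiv_linSubst A E.form ![0, 1, 0]) 0
      rw [hAx] at this
      rw [this, Matrix.mulVec, dotProduct_comm]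
      exact hAg)
    (by
      have := congrFun (congrFun (hessian_linSubst A E.form ![0, 1, 0]) 0) 0
      rw [hAx] at this
      refine Eq.trans this (Eq.trans ?_ h1)
      simp only [Matrix.mul_apply, Matrix.transpose_apply, dotProduct, Matrix.mulVec,
        Fin.sum_univ_three]
      ring)
  rw [hflex] at heq
  obtain ⟨a, b, hab⟩ := flexForm_linEquivalent (heq.isNonsingularForm hns)
  have heq := heq.trans hab
  -- A Weierstrass form with `a = 0` is a Fermat cubic, which is excluded.
  have ha : a ≠ 0 := by
    rintro rfl
    exact hferm' (heq.trans (weierstrassForm_zero_linEquivalent (heq.isNonsingularForm hns)))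
  obtain ⟨k, hk, hk'⟩ := weierstrassForm_linEquivalent ha (heq.isNonsingularForm hns)
  have heq := heq.trans hk'
  obtain ⟨l, hl0, hl1, hl⟩ := trilateralForm_linEquivalent hk (heq.isNonsingularForm hns)
  exact ⟨l, hl0, hl1, fun h8 =>
    hferm' ((heq.trans hl).trans (hesseForm_linEquivalent_fermatForm h8)), heq.trans hl⟩

/-! ### Powers of a primitive cube root of unity -/

/-- The powers of a primitive cube root of unity. -/
def rootPow (w : ℂ) (k : ZMod 3) : ℂ := w ^ k.val

section RootPow

variable {w : ℂ} (hw : w ^ 2 + w + 1 = 0)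
include hw

theorem rootPow_add (k l : ZMod 3) : rootPow w (k + l) = rootPow w k * rootPow w l := by
  rw [rootPow, rootPow, rootPow, ZMod.val_add, ← pow_eq_pow_mod _ (pow_three_eq_one hw), pow_add]

theorem rootPow_pow_three (k : ZMod 3) : rootPow w k ^ 3 = 1 := by
  rw [rootPow, ← pow_mul, mul_comm, pow_mul, pow_three_eq_one hw, one_pow]

theorem rootPow_ne_zero (k : ZMod 3) : rootPow w k ≠ 0 := fun h => by
  have := rootPow_pow_three hw k
  rw [h] at this
  norm_num at this

theorem rootPow_eq_one_iff (k : ZMod 3) : rootPow w k = 1 ↔ k = 0 := by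
  have h1 := self_sub_sq_ne_zero hw
  have hk : k = 0 ∨ k = 1 ∨ k = 2 := by revert k; decide
  rcases hk with rfl | rfl | rfl
  · simp [rootPow]
  · have : (1 : ZMod 3).val = 1 := rfl
    simp only [rootPow, this, pow_one]
    refine ⟨fun h => absurd ?_ h1, fun h => absurd h (by decide)⟩
    rw [h]; norm_num
  · have : (2 : ZMod 3).val = 2 := rfl
    simp only [rootPow, this]
    refine ⟨fun h => absurd ?_ h1, fun h => absurd h (by decide)⟩
    linear_combination (w - w ^ 2) / 3 * (h - (w - 2) * (hw - h))

theorem rootPow_eq_iff (k l : ZMod 3) : rootPow w k = rootPow w l ↔ k = l := by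
  have h := rootPow_add hw l (k - l)
  rw [add_sub_cancel] at h
  rw [h, mul_eq_left₀ (rootPow_ne_zero hw l), rootPow_eq_one_iff hw, sub_eq_zero]

theorem exists_eq_rootPow {u : ℂ} (hu : u ^ 3 = 1) : ∃ k, u = rootPow w k := by
  have h : (u - 1) * ((u - w) * (u - w ^ 2)) = 0 := by
    linear_combination hu + (-u ^ 2 + u + (u - 1) * (w - 1)) * hw
  rcases mul_eq_zero.1 h with h | h
  · exact ⟨0, by simpa [rootPow] using sub_eq_zero.1 h⟩
  rcases mul_eq_zero.1 h with h | h
  · exact ⟨1, by have : (1 : ZMod 3).val = 1 := rfl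
                 simpa [rootPow, this] using sub_eq_zero.1 h⟩
  · exact ⟨2, by have : (2 : ZMod 3).val = 2 := rfl
                 simpa [rootPow, this] using sub_eq_zero.1 h⟩

end RootPow

theorem sq_add_self_add_one_of_pow_three {u : ℂ} (hu : u ^ 3 = 1) (h : u ≠ 1) :
    u ^ 2 + u + 1 = 0 := by
  refine (mul_eq_zero.1 (?_ : (u - 1) * (u ^ 2 + u + 1) = 0)).resolve_left (sub_ne_zero.2 h)
  linear_combination hu

/-! ### Explicit flexes, tangents, nodes and conics of the Hesse pencil -/

/-- The flexes of the cubics of the Hesse pencil. -/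
def hesseFlex (w : ℂ) (a : AffPoint) : Fin 3 → ℂ :=
  (![![0, 1, -rootPow w a.2], ![-rootPow w a.2, 0, 1], ![1, -rootPow w a.2, 0]] :
    Fin 3 → Fin 3 → ℂ) a.1

/-- The inflectional tangents of a cubic of the Hesse pencil. -/
def hesseCusp (w l : ℂ) (a : AffPoint) : Fin 3 → ℂ :=
  (![![l * rootPow w a.2, 1, rootPow w a.2 ^ 2], ![rootPow w a.2 ^ 2, l * rootPow w a.2, 1],
    ![1, rootPow w a.2 ^ 2, l * rootPow w a.2]] : Fin 3 → Fin 3 → ℂ) a.1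

/-- The lines through three flexes. -/
def hesseNode (w : ℂ) (m : AffLine) : Fin 3 → ℂ :=
  m.1.elim ((![![1, 0, 0], ![0, 1, 0], ![0, 0, 1]] : Fin 3 → Fin 3 → ℂ) m.2)
    fun s => ![1, rootPow w s * rootPow w m.2 ^ 2, rootPow w s * rootPow w m.2]

/-- Coordinates in which the conics of the Hesse arrangement are standard. -/
noncomputable def hesseFrame (w l : ℂ) (m : AffLine) : Matrix (Fin 3) (Fin 3) ℂ :=
  m.1.elim
    ((![Matrix.of ![![1, 0, 0], ![0, 1, 0], ![0, 0, l⁻¹]],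
      Matrix.of ![![0, 1, 0], ![0, 0, 1], ![l⁻¹, 0, 0]],
      Matrix.of ![![0, 0, 1], ![1, 0, 0], ![0, l⁻¹, 0]]] :
      Fin 3 → Matrix (Fin 3) (Fin 3) ℂ) m.2)
    fun s =>
      let α := rootPow w s ^ 2 * rootPow w m.2
      let β := (rootPow w s * rootPow w m.2) ^ 2
      let σ := (l * rootPow w s - 1) / (l * rootPow w s + 2)
      Matrix.of ![![1, α, β], ![1, w * α, w ^ 2 * β], ![σ, σ * w ^ 2 * α, σ * w * β]]

theorem hesseFlex_zero (w : ℂ) (k : ZMod 3) : hesseFlex w (0, k) = ![0, 1, -rootPow w k] := rfl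

theorem hesseFlex_one (w : ℂ) (k : ZMod 3) : hesseFlex w (1, k) = ![-rootPow w k, 0, 1] := rfl

theorem hesseFlex_two (w : ℂ) (k : ZMod 3) : hesseFlex w (2, k) = ![1, -rootPow w k, 0] := rfl

theorem hesseCusp_zero (w l : ℂ) (k : ZMod 3) :
    hesseCusp w l (0, k) = ![l * rootPow w k, 1, rootPow w k ^ 2] := rfl

theorem hesseCusp_one (w l : ℂ) (k : ZMod 3) :
    hesseCusp w l (1, k) = ![rootPow w k ^ 2, l * rootPow w k, 1] := rfl

theorem hesseCusp_two (w l : ℂ) (k : ZMod 3) :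
    hesseCusp w l (2, k) = ![1, rootPow w k ^ 2, l * rootPow w k] := rfl

theorem hesseNode_none_zero (w : ℂ) : hesseNode w (none, 0) = ![1, 0, 0] := rfl

theorem hesseNode_none_one (w : ℂ) : hesseNode w (none, 1) = ![0, 1, 0] := rfl

theorem hesseNode_none_two (w : ℂ) : hesseNode w (none, 2) = ![0, 0, 1] := rfl

theorem hesseNode_some (w : ℂ) (s t : ZMod 3) : hesseNode w (some s, t) =
    ![1, rootPow w s * rootPow w t ^ 2, rootPow w s * rootPow w t] := rfl

theorem hesseFrame_none_zero (w l : ℂ) :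
    hesseFrame w l (none, 0) = Matrix.of ![![1, 0, 0], ![0, 1, 0], ![0, 0, l⁻¹]] := rfl

theorem hesseFrame_none_one (w l : ℂ) :
    hesseFrame w l (none, 1) = Matrix.of ![![0, 1, 0], ![0, 0, 1], ![l⁻¹, 0, 0]] := rfl

theorem hesseFrame_none_two (w l : ℂ) :
    hesseFrame w l (none, 2) = Matrix.of ![![0, 0, 1], ![1, 0, 0], ![0, l⁻¹, 0]] := rfl

/-- The symmetric quadratic form `x ^ 2 + y ^ 2 + z ^ 2 + (m + 1) (x y + y z + z x)`. -/
def symQuad (m x y z : ℂ) : ℂ :=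
  x ^ 2 + y ^ 2 + z ^ 2 + (m + 1) * (x * y + y * z + z * x)

theorem symQuad_rotate (m x y z : ℂ) : symQuad m x y z = symQuad m y z x := by
  simp only [symQuad]; ring

theorem symQuad_mul (m c x y z : ℂ) :
    symQuad m (c * x) (c * y) (c * z) = c ^ 2 * symQuad m x y z := by
  simp only [symQuad]; ring

theorem symQuad_eq_zero_iff {m c x y z x' y' z' : ℂ} (hc : c ≠ 0) (hx : x = c * x')
    (hy : y = c * y') (hz : z = c * z') : symQuad m x y z = 0 ↔ symQuad m x' y' z' = 0 := by
  rw [hx, hy, hz, symQuad_mul, mul_eq_zero, or_iff_right (pow_ne_zero 2 hc)]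

/-- At `e = 1` the value is `3 (m² + m + 1)`, nonzero since `m³ ≠ 1`. For a primitive cube root `e`
everything cancels by `e² + e + 1 = 0`. -/
theorem symQuad_cusp {m e : ℂ} (hm : m ^ 3 ≠ 1) (he : e ^ 3 = 1) :
    symQuad m (m * e) 1 (e ^ 2) = 0 ↔ e ≠ 1 := by
  constructor
  · rintro h rfl
    apply hm
    simp only [symQuad] at h
    linear_combination (m - 1) / 3 * h
  · intro h
    have := sq_add_self_add_one_of_pow_three he h
    simp only [symQuad]
    linear_combination (m * (m + 1) + (e ^ 2 - e + 1)) * this + m * (m + 1) * he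

/-- At `d = e = 1` the value is `3 (m + 2)`, excluded by `m³ ≠ -8`. For `d ≠ 1` a zero would make
`m` a cube root of unity. For `d = 1` and `e` primitive the value is zero. -/
theorem symQuad_node {m d e : ℂ} (hm : m ^ 3 ≠ 1) (hm8 : m ^ 3 ≠ -8) (hd : d ^ 3 = 1)
    (he : e ^ 3 = 1) : symQuad m 1 (d * e ^ 2) (d * e) = 0 ↔ d = 1 ∧ e ≠ 1 := by
  constructor
  · intro h
    by_cases hd1 : d = 1
    · refine ⟨hd1, ?_⟩
      rintro rfl
      apply hm8
      simp only [symQuad, hd1] at h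
      have : m = -2 := by linear_combination h / 3
      rw [this]; norm_num
    · exfalso
      apply hm
      have hd2 := sq_add_self_add_one_of_pow_three hd hd1
      simp only [symQuad] at h
      by_cases he1 : e = 1
      · have h1 : (d - 1) * (m - d ^ 2) = 0 := by
          rw [he1] at h
          linear_combination h - (m + 2) * hd2 - hd
        have h2 : m = d ^ 2 := by
          simpa [sub_eq_zero, hd1] using h1
        rw [h2, ← pow_mul, mul_comm, pow_mul, hd, one_pow]
      · have he2 := sq_add_self_add_one_of_pow_three he he1
        have h1 : (d - 1) * (d * m - 1) = 0 := by
          linear_combination h - d ^ 2 * e * he - d ^ 2 * he2 - (m + 1) * d * he2 -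
            (m + 1) * d ^ 2 * he
        have h2 : d * m = 1 := by
          simpa [sub_eq_zero, hd1] using h1
        have h3 := congrArg (· ^ 3) h2
        simp only [mul_pow, hd, one_mul, one_pow] at h3
        exact h3
  · rintro ⟨rfl, he1⟩
    have he2 := sq_add_self_add_one_of_pow_three he he1
    simp only [symQuad]
    linear_combination (m + 1 + e) * he + (m + 2) * he2

section HesseData

variable {w l : ℂ}

theorem zmod_three_cases (i : ZMod 3) : i = 0 ∨ i = 1 ∨ i = 2 := by revert i; decide

theorem mul_ne_of_pow_three {u v : ℂ} (hl1 : l ^ 3 ≠ 1) (hu : u ^ 3 = 1) (hv : v ^ 3 = 1) :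
    l * v ≠ u := fun h => hl1 <| by
  have := congrArg (· ^ 3) h
  simp only [mul_pow, hu, hv, mul_one] at this
  exact this

theorem mul_sq_eq_one_iff {u v : ℂ} (hv : v ^ 3 = 1) : u * v ^ 2 = 1 ↔ u = v := by
  constructor
  · intro h; linear_combination v * h - u * hv
  · rintro rfl; linear_combination hv

theorem hesseFlex_dot_hesseCusp (hw : w ^ 2 + w + 1 = 0) (hl1 : l ^ 3 ≠ 1) (a b : AffPoint) :
    hesseFlex w a ⬝ᵥ hesseCusp w l b = 0 ↔ a = b := by
  obtain ⟨i, k⟩ := a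
  obtain ⟨j, m⟩ := b
  have hu := rootPow_pow_three hw k
  have hv := rootPow_pow_three hw m
  have hv0 := rootPow_ne_zero hw m
  have h1 := mul_sq_eq_one_iff (u := rootPow w k) hv
  rw [rootPow_eq_iff hw] at h1
  have h2 := mul_ne_of_pow_three hl1 hu hv
  have h3 := mul_ne_of_pow_three hl1 hv hu
  have h01 : (0 : ZMod 3) ≠ 1 := by decide
  have h02 : (0 : ZMod 3) ≠ 2 := by decide
  have h12 : (1 : ZMod 3) ≠ 2 := by decide
  rcases zmod_three_cases i with rfl | rfl | rfl <;>
  rcases zmod_three_cases j with rfl | rfl | rfl <;>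
  simp only [hesseFlex_zero, hesseFlex_one, hesseFlex_two, hesseCusp_zero, hesseCusp_one,
    hesseCusp_two, Prod.mk.injEq, h01, h02, h12, h01.symm, h02.symm, h12.symm, true_and, false_and,
    iff_false, ← h1] <;>
  generalize rootPow w k = u at * <;>
  generalize rootPow w m = v at * <;>
  simp only [dotProduct, Fin.sum_univ_three, Matrix.cons_val]
  · exact ⟨fun h => by linear_combination -h, fun h => by linear_combination -h⟩
  · exact fun h => h2 (by linear_combination h)
  · exact fun h => h3 (mul_right_cancel₀ hv0 (by linear_combination -h))
  · exact fun h => h3 (mul_right_cancel₀ hv0 (by linear_combination -h))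
  · exact ⟨fun h => by linear_combination -h, fun h => by linear_combination -h⟩
  · exact fun h => h2 (by linear_combination h)
  · exact fun h => h2 (by linear_combination h)
  · exact fun h => h3 (mul_right_cancel₀ hv0 (by linear_combination -h))
  · exact ⟨fun h => by linear_combination -h, fun h => by linear_combination -h⟩

theorem hesseFlex_dot_hesseNode (hw : w ^ 2 + w + 1 = 0) (a : AffPoint) (m : AffLine) :
    hesseFlex w a ⬝ᵥ hesseNode w m = 0 ↔ Inc a m := by
  obtain ⟨i, k⟩ := a
  have hu := rootPow_ne_zero hw k
  have h01 : (0 : ZMod 3) ≠ 1 := by decide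
  have h02 : (0 : ZMod 3) ≠ 2 := by decide
  have h12 : (1 : ZMod 3) ≠ 2 := by decide
  rcases m with ⟨_ | s, t⟩
  · rcases zmod_three_cases i with rfl | rfl | rfl <;>
    rcases zmod_three_cases t with rfl | rfl | rfl <;>
    simp only [hesseFlex_zero, hesseFlex_one, hesseFlex_two, hesseNode_none_zero,
      hesseNode_none_one, hesseNode_none_two, Inc, Option.elim, h01, h02, h12, h01.symm, h02.symm,
      h12.symm, iff_false, iff_true] <;>
    simp [dotProduct, Fin.sum_univ_three, hu]
  · have hs := rootPow_pow_three hw s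
    have ht := rootPow_pow_three hw t
    have hs0 := rootPow_ne_zero hw s
    have ht0 := rootPow_ne_zero hw t
    rcases zmod_three_cases i with rfl | rfl | rfl
    · have : Inc (0, k) (some s, t) ↔ k = t := by simp [Inc]
      rw [this, ← rootPow_eq_iff hw, hesseFlex_zero, hesseNode_some]
      simp only [dotProduct, Fin.sum_univ_three, Matrix.cons_val]
      refine ⟨fun h => ?_, fun h => ?_⟩
      · refine mul_right_cancel₀ ht0 (mul_right_cancel₀ hs0 ?_)
        linear_combination -h
      · rw [h]; ring
    · have : Inc (1, k) (some s, t) ↔ k = s + t := by simp [Inc]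
      rw [this, ← rootPow_eq_iff hw, rootPow_add hw, hesseFlex_one, hesseNode_some]
      simp only [dotProduct, Fin.sum_univ_three, Matrix.cons_val]
      exact ⟨fun h => by linear_combination -h, fun h => by rw [h]; ring⟩
    · have : Inc (2, k) (some s, t) ↔ k = s + s + t := by simp [Inc, mul_two]
      rw [this, ← rootPow_eq_iff hw, rootPow_add hw, rootPow_add hw, hesseFlex_two, hesseNode_some]
      simp only [dotProduct, Fin.sum_univ_three, Matrix.cons_val]
      generalize rootPow w k = u at *
      generalize rootPow w s = a at *
      generalize rootPow w t = b at *
      refine ⟨fun h => ?_, fun h => ?_⟩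
      · linear_combination (-a ^ 2 * b) * h - u * b ^ 3 * hs - u * ht
      · rw [h]; linear_combination -b ^ 3 * hs - ht

theorem eval_linSubst_stdConic (N : Matrix (Fin 3) (Fin 3) ℂ) (v : Fin 3 → ℂ) :
    eval v (linSubst N stdConic) =
      N.mulVec v 1 * N.mulVec v 2 - N.mulVec v 0 ^ 2 := by
  rw [eval_linSubst]
  simp [stdConic]

theorem eval_hesseFrame_none_zero (hl : l ≠ 0) (v : Fin 3 → ℂ) :
    eval v (linSubst (hesseFrame w l (none, 0)) stdConic) = 0 ↔ v 1 * v 2 = l * v 0 ^ 2 := by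
  rw [eval_linSubst_stdConic, hesseFrame_none_zero]
  simp only [Matrix.mulVec, dotProduct, Fin.sum_univ_three, Matrix.of_apply, Matrix.cons_val]
  field_simp
  constructor <;> intro h <;> linear_combination h

theorem eval_hesseFrame_none_one (hl : l ≠ 0) (v : Fin 3 → ℂ) :
    eval v (linSubst (hesseFrame w l (none, 1)) stdConic) = 0 ↔ v 2 * v 0 = l * v 1 ^ 2 := by
  rw [eval_linSubst_stdConic, hesseFrame_none_one]
  simp only [Matrix.mulVec, dotProduct, Fin.sum_univ_three, Matrix.of_apply, Matrix.cons_val]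
  field_simp
  constructor <;> intro h <;> linear_combination h

theorem eval_hesseFrame_none_two (hl : l ≠ 0) (v : Fin 3 → ℂ) :
    eval v (linSubst (hesseFrame w l (none, 2)) stdConic) = 0 ↔ v 0 * v 1 = l * v 2 ^ 2 := by
  rw [eval_linSubst_stdConic, hesseFrame_none_two]
  simp only [Matrix.mulVec, dotProduct, Fin.sum_univ_three, Matrix.of_apply, Matrix.cons_val]
  field_simp
  constructor <;> intro h <;> linear_combination h

theorem mul_rootPow_pow_three (hw : w ^ 2 + w + 1 = 0) (l : ℂ) (s : ZMod 3) :
    (l * rootPow w s) ^ 3 = l ^ 3 := by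
  rw [mul_pow, rootPow_pow_three hw, mul_one]

theorem mul_rootPow_add_two_ne_zero (hw : w ^ 2 + w + 1 = 0) (hl8 : l ^ 3 ≠ -8) (s : ZMod 3) :
    l * rootPow w s + 2 ≠ 0 := fun h => hl8 <| by
  rw [← mul_rootPow_pow_three hw l s, eq_neg_of_add_eq_zero_left h]; norm_num

/-- The frame gives `σ S₁ S₂ - S₀²` in Fourier coordinates of the rescaled variables. Comparing the
ratio of its mixed and square terms with `m + 1`, where `m = l * rootPow w s`, yields `σ = (m - 1) /
(m + 2)`. -/
theorem eval_hesseFrame_some (hw : w ^ 2 + w + 1 = 0) (hl8 : l ^ 3 ≠ -8) (s t : ZMod 3)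
    (v : Fin 3 → ℂ) :
    eval v (linSubst (hesseFrame w l (some s, t)) stdConic) = 0 ↔
      symQuad (l * rootPow w s) (v 0) (rootPow w s ^ 2 * rootPow w t * v 1)
        ((rootPow w s * rootPow w t) ^ 2 * v 2) = 0 := by
  have hμ := mul_rootPow_add_two_ne_zero hw hl8 s
  have h : eval v (linSubst (hesseFrame w l (some s, t)) stdConic) = -3 / (l * rootPow w s + 2) *
      symQuad (l * rootPow w s) (v 0) (rootPow w s ^ 2 * rootPow w t * v 1)
        ((rootPow w s * rootPow w t) ^ 2 * v 2) := by
    rw [eval_linSubst_stdConic, hesseFrame]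
    simp only [Option.elim, Matrix.mulVec, dotProduct, Fin.sum_univ_three, Matrix.of_apply,
      Matrix.cons_val, symQuad]
    generalize rootPow w s ^ 2 * rootPow w t = a at *
    generalize (rootPow w s * rootPow w t) ^ 2 = b at *
    generalize l * rootPow w s = m at *
    field_simp
    linear_combination (m - 1) * ((w - 1) * ((a * v 1) ^ 2 + (b * v 2) ^ 2) +
      v 0 * (a * v 1) + v 0 * (b * v 2) + (w ^ 2 - w + 1) * (a * v 1) * (b * v 2)) * hw
  rw [h, mul_eq_zero, or_iff_right]
  exact div_ne_zero (by norm_num) hμ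

/-- For a non-vertical affine line, a scaling and a cyclic rotation bring every cusp to the vector
of `symQuad_cusp`; the root of unity `e` there is 1 exactly when the point is on the line. -/
theorem hesseConic_hesseCusp (hw : w ^ 2 + w + 1 = 0) (hl : l ≠ 0) (hl1 : l ^ 3 ≠ 1)
    (hl8 : l ^ 3 ≠ -8) (a : AffPoint) (m : AffLine) :
    eval (hesseCusp w l a) (linSubst (hesseFrame w l m) stdConic) = 0 ↔ ¬ Inc a m := by
  obtain ⟨i, k⟩ := a
  have hu := rootPow_pow_three hw k
  have hu0 := rootPow_ne_zero hw k
  have h01 : (0 : ZMod 3) ≠ 1 := by decide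
  have h02 : (0 : ZMod 3) ≠ 2 := by decide
  have h12 : (1 : ZMod 3) ≠ 2 := by decide
  rcases m with ⟨_ | s, t⟩
  · rcases zmod_three_cases i with rfl | rfl | rfl <;>
    rcases zmod_three_cases t with rfl | rfl | rfl <;>
    simp only [eval_hesseFrame_none_zero hl, eval_hesseFrame_none_one hl,
      eval_hesseFrame_none_two hl, hesseCusp_zero, hesseCusp_one, hesseCusp_two, Inc, Option.elim,
      h01, h02, h12, h01.symm, h02.symm, h12.symm, not_true_eq_false, not_false_eq_true,
      iff_false, iff_true] <;>
    simp only [Matrix.cons_val] <;>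
    generalize rootPow w k = u at *
    · exact fun h => hl1 (mul_right_cancel₀ (pow_ne_zero 2 hu0) (by linear_combination -h))
    · linear_combination l * hu
    · linear_combination (-l * u) * hu
    · linear_combination (-l * u) * hu
    · exact fun h => hl1 (mul_right_cancel₀ (pow_ne_zero 2 hu0) (by linear_combination -h))
    · linear_combination l * hu
    · linear_combination l * hu
    · linear_combination (-l * u) * hu
    · exact fun h => hl1 (mul_right_cancel₀ (pow_ne_zero 2 hu0) (by linear_combination -h))
  · have hs := rootPow_pow_three hw s
    have ht := rootPow_pow_three hw t
    have hs0 := rootPow_ne_zero hw s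
    have ht0 := rootPow_ne_zero hw t
    have hm := mul_rootPow_pow_three hw l s
    rw [eval_hesseFrame_some hw hl8]
    have hc {u v : ℂ} (hu : u ^ 3 = 1) (hv : v ^ 3 = 1) : (u * v ^ 2) ^ 3 = 1 := by
      linear_combination v ^ 6 * hu + (v ^ 3 + 1) * hv
    have hst : (rootPow w s * rootPow w t) ^ 3 = 1 := by rw [mul_pow, hs, ht, one_mul]
    have hsst : (rootPow w s * rootPow w s * rootPow w t) ^ 3 = 1 := by
      rw [mul_pow, mul_pow, hs, ht, one_mul, one_mul]
    rcases zmod_three_cases i with rfl | rfl | rfl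
    · have : Inc (0, k) (some s, t) ↔ k = t := by simp [Inc]
      rw [this, ← rootPow_eq_iff hw, hesseCusp_zero, ← mul_sq_eq_one_iff ht, ← ne_eq,
        ← symQuad_cusp (hm.trans_ne hl1) (hc hu ht)]
      simp only [Matrix.cons_val]
      generalize rootPow w k = u at *
      generalize rootPow w s = a at *
      generalize rootPow w t = b at *
      refine symQuad_eq_zero_iff (mul_ne_zero (pow_ne_zero 2 hs0) ht0) ?_ rfl ?_
      · linear_combination (-l * u * b ^ 3) * hs - l * u * ht
      · linear_combination (-a ^ 2 * b ^ 2 * u ^ 2) * ht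
    · have : Inc (1, k) (some s, t) ↔ k = s + t := by simp [Inc]
      rw [this, ← rootPow_eq_iff hw, rootPow_add hw, hesseCusp_one, ← mul_sq_eq_one_iff hst, ← ne_eq,
        ← symQuad_cusp (hm.trans_ne hl1) (hc hu hst), symQuad_rotate]
      simp only [Matrix.cons_val]
      generalize rootPow w k = u at *
      generalize rootPow w s = a at *
      generalize rootPow w t = b at *
      refine symQuad_eq_zero_iff (pow_ne_zero 2 (mul_ne_zero hs0 ht0)) ?_ rfl ?_
      · linear_combination (-l * u * a ^ 2 * b) * hst
      · linear_combination (-u ^ 2 * ((a * b) ^ 3 + 1)) * hst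
    · have : Inc (2, k) (some s, t) ↔ k = s + s + t := by simp [Inc, mul_two]
      rw [this, ← rootPow_eq_iff hw, rootPow_add hw, rootPow_add hw, hesseCusp_two,
        ← mul_sq_eq_one_iff hsst, ← ne_eq, ← symQuad_cusp (hm.trans_ne hl1) (hc hu hsst),
        symQuad_rotate _ (_ * (_ * _))]
      simp only [Matrix.cons_val]
      generalize rootPow w k = u at *
      generalize rootPow w s = a at *
      generalize rootPow w t = b at *
      refine symQuad_eq_zero_iff one_ne_zero (by ring) ?_ ?_
      · linear_combination (-u ^ 2 * a ^ 2 * b) * hsst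
      · linear_combination (-l * u * a ^ 2 * b ^ 2) * hs

/-- For two non-vertical affine lines, the quotients `d` of the slope roots and `e` of the intercept
roots reduce the claim to `symQuad_node`. If one line is vertical, an incidence could only come from
`l` being a ratio of cube roots of unity, or from a coordinate point on the conic. -/
theorem hesseConic_hesseNode (hw : w ^ 2 + w + 1 = 0) (hl : l ≠ 0) (hl1 : l ^ 3 ≠ 1)
    (hl8 : l ^ 3 ≠ -8) (m m' : AffLine) :
    eval (hesseNode w m) (linSubst (hesseFrame w l m') stdConic) = 0 ↔ m.1 = m'.1 ∧ m ≠ m' := by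
  have h01 : (0 : ZMod 3) ≠ 1 := by decide
  have h02 : (0 : ZMod 3) ≠ 2 := by decide
  have h12 : (1 : ZMod 3) ≠ 2 := by decide
  rcases m with ⟨_ | s, t⟩ <;> rcases m' with ⟨_ | s', t'⟩
  · rcases zmod_three_cases t with rfl | rfl | rfl <;>
    rcases zmod_three_cases t' with rfl | rfl | rfl <;>
    simp only [eval_hesseFrame_none_zero hl, eval_hesseFrame_none_one hl,
      eval_hesseFrame_none_two hl, hesseNode_none_zero, hesseNode_none_one, hesseNode_none_two,
      ne_eq, Prod.mk.injEq, h01, h02, h12, h01.symm, h02.symm, h12.symm, not_true_eq_false,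
      not_false_eq_true, true_and, and_self, iff_false, iff_true] <;>
    simp [hl.symm]
  · have hs0 := rootPow_ne_zero hw s'
    have ht0 := rootPow_ne_zero hw t'
    rw [eval_hesseFrame_some hw hl8]
    rcases zmod_three_cases t with rfl | rfl | rfl <;>
    simp [hesseNode_none_zero, hesseNode_none_one, hesseNode_none_two, symQuad, hs0, ht0]
  · have hs := rootPow_pow_three hw s
    have ht := rootPow_pow_three hw t
    rw [hesseNode_some]
    have hc (i j : ℕ) : (rootPow w s ^ i * rootPow w t ^ j) ^ 3 = 1 := by
      rw [mul_pow, ← pow_mul, ← pow_mul, mul_comm i, mul_comm j, pow_mul, pow_mul, hs, ht, one_pow,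
        one_pow, one_mul]
    rcases zmod_three_cases t' with rfl | rfl | rfl <;>
    simp only [eval_hesseFrame_none_zero hl, eval_hesseFrame_none_one hl,
      eval_hesseFrame_none_two hl, reduceCtorEq, false_and, iff_false, Matrix.cons_val]
    · exact fun h => mul_ne_of_pow_three hl1 (hc 2 3) (one_pow 3) (by linear_combination -h)
    · exact fun h => mul_ne_of_pow_three hl1 (hc 1 1) (hc 2 4) (by linear_combination -h)
    · exact fun h => mul_ne_of_pow_three hl1 (hc 1 2) (hc 2 2) (by linear_combination -h)
  · have hs := rootPow_pow_three hw s
    have ht := rootPow_pow_three hw t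
    have hs' := rootPow_pow_three hw s'
    have ht' := rootPow_pow_three hw t'
    have hm := mul_rootPow_pow_three hw l s'
    have hc {u v : ℂ} (hu : u ^ 3 = 1) (hv : v ^ 3 = 1) : (u * v ^ 2) ^ 3 = 1 := by
      linear_combination v ^ 6 * hu + (v ^ 3 + 1) * hv
    have h1 : ((some s, t).1 = (some s', t').1 ∧ (some s, t) ≠ (some s', t')) ↔
        rootPow w s * rootPow w s' ^ 2 = 1 ∧ rootPow w t * rootPow w t' ^ 2 ≠ 1 := by
      rw [ne_eq (_ * _), mul_sq_eq_one_iff hs', mul_sq_eq_one_iff ht', rootPow_eq_iff hw,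
        rootPow_eq_iff hw]
      simp only [Option.some.injEq, ne_eq, Prod.mk.injEq]
      tauto
    rw [h1, eval_hesseFrame_some hw hl8, hesseNode_some,
      ← symQuad_node (hm.trans_ne hl1) (hm.trans_ne hl8) (hc hs hs') (hc ht ht')]
    simp only [Matrix.cons_val]
    generalize rootPow w s = a at *
    generalize rootPow w t = b at *
    generalize rootPow w s' = a' at *
    generalize rootPow w t' = b' at *
    refine symQuad_eq_zero_iff one_ne_zero (by ring) ?_ ?_
    · linear_combination (-a' ^ 2 * b' * a * b ^ 2) * ht'
    · ring

theorem isUnit_det_hesseFrame (hw : w ^ 2 + w + 1 = 0) (hl : l ≠ 0) (hl1 : l ^ 3 ≠ 1)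
    (hl8 : l ^ 3 ≠ -8) (m : AffLine) : IsUnit (hesseFrame w l m).det := by
  rw [isUnit_iff_ne_zero]
  rcases m with ⟨_ | s, t⟩
  · rcases zmod_three_cases t with rfl | rfl | rfl <;>
    simp [hesseFrame_none_zero, hesseFrame_none_one, hesseFrame_none_two, Matrix.det_fin_three, hl]
  · have hs0 := rootPow_ne_zero hw s
    have ht0 := rootPow_ne_zero hw t
    have hμ := mul_rootPow_add_two_ne_zero hw hl8 s
    have hμ1 : l * rootPow w s - 1 ≠ 0 := fun h => hl1 <| by
      rw [← mul_rootPow_pow_three hw l s, sub_eq_zero.1 h, one_pow]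
    have h : (hesseFrame w l (some s, t)).det =
        (l * rootPow w s - 1) / (l * rootPow w s + 2) * (rootPow w s ^ 2 * rootPow w t) *
          (rootPow w s * rootPow w t) ^ 2 * (-3) * (w - w ^ 2) := by
      rw [Matrix.det_fin_three, hesseFrame]
      simp only [Option.elim, Matrix.of_apply, Matrix.cons_val]
      generalize (l * rootPow w s - 1) / (l * rootPow w s + 2) = c
      generalize rootPow w s ^ 2 * rootPow w t = a at *
      generalize (rootPow w s * rootPow w t) ^ 2 = b at *
      linear_combination -c * a * b * w * (w - 1) * hw
    rw [h]
    refine mul_ne_zero (mul_ne_zero (mul_ne_zero (mul_ne_zero (div_ne_zero hμ1 hμ) ?_) ?_)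
      (by norm_num)) (self_sub_sq_ne_zero hw)
    · exact mul_ne_zero (pow_ne_zero 2 hs0) ht0
    · exact pow_ne_zero 2 (mul_ne_zero hs0 ht0)

end HesseData

/-! ### Flexes of the cubics of the Hesse pencil -/

theorem hesseForm_isHomogeneous (l : ℂ) : (hesseForm l).IsHomogeneous 3 :=
  (((isHomogeneous_X_pow _ _).add (isHomogeneous_X_pow _ _)).add (isHomogeneous_X_pow _ _)).sub
    (((isHomogeneous_C_mul_X _ _).mul (isHomogeneous_X _ _)).mul (isHomogeneous_X _ _))

theorem eval_hesseForm (l : ℂ) (v : Fin 3 → ℂ) :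
    eval v (hesseForm l) = v 0 ^ 3 + v 1 ^ 3 + v 2 ^ 3 - 3 * l * v 0 * v 1 * v 2 := by
  simp [hesseForm]

theorem eval_pderiv_hesseForm (l : ℂ) (v : Fin 3 → ℂ) :
    (fun i => eval v (pderiv i (hesseForm l))) = 3 • ![v 0 ^ 2 - l * v 1 * v 2,
      v 1 ^ 2 - l * v 2 * v 0, v 2 ^ 2 - l * v 0 * v 1] := by
  ext i
  fin_cases i <;> simp [hesseForm, pderiv_X] <;> ring

/-- The Hessian lies in the same pencil, so on the cubic it reduces to a multiple of `x y z`,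
nonzero for `l³ ≠ 1`. The flexes are therefore the points on the coordinate triangle. -/
theorem hessian_hesseForm_det (l : ℂ) (v : Fin 3 → ℂ) : (hessian (hesseForm l) v).det =
    216 * (1 - l ^ 3) * (v 0 * v 1 * v 2) - 54 * l ^ 2 * eval v (hesseForm l) := by
  have h : hessian (hesseForm l) v = Matrix.of ![![6 * v 0, -3 * l * v 2, -3 * l * v 1],
      ![-3 * l * v 2, 6 * v 1, -3 * l * v 0], ![-3 * l * v 1, -3 * l * v 0, 6 * v 2]] := by
    have h3 (i : Fin 3) : pderiv i (3 : MvPolynomial (Fin 3) ℂ) = 0 :=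
      (pderiv (R := ℂ) i).map_natCast 3
    ext i j
    fin_cases i <;> fin_cases j <;>
      simp [hessian, hesseForm, pderiv_X, h3] <;> ring
  rw [h, Matrix.det_fin_three, eval_hesseForm]
  simp only [Matrix.of_apply, Matrix.cons_val]
  ring

theorem exists_eq_smul_hesseFlex_iff {w l : ℂ} (hw : w ^ 2 + w + 1 = 0) {v : Fin 3 → ℂ}
    (hv : v ≠ 0) : (∃ a, ∃ c : ℂ, c ≠ 0 ∧ v = c • hesseFlex w a) ↔
      eval v (hesseForm l) = 0 ∧ v 0 * v 1 * v 2 = 0 := by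
  rw [eval_hesseForm]
  constructor
  · rintro ⟨⟨i, k⟩, c, -, rfl⟩
    have hk := rootPow_pow_three hw k
    rcases zmod_three_cases i with rfl | rfl | rfl <;>
    simp only [hesseFlex_zero, hesseFlex_one, hesseFlex_two, Pi.smul_apply, smul_eq_mul,
      Matrix.cons_val] <;>
    refine ⟨?_, by ring⟩ <;>
    linear_combination (-c ^ 3) * hk
  · rintro ⟨h, h0⟩
    rw [mul_assoc, mul_assoc, ← mul_assoc (v 0), h0, mul_zero, sub_zero] at h
    have key {y z : ℂ} (hyz : y ^ 3 + z ^ 3 = 0) (h : y ≠ 0 ∨ z ≠ 0) :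
        y ≠ 0 ∧ ∃ k, z = y * -rootPow w k := by
      have hy : y ≠ 0 := by
        rintro rfl
        exact h.elim (· rfl) fun h => h (pow_eq_zero_iff three_ne_zero |>.1 (by simpa using hyz))
      obtain ⟨k, hk⟩ := exists_eq_rootPow hw (u := -z / y) (by
        rw [div_pow, div_eq_one_iff_eq (pow_ne_zero 3 hy)]
        linear_combination -hyz)
      exact ⟨hy, k, by rw [← hk]; field_simp⟩
    have hv' : v 0 ≠ 0 ∨ v 1 ≠ 0 ∨ v 2 ≠ 0 := by
      by_contra! hc
      exact hv (funext fun i => by fin_cases i <;> simp [hc])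
    rw [mul_eq_zero, mul_eq_zero] at h0
    rcases h0 with (h0 | h0) | h0
    · obtain ⟨hy, k, hk⟩ := key (y := v 1) (z := v 2) (by rw [h0] at h; linear_combination h)
        (by tauto)
      refine ⟨(0, k), v 1, hy, funext fun i => ?_⟩
      rw [hesseFlex_zero]
      fin_cases i <;> simp [h0, hk]
    · obtain ⟨hy, k, hk⟩ := key (y := v 2) (z := v 0) (by rw [h0] at h; linear_combination h)
        (by tauto)
      refine ⟨(1, k), v 2, hy, funext fun i => ?_⟩
      rw [hesseFlex_one]
      fin_cases i <;> simp [h0, hk]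
    · obtain ⟨hy, k, hk⟩ := key (y := v 0) (z := v 1) (by rw [h0] at h; linear_combination h)
        (by tauto)
      refine ⟨(2, k), v 0, hy, funext fun i => ?_⟩
      rw [hesseFlex_two]
      fin_cases i <;> simp [h0, hk]

theorem eval_pderiv_hesseFlex (w l : ℂ) (a : AffPoint) :
    (fun i => eval (hesseFlex w a) (pderiv i (hesseForm l))) = (3 : ℂ) • hesseCusp w l a := by
  obtain ⟨i, k⟩ := a
  rw [eval_pderiv_hesseForm]
  rcases zmod_three_cases i with rfl | rfl | rfl
  · rw [hesseFlex_zero, hesseCusp_zero]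
    ext i; fin_cases i <;> simp
  · rw [hesseFlex_one, hesseCusp_one]
    ext i; fin_cases i <;> simp
  · rw [hesseFlex_two, hesseCusp_two]
    ext i; fin_cases i <;> simp

theorem mulVec_dotProduct_transpose_mulVec {M N : Matrix (Fin 3) (Fin 3) ℂ} (h : M * N = 1)
    (u v : Fin 3 → ℂ) : M.mulVec u ⬝ᵥ N.transpose.mulVec v = u ⬝ᵥ v := by
  rw [Matrix.mulVec_transpose, dotProduct_comm, ← Matrix.dotProduct_mulVec, Matrix.mulVec_mulVec,
    mul_eq_one_comm.1 h, Matrix.one_mulVec, dotProduct_comm]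

/-! ### Transport to an arbitrary cubic and the main theorem -/

/-- The incidence structure of a smooth cubic that is not projectively equivalent to the Fermat
cubic. -/
theorem nonempty_hesseConfiguration {E : PlaneCurve} (hdeg : E.degree = 3) (hE : E.IsSmooth)
    (hferm : ¬ E.IsFermatCubic) : Nonempty (HesseConfiguration E) := by
  obtain ⟨w, hw⟩ := exists_sq_add_self_add_one
  obtain ⟨l, hl, hl1, hl8, N, M, hMN, hform⟩ := exists_linEquivalent_hesseForm hdeg hE hferm
  have hNM := mul_eq_one_comm.1 hMN
  have hT : N.transpose * M.transpose = 1 := by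
    rw [← Matrix.transpose_mul, hMN, Matrix.transpose_one]
  have hT' := mul_eq_one_comm.1 hT
  -- Points move by `M` and lines, being dual, by the transpose of `N`; hence the conics in the dual
  -- plane are pulled back by the transpose of `M`, and all incidences are preserved.
  have hconic (u : Fin 3 → ℂ) (m : AffLine) :
      eval (N.transpose.mulVec u) (linSubst (hesseFrame w l m * M.transpose) stdConic) =
        eval u (linSubst (hesseFrame w l m) stdConic) := by
    rw [eval_linSubst, eval_linSubst, Matrix.mulVec_mulVec, Matrix.mul_assoc, hT', Matrix.mul_one]
  have hrep (x v : Fin 3 → ℂ) (c : ℂ) : x = c • M.mulVec v ↔ N.mulVec x = c • v := by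
    constructor
    · rintro rfl
      rw [Matrix.mulVec_smul, Matrix.mulVec_mulVec, hNM, Matrix.one_mulVec]
    · intro h
      rw [← Matrix.mulVec_smul, ← h, Matrix.mulVec_mulVec, hMN, Matrix.one_mulVec]
  exact ⟨{
    f := fun a => M.mulVec (hesseFlex w a)
    p := fun a => N.transpose.mulVec (hesseCusp w l a)
    n := fun m => N.transpose.mulVec (hesseNode w m)
    N := fun m => hesseFrame w l m * M.transpose
    M := fun m => N.transpose * (hesseFrame w l m)⁻¹
    mul_eq_one := fun m => by
      rw [Matrix.mul_assoc, ← Matrix.mul_assoc _⁻¹,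
        Matrix.nonsing_inv_mul _ (isUnit_det_hesseFrame hw hl hl1 hl8 m), Matrix.one_mul, hT]
    f_dot_p := fun a b => by
      rw [mulVec_dotProduct_transpose_mulVec hMN, hesseFlex_dot_hesseCusp hw hl1]
    f_dot_n := fun a m => by
      rw [mulVec_dotProduct_transpose_mulVec hMN, hesseFlex_dot_hesseNode hw]
    conic_p := fun a m => by rw [hconic, hesseConic_hesseCusp hw hl hl1 hl8]
    conic_n := fun m m' => by rw [hconic, hesseConic_hesseNode hw hl hl1 hl8]
    mem_flexes := fun x => by
      have hdet : N.det ≠ 0 := fun h => by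
        have := congrArg Matrix.det hMN
        rw [Matrix.det_mul, h, mul_zero, Matrix.det_one] at this
        exact zero_ne_one this
      have h3 : 216 * (1 - l ^ 3) ≠ 0 := mul_ne_zero (by norm_num) (sub_ne_zero.2 hl1.symm)
      simp only [hrep]
      rw [exists_eq_smul_hesseFlex_iff (l := l) hw (mulVec_ne_zero hMN x.rep_nonzero),
        mem_flexes_iff hdeg hE, hform, eval_linSubst, hessian_linSubst, Matrix.det_mul,
        Matrix.det_mul, Matrix.det_transpose, hessian_hesseForm_det]
      refine and_congr_right fun h => ?_
      rw [h, mul_zero, sub_zero, mul_eq_zero, mul_eq_zero, or_iff_left hdet, or_iff_right hdet,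
        mul_eq_zero, or_iff_right h3]
    grad_eq := fun x a c hc hx => by
      rw [hrep] at hx
      -- The gradient of a cubic is quadratic in the point, which gives `c ^ 2`, and at `hesseFlex`
      -- it is three times `hesseCusp`.
      refine ⟨c ^ 2 * 3, mul_ne_zero (pow_ne_zero 2 hc) three_ne_zero, ?_⟩
      have h : E.grad x = N.transpose.mulVec
          (fun i => eval (c • hesseFlex w a) (pderiv i (hesseForm l))) := by
        rw [← hx, ← eval_pderiv_linSubst, ← hform]; rfl
      simp only [eval_smul_pderiv (hesseForm_isHomogeneous l)] at h
      rw [h, ← Matrix.mulVec_smul, mul_smul, ← eval_pderiv_hesseFlex]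
      rfl }⟩

theorem mainTheorem4 (E : PlaneCurve) (hdeg : E.degree = 3) (hsmooth : E.IsSmooth)
    (hE : ¬ E.IsFermatCubic) :
    -- the arrangement of twelve conics
    (hesseConics E).ncard = 12 ∧
    Arrangement.IsDArrangement 2 (hesseConics E) ∧
    -- its singular locus
    (dualCusps E).ncard = 9 ∧
    (∀ p ∈ dualCusps E, Arrangement.mult (hesseConics E) p = 8) ∧
    (Arrangement.nodes (hesseConics E)).ncard = 12 ∧
    Arrangement.sing (hesseConics E) = dualCusps E ∪ Arrangement.nodes (hesseConics E) ∧
    (Arrangement.sing (hesseConics E)).ncard = 21 ∧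
    (∀ C ∈ hesseConics E, (dualCusps E ∩ C.points).ncard = 6 ∧
      (Arrangement.nodes (hesseConics E) ∩ C.points).ncard = 2) ∧
    -- the nine lines of the dual Hesse arrangement
    (dualHesseLines E).ncard = 9 ∧
    Arrangement.sing (dualHesseLines E) = Arrangement.nodes (hesseConics E) ∧
    (∀ p ∈ Arrangement.sing (dualHesseLines E), Arrangement.mult (dualHesseLines E) p = 3) ∧
    (∀ L ∈ dualHesseLines E, (Arrangement.nodes (hesseConics E) ∩ L.points).ncard = 4 ∧
      (dualCusps E ∩ L.points).ncard = 1) ∧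
    -- the reducible quintic through all singular points
    (∃ L₁ ∈ dualHesseLines E, ∃ L₂ ∈ dualHesseLines E, ∃ L₃ ∈ dualHesseLines E,
      ∃ C ∈ hesseConics E, L₁ ≠ L₂ ∧ L₁ ≠ L₃ ∧ L₂ ≠ L₃ ∧
      ∃ Q : PlaneCurve, Q.degree = 5 ∧
        Associated Q.form (L₁.form * L₂.form * L₃.form * C.form) ∧
        Arrangement.sing (hesseConics E) ⊆ Q.points) ∧
    -- the configurational Seshadri constant, and the ratios of the conics and of the lines
    Arrangement.configurationalSeshadri (hesseConics E) = 1 / 4 ∧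
    (∀ C ∈ hesseConics E, C.seshadriRatio (Arrangement.sing (hesseConics E)) = 1 / 4) ∧
    (∀ L ∈ dualHesseLines E, L.IsIntegral ∧
      L.seshadriRatio (Arrangement.sing (hesseConics E)) = 1 / 5) ∧
    -- the multipoint Seshadri constant
    seshadriConstant (Arrangement.sing (hesseConics E)) = 1 / 5 ∧
    seshadriConstant (Arrangement.sing (hesseConics E)) <
      Arrangement.configurationalSeshadri (hesseConics E) := by 
  obtain ⟨H⟩ := nonempty_hesseConfiguration hdeg hsmooth hE
  have h21 : (Set.range H.cusp ∪ Set.range H.node).ncard = 21 := by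
    rw [Set.ncard_union_eq H.disjoint_cusp_node, Set.ncard_range_of_injective' H.cusp_injective,
      Set.ncard_range_of_injective' H.node_injective]
    decide
  rw [H.hesseConics_eq, H.dualHesseLines_eq, H.dualCusps_eq, H.nodes_conics, H.sing_conics,
    H.sing_lines, H.configurationalSeshadri_conics, H.seshadriConstant_eq]
  obtain ⟨Q, hQ⟩ := H.exists_quintic
  refine ⟨?_, H.isDArrangement, ?_, ?_, ?_, rfl, h21, ?_, ?_, rfl, ?_, ?_,
    ⟨_, ⟨(0, 0), rfl⟩, _, ⟨(0, 1), rfl⟩, _, ⟨(0, 2), rfl⟩, _, ⟨(none, 0), rfl⟩,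
      H.line_injective.ne (by decide), H.line_injective.ne (by decide),
      H.line_injective.ne (by decide), Q, hQ⟩, rfl, ?_, ?_, rfl, by norm_num⟩
  · rw [Set.ncard_range_of_injective' H.conic_injective]; decide
  · rw [Set.ncard_range_of_injective' H.cusp_injective]; decide
  · rintro _ ⟨a, rfl⟩
    exact H.mult_cusp a
  · rw [Set.ncard_range_of_injective' H.node_injective]; decide
  · rintro _ ⟨l, rfl⟩
    exact ⟨H.ncard_cusps_inter_conic l, H.ncard_nodes_inter_conic l⟩
  · rw [Set.ncard_range_of_injective' H.line_injective]; decide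
  · rintro _ ⟨l, rfl⟩
    exact H.mult_lines_node l
  · rintro _ ⟨a, rfl⟩
    exact ⟨H.ncard_nodes_inter_line a, H.ncard_cusps_inter_line a⟩
  · rintro _ ⟨l, rfl⟩
    exact H.seshadriRatio_conic l
  · rintro _ ⟨a, rfl⟩
    obtain ⟨φ, hφ⟩ := H.exists_line_parametrization a
    exact ⟨hφ.irreducible, H.seshadriRatio_line a⟩
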